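/- Let $L$ be Lebesgue measure on $\mathbb C$ and let $$\mathcal E=\{u:\mathbb C\to\mathbb C \;:\; u(z)=e^{-|z|^2/2}f(z),\ f \text{ entire}\}\cap L^2(\mathbb C)$$ be the Bargmann–Fock space. For $u\in\mathcal E$ put $$M(u)=\int_{\mathbb C}|u|^2\,dL,\qquad \mathcal H(u)=\frac14\int_{\mathbb C}|u|^4\,dL,\qquad P(u)=\int_{\mathbb C}(|z|^2-1)|u(z)|^2\,dL(z)\in(-\infty,+\infty],$$ and for $\mu>0$ let $\mathcal G_\mu(u)=8\pi\mathcal H(u)+\mu P(u)\in(-\infty,+\infty]$. A global minimizer of $\mathcal G_\mu$ is a function $u\in\mathcal E$ with $M(u)=1$ and $\mathcal G_\mu(u)\le \mathcal G_\mu(v)$ for all $v\in\mathcal E$ with $M(v)=1$. Let $\phi_1(z)=\frac1{\sqrt\pi}\,z\,e^{-|z|^2/2}$. **Theorem.** There exists $\mu_0\in[5/32,1/2)$ such that: 1. for all $\mu\in(\mu_0,1/2)$, $\phi_1$ is a global minimizer of $\mathcal G_\mu$, and it is the unique one up to phase and space rotations, that is, every global minimizer $u$ of $\mathcal G_\mu$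 has the form $u(z)=e^{i\gamma}\phi_1(e^{i\theta}z)$ with $\gamma,\theta\in\mathbb R$; 2. for all $\mu\in(0,\mu_0)$, every global minimizer of $\mathcal G_\mu$ has infinitely many zeros in $\mathbb C$. -/

import Mathlib

open MeasureTheory
open scoped ENNReal

noncomputable section

namespace LLL

/-- The Bargmann-Fock space: functions `u(z) = exp(-|z|²/2) f(z)` with `f` entire, such that
`u ∈ L²(ℂ)`. Its elements are continuous, so they are kept as genuine functions rather than as
classes modulo null sets. -/
def bargmannFock : Set (ℂ → ℂ) :=
  {u | (∃ f : ℂ → ℂ, Differentiable ℂ f ∧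
      ∀ z : ℂ, u z = (Real.exp (-‖z‖ ^ 2 / 2) : ℂ) * f z) ∧ MemLp u 2 volume}

/-- The mass `M(u) = ∫ |u|²`. -/
def mass (u : ℂ → ℂ) : ℝ≥0∞ := ∫⁻ z : ℂ, ‖u z‖ₑ ^ 2

/-- The Hamiltonian `H(u) = (1/4) ∫ |u|⁴`. -/
def hamiltonian (u : ℂ → ℂ) : ℝ≥0∞ := (∫⁻ z : ℂ, ‖u z‖ₑ ^ 4) / 4

/-- The angular momentum `P(u) = ∫ (|z|² - 1) |u(z)|²`, written as the difference of the integrals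
of `|z|² |u|²` and `|u|²`. For `u ∈ L²(ℂ)` the second one is finite, so that `P(u)` is the usual
integral with values in `(-∞, +∞]`; it is `+∞` exactly when `z u ∉ L²(ℂ)`. -/
def angularMomentum (u : ℂ → ℂ) : EReal :=
  ((∫⁻ z : ℂ, ‖z‖ₑ ^ 2 * ‖u z‖ₑ ^ 2 : ℝ≥0∞) : EReal) - ((∫⁻ z : ℂ, ‖u z‖ₑ ^ 2 : ℝ≥0∞) : EReal)

/-- The energy `G_μ(u) = 8π H(u) + μ P(u)`, with values in `(-∞, +∞]` when `u ∈ L²(ℂ)` and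
`μ > 0`. -/
def energy (μ : ℝ) (u : ℂ → ℂ) : EReal :=
  ((8 * Real.pi : ℝ) : EReal) * (hamiltonian u : EReal) + (μ : EReal) * angularMomentum u

/-- The constraint set: elements of the Bargmann-Fock space of unit mass. -/
def unitMass : Set (ℂ → ℂ) := {u | u ∈ bargmannFock ∧ mass u = 1}

/-- `u` is a global minimizer of `G_μ` over the elements of the Bargmann-Fock space of unit
mass. -/
def IsGlobalMinimizer (μ : ℝ) (u : ℂ → ℂ) : Prop :=
  u ∈ unitMass ∧ ∀ v ∈ unitMass, energy μ u ≤ energy μ v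

/-- Phase rotation `T_γ`. -/
def phaseRotation (γ : ℝ) (u : ℂ → ℂ) : ℂ → ℂ := fun z => Complex.exp (Complex.I * γ) * u z

/-- Space rotation `L_θ`. -/
def spaceRotation (θ : ℝ) (u : ℂ → ℂ) : ℂ → ℂ := fun z => u (Complex.exp (Complex.I * θ) * z)

/-- `φ₁(z) = π^{-1/2} z exp(-|z|²/2)`. -/
def phi1 : ℂ → ℂ := fun z =>
  ((1 / Real.sqrt Real.pi : ℝ) : ℂ) * z * (Real.exp (-‖z‖ ^ 2 / 2) : ℂ)

end LLL

end

open MeasureTheory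
open scoped ENNReal

noncomputable section

namespace LLL

/-! Expand f(z) = ∑ c_n z^n / √(π n!). For unit mass everything is read off the coefficients: M = ∑
|c_n|², P = ∑ n |c_n|², and 8πH = `quartC c` is the squared ℓ² norm of a weighted self-convolution
of c. The state φ₁ is the sequence supported at n = 1, with energy 1/2 + μ.

The central fact is 8πH + P/2 ≥ 1 (`two_le_quartC`). Write the product state u(x)u(y) in the
coordinates x = s + t, y = s - t. For fixed s the function h(t) = f(s+t) f(s-t) is entire and even,
and Parseval with weight exp(-2|t|²) gives π|h(0)|² + 2∫|t h|² ≥ 3∫|h|², with equality only for h(t)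
= a + b t². Integration over s yields the inequality. In the case of equality f has finitely many
zeros, so it is a polynomial times the exponential of a quadratic, and the form of h reduces it to
degree at most one times exp(βz). Among these states the only one with P ≥ 1 is φ₁, up to phase
(`equality_case`).

Let V be the set of μ for which φ₁ is minimal (`VortexMin`), and let μ₀ = inf V. For a fixed state
the required inequality is affine in μ, and it holds at μ = 1/2 by the central fact. Hence V is
closed upwards below 1/2, and a minimiser at a parameter strictly between a point of V and 1/2 must
realise equality, which gives uniqueness. An expansion near φ₁ together with compactness away from
it shows that V contains a point below 1/2 (`exists_vortexMin`), and the second variation at φ₁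
gives V ⊆ [5/32, ∞).

For μ < μ₀ suppose that a minimiser has finitely many zeros. Then f = p exp(αz² + βz), with |α| <
1/2 because P is finite, so the c_n decay geometrically. The Euler-Lagrange equation improves this
to decay faster than any geometric rate, which forces α = 0: the state is a translate of a
polynomial state. The same equation at the top frequencies leaves a single Fock mode at the origin
if the degree is at least 2 (`IsMinC.eq_single`), and the second variation excludes that mode
(`not_isMinC_single`). Degree at most 1 leaves only φ₁, so μ ∈ V, a contradiction. -/

/-! ### Parseval on circles and with Gaussian weights -/

open Real in
theorem integral_conj_expI_mul (m n : ℕ) :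
    ∫ θ in (-π)..π, (starRingEnd ℂ) (Complex.exp (m * (θ * Complex.I))) *
      Complex.exp (n * (θ * Complex.I)) = if m = n then (2 * π : ℂ) else 0 := by
  have h1 : ∀ θ : ℝ, (starRingEnd ℂ) (Complex.exp (m * (θ * Complex.I))) *
      Complex.exp (n * (θ * Complex.I)) = Complex.exp ((((n : ℂ) - m) * Complex.I) * θ) := by
    intro θ
    rw [← Complex.exp_conj, ← Complex.exp_add]
    congr 1
    simp
    ring
  simp_rw [h1]
  split_ifs with h
  · subst h
    simp
    ring
  · have hne : ((n : ℂ) - m) * Complex.I ≠ 0 := by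
      refine mul_ne_zero ?_ Complex.I_ne_zero
      rw [sub_ne_zero]
      exact fun h' => h (Nat.cast_injective h').symm
    rw [integral_exp_mul_complex hne]
    have : Complex.exp (((n : ℂ) - m) * Complex.I * (π : ℝ)) =
        Complex.exp (((n : ℂ) - m) * Complex.I * ((-π : ℝ) : ℂ)) := by
      rw [Complex.exp_eq_exp_iff_exists_int]
      refine ⟨(n : ℤ) - m, ?_⟩
      push_cast
      ring
    rw [this, sub_self, zero_div]

open Real in
/-- Parseval's identity on a circle for an absolutely convergent series of exponentials. -/
theorem hasSum_norm_sq_trigSeries (b : ℕ → ℂ) (hb : Summable fun n => ‖b n‖) :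
    HasSum (fun n => 2 * π * ‖b n‖ ^ 2)
      (∫ θ in (-π)..π, ‖∑' n : ℕ, b n * Complex.exp (n * (θ * Complex.I))‖ ^ 2) := by
  set G : ℝ → ℂ := fun θ => ∑' n : ℕ, b n * Complex.exp (n * (θ * Complex.I)) with hG
  have hnorm : ∀ (n : ℕ) (θ : ℝ), ‖Complex.exp (n * (θ * Complex.I))‖ = 1 := by
    intro n θ
    rw [show (n : ℂ) * (θ * Complex.I) = ((n * θ : ℝ) : ℂ) * Complex.I by push_cast; ring]
    exact Complex.norm_exp_ofReal_mul_I _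
  have hsum : ∀ θ : ℝ, HasSum (fun n : ℕ => b n * Complex.exp (n * (θ * Complex.I))) (G θ) := by
    intro θ
    refine Summable.hasSum (Summable.of_norm ?_)
    simpa [hnorm] using hb
  have hcont : Continuous G := by
    refine continuous_tsum (fun n => by fun_prop) hb ?_
    intro n θ
    simp [hnorm]
  have hGb : ∀ θ, ‖G θ‖ ≤ ∑' n, ‖b n‖ := by
    intro θ
    refine tsum_of_norm_bounded hb.hasSum ?_
    intro n
    simp [hnorm]
  -- The Fourier coefficients of `G` come from one termwise integration; expanding the second factor
  -- of `conj G * G` then uses them, so that no double series appears.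
  have h1 : ∀ n : ℕ, ∫ θ in (-π)..π, (starRingEnd ℂ) (G θ) * Complex.exp (n * (θ * Complex.I)) =
      2 * π * (starRingEnd ℂ) (b n) := by
    intro n
    have := intervalIntegral.hasSum_integral_of_dominated_convergence (μ := volume)
      (a := -π) (b := π)
      (F := fun (m : ℕ) (θ : ℝ) => (starRingEnd ℂ) (b m * Complex.exp (m * (θ * Complex.I))) *
        Complex.exp (n * (θ * Complex.I)))
      (f := fun θ => (starRingEnd ℂ) (G θ) * Complex.exp (n * (θ * Complex.I)))
      (fun m _ => ‖b m‖)
      (fun m => (by fun_prop : Continuous _).aestronglyMeasurable)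
      (fun m => Filter.Eventually.of_forall fun θ _ => by simp [hnorm])
      (Filter.Eventually.of_forall fun θ _ => hb)
      (by simp)
      (Filter.Eventually.of_forall fun θ _ =>
        ((Complex.hasSum_conj'.2 (hsum θ)).mul_right _))
    have h2 : ∀ m : ℕ, ∫ θ in (-π)..π, (starRingEnd ℂ) (b m * Complex.exp (m * (θ * Complex.I))) *
        Complex.exp (n * (θ * Complex.I)) =
        if m = n then 2 * π * (starRingEnd ℂ) (b n) else 0 := by
      intro m
      simp_rw [map_mul, mul_assoc]
      rw [intervalIntegral.integral_const_mul, integral_conj_expI_mul]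
      split_ifs with h
      · subst h; ring
      · simp
    simp_rw [h2] at this
    exact this.unique (hasSum_ite_eq n _)
  have h3 := intervalIntegral.hasSum_integral_of_dominated_convergence (μ := volume)
      (a := -π) (b := π)
      (F := fun (n : ℕ) (θ : ℝ) => (starRingEnd ℂ) (G θ) *
        (b n * Complex.exp (n * (θ * Complex.I))))
      (f := fun θ => (starRingEnd ℂ) (G θ) * G θ)
      (fun n _ => (∑' n, ‖b n‖) * ‖b n‖)
      (fun m => (by fun_prop : Continuous _).aestronglyMeasurable)
      (fun m => Filter.Eventually.of_forall fun θ _ => by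
        simp only [norm_mul, hnorm, mul_one, RCLike.norm_conj]
        exact mul_le_mul_of_nonneg_right (hGb θ) (norm_nonneg _))
      (Filter.Eventually.of_forall fun θ _ => hb.mul_left _)
      (by simp)
      (Filter.Eventually.of_forall fun θ _ => (hsum θ).mul_left _)
  have h4 : ∀ n : ℕ, ∫ θ in (-π)..π, (starRingEnd ℂ) (G θ) *
      (b n * Complex.exp (n * (θ * Complex.I))) = ((2 * π * ‖b n‖ ^ 2 : ℝ) : ℂ) := by
    intro n
    have : ∀ θ : ℝ, (starRingEnd ℂ) (G θ) * (b n * Complex.exp (n * (θ * Complex.I))) =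
      b n * ((starRingEnd ℂ) (G θ) * Complex.exp (n * (θ * Complex.I))) := fun θ => by ring
    simp_rw [this]
    rw [intervalIntegral.integral_const_mul, h1]
    rw [show b n * (2 * π * (starRingEnd ℂ) (b n)) = 2 * π * (b n * (starRingEnd ℂ) (b n)) by ring,
      Complex.mul_conj']
    push_cast
    ring
  simp_rw [h4, Complex.conj_mul'] at h3
  have h5 : ∫ θ in (-π)..π, ((‖G θ‖ : ℂ)) ^ 2 = ((∫ θ in (-π)..π, ‖G θ‖ ^ 2 : ℝ) : ℂ) := by
    rw [← intervalIntegral.integral_ofReal]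
    push_cast
    rfl
  rw [h5] at h3
  exact_mod_cast h3

open Real in
theorem lintegral_pow_mul_exp_neg_mul_sq (n : ℕ) {b : ℝ} (hb : 0 < b) :
    ∫⁻ r in Set.Ioi (0 : ℝ), ENNReal.ofReal (r ^ (2 * n + 1) * Real.exp (-b * r ^ 2)) =
      ENNReal.ofReal (n.factorial / (2 * b ^ (n + 1))) := by
  have h := integral_rpow_mul_exp_neg_mul_rpow (p := 2) (q := 2 * n + 1) (b := b) (by norm_num)
    (by have : (0 : ℝ) ≤ n := n.cast_nonneg
        linarith) hb
  have hconv : ∀ r : ℝ, r ^ (2 * n + 1) * Real.exp (-b * r ^ 2) =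
      r ^ (2 * (n : ℝ) + 1) * Real.exp (-b * r ^ (2 : ℝ)) := by
    intro r
    rw [Real.rpow_two, ← Real.rpow_natCast]
    push_cast
    rfl
  have e1 : (2 * (n : ℝ) + 1 + 1) / 2 = (n : ℝ) + 1 := by ring
  have e2 : -(2 * (n : ℝ) + 1 + 1) / 2 = -((n + 1 : ℕ) : ℝ) := by push_cast; ring
  rw [e1, e2, Real.Gamma_nat_eq_factorial, Real.rpow_neg hb.le, Real.rpow_natCast] at h
  rw [← ofReal_integral_eq_lintegral_ofReal]
  · congr 1
    simp_rw [hconv, h]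
    field_simp
  · simp_rw [hconv]
    refine integrableOn_rpow_mul_exp_neg_mul_rpow ?_ (by norm_num) hb
    have : (0 : ℝ) ≤ n := n.cast_nonneg
    linarith
  · refine (ae_restrict_iff' measurableSet_Ioi).2 (Filter.Eventually.of_forall ?_)
    intro r hr
    have : (0 : ℝ) < r := hr
    simp only [Pi.zero_apply]
    positivity

open Real in
theorem lintegral_circle_norm_sq {F : ℂ → ℂ} {a : ℕ → ℂ}
    (ha : ∀ z, HasSum (fun n => a n * z ^ n) (F z)) (r : ℝ) :
    ∫⁻ θ in Set.Ioo (-π) π, ‖F (r * Complex.exp (θ * Complex.I))‖ₑ ^ 2 =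
      ∑' n, ENNReal.ofReal (2 * π * (‖a n‖ ^ 2 * r ^ (2 * n))) := by
  have hb : Summable fun n => ‖a n * (r : ℂ) ^ n‖ := (ha r).summable.norm
  have h := hasSum_norm_sq_trigSeries (fun n => a n * (r : ℂ) ^ n) hb
  have hF : ∀ θ : ℝ, ∑' n : ℕ, a n * (r : ℂ) ^ n * Complex.exp (n * (θ * Complex.I)) =
      F (r * Complex.exp (θ * Complex.I)) := by
    intro θ
    rw [← (ha (r * Complex.exp (θ * Complex.I))).tsum_eq]
    congr 1
    ext n
    rw [mul_pow, ← Complex.exp_nat_mul, mul_assoc]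
  simp_rw [hF] at h
  have hcont : Continuous fun θ : ℝ => F (r * Complex.exp (θ * Complex.I)) := by
    simp_rw [← hF]
    refine continuous_tsum (fun n => by fun_prop) hb ?_
    intro n θ
    have hn : ‖Complex.exp (n * (θ * Complex.I))‖ = 1 := by
      rw [show (n : ℂ) * (θ * Complex.I) = ((n * θ : ℝ) : ℂ) * Complex.I by push_cast; ring]
      exact Complex.norm_exp_ofReal_mul_I _
    rw [norm_mul, hn, mul_one]
  have hnn : ∀ n, 0 ≤ 2 * π * ‖a n * (r : ℂ) ^ n‖ ^ 2 := fun n => by positivity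
  calc ∫⁻ θ in Set.Ioo (-π) π, ‖F (r * Complex.exp (θ * Complex.I))‖ₑ ^ 2
      = ∫⁻ θ in Set.Ioc (-π) π, ENNReal.ofReal (‖F (r * Complex.exp (θ * Complex.I))‖ ^ 2) := by
        rw [restrict_Ioo_eq_restrict_Ioc]
        refine lintegral_congr fun θ => ?_
        rw [ENNReal.ofReal_pow (norm_nonneg _), ofReal_norm]
    _ = ENNReal.ofReal (∫ θ in (-π)..π, ‖F (r * Complex.exp (θ * Complex.I))‖ ^ 2) := by
        rw [intervalIntegral.integral_of_le (by linarith [pi_pos]),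
          ofReal_integral_eq_lintegral_ofReal]
        · exact (hcont.norm.pow 2).integrableOn_Ioc
        · exact Filter.Eventually.of_forall fun θ => by positivity
    _ = _ := by
        rw [← h.tsum_eq, ENNReal.ofReal_tsum_of_nonneg hnn h.summable]
        congr 1
        ext n
        rw [norm_mul, norm_pow, mul_pow, ← pow_mul, mul_comm n 2, Complex.norm_real,
          Real.norm_eq_abs, (even_two_mul n).pow_abs]

open Real in
/-- Gaussian Parseval identity for entire functions. -/
theorem lintegral_norm_sq_gaussian {F : ℂ → ℂ} {a : ℕ → ℂ}
    (ha : ∀ z, HasSum (fun n => a n * z ^ n) (F z)) {b : ℝ} (hb : 0 < b) (hF : Continuous F) :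
    ∫⁻ z : ℂ, ‖F z‖ₑ ^ 2 * ENNReal.ofReal (Real.exp (-b * ‖z‖ ^ 2)) =
      ∑' n, ENNReal.ofReal (‖a n‖ ^ 2 * (π * n.factorial / b ^ (n + 1))) := by
  rw [← Complex.lintegral_comp_polarCoord_symm, polarCoord_target, Measure.volume_eq_prod,
    ← Measure.prod_restrict, lintegral_prod]
  · have hinner : ∀ r ∈ Set.Ioi (0 : ℝ), ∫⁻ θ in Set.Ioo (-π) π, ENNReal.ofReal r •
        (‖F (Complex.polarCoord.symm (r, θ))‖ₑ ^ 2 *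
          ENNReal.ofReal (Real.exp (-b * ‖Complex.polarCoord.symm (r, θ)‖ ^ 2))) =
        ∑' n, ENNReal.ofReal (2 * π * ‖a n‖ ^ 2) *
          ENNReal.ofReal (r ^ (2 * n + 1) * Real.exp (-b * r ^ 2)) := by
      intro r hr
      have hr' : (0 : ℝ) < r := hr
      have : ∀ θ : ℝ, ENNReal.ofReal r • (‖F (Complex.polarCoord.symm (r, θ))‖ₑ ^ 2 *
          ENNReal.ofReal (Real.exp (-b * ‖Complex.polarCoord.symm (r, θ)‖ ^ 2))) =
          ENNReal.ofReal (r * Real.exp (-b * r ^ 2)) *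
            ‖F (r * Complex.exp (θ * Complex.I))‖ₑ ^ 2 := by
        intro θ
        rw [ENNReal.ofReal_mul hr'.le, Complex.norm_polarCoord_symm, sq_abs,
          Complex.polarCoord_symm_apply, smul_eq_mul, Complex.exp_mul_I]
        push_cast
        ring
      simp_rw [this]
      rw [lintegral_const_mul' _ _ ENNReal.ofReal_ne_top, lintegral_circle_norm_sq ha,
        ← ENNReal.tsum_mul_left]
      congr 1
      ext n
      rw [← ENNReal.ofReal_mul (by positivity), ← ENNReal.ofReal_mul (by positivity)]
      congr 1
      ring
    rw [setLIntegral_congr_fun measurableSet_Ioi hinner, lintegral_tsum]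
    · congr 1
      ext n
      rw [lintegral_const_mul' _ _ ENNReal.ofReal_ne_top, lintegral_pow_mul_exp_neg_mul_sq n hb,
        ← ENNReal.ofReal_mul (by positivity)]
      congr 1
      field_simp
    · intro n
      fun_prop
  · have h1 : Measurable fun p : ℝ × ℝ => Complex.polarCoord.symm p := by
      have : (fun p : ℝ × ℝ => Complex.polarCoord.symm p) = fun p : ℝ × ℝ =>
          (p.1 : ℂ) * (Real.cos p.2 + Real.sin p.2 * Complex.I) := by
        ext p
        rw [Complex.polarCoord_symm_apply]
      rw [this]
      fun_prop
    have h2 : Measurable F := hF.measurable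
    fun_prop

/-! ### The functionals in terms of Fock coefficients -/

/-- Sequences of coefficients whose state has finite angular momentum. -/
def Tame (c : ℕ → ℂ) : Prop := Summable fun n : ℕ => ((n : ℝ) + 1) * ‖c n‖ ^ 2

/-- The mass of a sequence of coefficients. -/
def massC (c : ℕ → ℂ) : ℝ := ∑' n, ‖c n‖ ^ 2

/-- The angular momentum of a sequence of coefficients. -/
def angC (c : ℕ → ℂ) : ℝ := ∑' n : ℕ, (n : ℝ) * ‖c n‖ ^ 2

/-- Coefficients of `(z + w) u` in the Fock basis. -/
def shiftC (w : ℂ) (c : ℕ → ℂ) (n : ℕ) : ℂ := (√(n : ℝ) : ℂ) * c (n - 1) + w * c n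

/-- The second moment `∫ |z + w|² |u|²` in terms of coefficients. -/
def momC (w : ℂ) (c : ℕ → ℂ) : ℝ := ∑' n, ‖shiftC w c n‖ ^ 2

/-- The weights of the convolution structure of the square of a Fock state. -/
def wt (k i : ℕ) : ℝ := √((k.choose i : ℝ) / 2 ^ k)

/-- The polarised coefficients of the square of a Fock state. -/
def bil (c d : ℕ → ℂ) (k : ℕ) : ℂ :=
  ∑ p ∈ Finset.HasAntidiagonal.antidiagonal k, (wt k p.1 : ℂ) * (c p.1 * d p.2)

/-- The coefficients of the square of a Fock state. -/
def quad (c : ℕ → ℂ) (k : ℕ) : ℂ := bil c c k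

/-- The interaction energy `2π ∫ |u|⁴` in terms of coefficients. -/
def quartC (c : ℕ → ℂ) : ℝ := ∑' k, ‖quad c k‖ ^ 2

/-- The normalised Taylor coefficients. -/
def taylorC (c : ℕ → ℂ) (n : ℕ) : ℂ := c n / (√(Real.pi * n.factorial) : ℝ)

/-- The entire function with given Fock coefficients. -/
def fockFun (c : ℕ → ℂ) (z : ℂ) : ℂ := ∑' n, taylorC c n * z ^ n

/-- The translate by `w` of the Fock state with coefficients `c`. -/
def fockState (c : ℕ → ℂ) (w : ℂ) (z : ℂ) : ℂ :=
  (Real.exp (-‖z‖ ^ 2 / 2) : ℂ) *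
    (Complex.exp (z * (starRingEnd ℂ) w - (‖w‖ ^ 2 / 2 : ℝ)) * fockFun c (z - w))

theorem summable_norm_sq_of_tame {c : ℕ → ℂ} (hc : Tame c) : Summable fun n => ‖c n‖ ^ 2 := by
  refine Summable.of_nonneg_of_le (fun n => by positivity) (fun n => ?_) hc
  have : (0 : ℝ) ≤ n := n.cast_nonneg
  nlinarith [sq_nonneg ‖c n‖]

theorem summable_ang_of_tame {c : ℕ → ℂ} (hc : Tame c) :
    Summable fun n : ℕ => (n : ℝ) * ‖c n‖ ^ 2 := by
  refine Summable.of_nonneg_of_le (fun n => by positivity) (fun n => ?_) hc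
  nlinarith [sq_nonneg ‖c n‖]

theorem norm_taylorC_sq (c : ℕ → ℂ) (n : ℕ) :
    ‖taylorC c n‖ ^ 2 = ‖c n‖ ^ 2 / (Real.pi * n.factorial) := by
  rw [taylorC, norm_div, Complex.norm_real, Real.norm_eq_abs, div_pow, sq_abs,
    Real.sq_sqrt (by positivity)]

theorem summable_taylorC {c : ℕ → ℂ} (hc : Summable fun n => ‖c n‖ ^ 2) (z : ℂ) :
    Summable fun n => ‖taylorC c n * z ^ n‖ := by
  have h1 : Summable fun n : ℕ => (‖z‖ ^ 2) ^ n / n.factorial := Real.summable_pow_div_factorial _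
  refine Summable.of_nonneg_of_le (fun n => norm_nonneg _) (fun n => ?_)
    ((hc.add (h1.mul_left (1 / Real.pi))).mul_left (1 / 2))
  have h2 : ‖taylorC c n * z ^ n‖ =
      ‖c n‖ * (‖z‖ ^ n / √(Real.pi * n.factorial)) := by
    rw [norm_mul, taylorC, norm_div, norm_pow, Complex.norm_real, Real.norm_eq_abs,
      abs_of_nonneg (Real.sqrt_nonneg _)]
    ring
  have h3 : (‖z‖ ^ n / √(Real.pi * n.factorial)) ^ 2 =
      1 / Real.pi * ((‖z‖ ^ 2) ^ n / n.factorial) := by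
    rw [div_pow, Real.sq_sqrt (by positivity), ← pow_mul, ← pow_mul, mul_comm n 2]
    field_simp
  rw [h2, ← h3]
  nlinarith [sq_nonneg (‖c n‖ - ‖z‖ ^ n / √(Real.pi * n.factorial))]

theorem hasSum_fockFun {c : ℕ → ℂ} (hc : Summable fun n => ‖c n‖ ^ 2) (z : ℂ) :
    HasSum (fun n => taylorC c n * z ^ n) (fockFun c z) :=
  (summable_taylorC hc z).of_norm.hasSum

theorem differentiable_of_hasSum_pow {F : ℂ → ℂ} {a : ℕ → ℂ}
    (ha : ∀ z, HasSum (fun n => a n * z ^ n) (F z)) : Differentiable ℂ F := by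
  have hF : F = fun z => ∑' n, a n * z ^ n := by
    ext z
    exact (ha z).tsum_eq.symm
  intro z
  have h : DifferentiableOn ℂ F (Metric.ball 0 (‖z‖ + 1)) := by
    rw [hF]
    refine Complex.differentiableOn_tsum_of_summable_norm
      (u := fun n => ‖a n * ((‖z‖ + 1 : ℝ) : ℂ) ^ n‖) (ha _).summable.norm
      (fun n => by fun_prop) Metric.isOpen_ball (fun n w hw => ?_)
    have hw' : ‖w‖ < ‖z‖ + 1 := by simpa using hw
    rw [norm_mul, norm_mul, norm_pow, norm_pow, Complex.norm_real, Real.norm_eq_abs,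
      abs_of_pos (by positivity : 0 < ‖z‖ + 1)]
    gcongr
  exact h.differentiableAt (Metric.isOpen_ball.mem_nhds (by simp))

theorem differentiable_fockFun {c : ℕ → ℂ} (hc : Summable fun n => ‖c n‖ ^ 2) :
    Differentiable ℂ (fockFun c) :=
  differentiable_of_hasSum_pow (hasSum_fockFun hc)

theorem hasSum_mul_pow {F G : ℂ → ℂ} {a b : ℕ → ℂ}
    (ha : ∀ z, HasSum (fun n => a n * z ^ n) (F z))
    (hb : ∀ z, HasSum (fun n => b n * z ^ n) (G z)) (z : ℂ) :
    HasSum (fun n => (∑ p ∈ Finset.HasAntidiagonal.antidiagonal n, a p.1 * b p.2) * z ^ n) (F z * G z) := by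
  have h := (summable_norm_sum_mul_antidiagonal_of_summable_norm
    (ha z).summable.norm (hb z).summable.norm).of_norm.hasSum
  rw [← tsum_mul_tsum_eq_tsum_sum_antidiagonal_of_summable_norm
    (ha z).summable.norm (hb z).summable.norm, (ha z).tsum_eq, (hb z).tsum_eq] at h
  refine h.congr_fun fun n => ?_
  rw [Finset.sum_mul]
  refine Finset.sum_congr rfl fun p hp => ?_
  rw [← Finset.HasAntidiagonal.mem_antidiagonal.1 hp, pow_add]
  ring

theorem wt_sq (k i : ℕ) : wt k i ^ 2 = (k.choose i : ℝ) / 2 ^ k :=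
  Real.sq_sqrt (by positivity)

theorem wt_nonneg (k i : ℕ) : 0 ≤ wt k i := Real.sqrt_nonneg _

theorem wt_symm {k i j : ℕ} (h : i + j = k) : wt k i = wt k j := by
  rw [wt, wt, Nat.choose_symm_of_eq_add h.symm]

theorem sum_wt_sq (k : ℕ) : ∑ p ∈ Finset.HasAntidiagonal.antidiagonal k, wt k p.1 ^ 2 = 1 := by
  simp_rw [wt_sq]
  rw [← Finset.sum_div, Finset.Nat.sum_antidiagonal_eq_sum_range_succ (fun i _ => (k.choose i : ℝ)),
    ← Nat.cast_sum, Nat.sum_range_choose]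
  push_cast
  field_simp

/-- The scalar in front is, up to a factor independent of k, the normalisation of z^k for the weight
exp(-2|z|²), so the quartic energy becomes a plain ℓ² sum. What remains in `bil` are square roots of
the binomial probabilities with parameter 1/2. -/
theorem sum_taylorC_mul (c d : ℕ → ℂ) (k : ℕ) :
    ∑ p ∈ Finset.HasAntidiagonal.antidiagonal k, taylorC c p.1 * taylorC d p.2 =
      ((√(2 ^ k / k.factorial) / Real.pi : ℝ) : ℂ) * bil c d k := by
  rw [bil, Finset.mul_sum]
  refine Finset.sum_congr rfl fun p hp => ?_
  have hk := Finset.HasAntidiagonal.mem_antidiagonal.1 hp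
  have hc : (k.choose p.1 : ℝ) = k.factorial / (p.1.factorial * p.2.factorial) := by
    rw [← hk, Nat.choose_symm_add, Nat.add_choose, Nat.cast_div (Nat.factorial_mul_factorial_dvd_factorial_add _ _)
      (by positivity)]
    push_cast
    rfl
  have hkey : √(2 ^ k / k.factorial) / Real.pi * wt k p.1 =
      1 / (√(Real.pi * p.1.factorial) * √(Real.pi * p.2.factorial)) := by
    rw [wt, hc, ← Real.sqrt_mul (by positivity), div_mul_eq_mul_div,
      ← Real.sqrt_mul (by positivity)]
    have e1 : (2 : ℝ) ^ k / k.factorial * (k.factorial / (p.1.factorial * p.2.factorial) / 2 ^ k) =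
      1 / (p.1.factorial * p.2.factorial) := by
      field_simp
    have e2 : Real.pi * p.1.factorial * (Real.pi * p.2.factorial) =
      Real.pi ^ 2 * (p.1.factorial * p.2.factorial) := by ring
    rw [e1, e2, Real.sqrt_mul (by positivity), Real.sqrt_sq Real.pi_pos.le,
      Real.sqrt_div (by positivity), Real.sqrt_one]
    field_simp
  have hkey' : ((√(2 ^ k / k.factorial) / Real.pi : ℝ) : ℂ) * (wt k p.1 : ℂ) =
      1 / ((√(Real.pi * p.1.factorial) : ℝ) * (√(Real.pi * p.2.factorial) : ℝ)) := by
    rw [← Complex.ofReal_mul, hkey]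
    push_cast
    rfl
  rw [← mul_assoc, hkey', taylorC, taylorC]
  field_simp

theorem hasSum_fockFun_mul {c d : ℕ → ℂ} (hc : Summable fun n => ‖c n‖ ^ 2)
    (hd : Summable fun n => ‖d n‖ ^ 2) (z : ℂ) :
    HasSum (fun k => ((√(2 ^ k / k.factorial) / Real.pi : ℝ) : ℂ) * bil c d k * z ^ k)
      (fockFun c z * fockFun d z) := by
  simp_rw [← sum_taylorC_mul]
  exact hasSum_mul_pow (hasSum_fockFun hc) (hasSum_fockFun hd) z

/-- Cauchy-Schwarz, the squared weights on each antidiagonal being a probability distribution. -/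
theorem norm_bil_sq_le (c d : ℕ → ℂ) (k : ℕ) :
    ‖bil c d k‖ ^ 2 ≤ ∑ p ∈ Finset.HasAntidiagonal.antidiagonal k, ‖c p.1‖ ^ 2 * ‖d p.2‖ ^ 2 := by
  have h1 : ‖bil c d k‖ ≤ ∑ p ∈ Finset.HasAntidiagonal.antidiagonal k, wt k p.1 * (‖c p.1‖ * ‖d p.2‖) := by
    refine (norm_sum_le _ _).trans (Finset.sum_le_sum fun p _ => ?_)
    rw [norm_mul, norm_mul, Complex.norm_real, Real.norm_eq_abs, abs_of_nonneg (wt_nonneg _ _)]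
  calc ‖bil c d k‖ ^ 2 ≤ (∑ p ∈ Finset.HasAntidiagonal.antidiagonal k, wt k p.1 * (‖c p.1‖ * ‖d p.2‖)) ^ 2 := by
        gcongr
    _ ≤ (∑ p ∈ Finset.HasAntidiagonal.antidiagonal k, wt k p.1 ^ 2) *
        ∑ p ∈ Finset.HasAntidiagonal.antidiagonal k, (‖c p.1‖ * ‖d p.2‖) ^ 2 :=
        Finset.sum_mul_sq_le_sq_mul_sq _ _ _
    _ = _ := by
        rw [sum_wt_sq, one_mul]
        simp_rw [mul_pow]

theorem summable_norm_bil_sq {c d : ℕ → ℂ} (hc : Summable fun n => ‖c n‖ ^ 2)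
    (hd : Summable fun n => ‖d n‖ ^ 2) : Summable fun k => ‖bil c d k‖ ^ 2 := by
  refine Summable.of_nonneg_of_le (fun k => by positivity) (fun k => norm_bil_sq_le c d k) ?_
  exact summable_sum_mul_antidiagonal_of_summable_mul (f := fun n => ‖c n‖ ^ 2)
    (g := fun n => ‖d n‖ ^ 2) (hc.mul_of_nonneg hd (fun _ => by positivity) fun _ => by positivity)

theorem summable_norm_quad_sq {c : ℕ → ℂ} (hc : Summable fun n => ‖c n‖ ^ 2) :
    Summable fun k => ‖quad c k‖ ^ 2 := summable_norm_bil_sq hc hc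

theorem summable_norm_shiftC_sq {c : ℕ → ℂ} (hc : Tame c) (w : ℂ) :
    Summable fun n => ‖shiftC w c n‖ ^ 2 := by
  have h1 : Summable fun n : ℕ => (n : ℝ) * ‖c (n - 1)‖ ^ 2 := by
    rw [← summable_nat_add_iff 1]
    simpa [Tame] using hc
  refine Summable.of_nonneg_of_le (fun k => by positivity) (fun n => ?_)
    ((h1.add ((summable_norm_sq_of_tame hc).mul_left (‖w‖ ^ 2))).mul_left 2)
  have h2 : ‖shiftC w c n‖ ≤ √n * ‖c (n - 1)‖ + ‖w‖ * ‖c n‖ := by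
    refine (norm_add_le _ _).trans (le_of_eq ?_)
    rw [norm_mul, norm_mul, Complex.norm_real, Real.norm_eq_abs, abs_of_nonneg (Real.sqrt_nonneg _)]
  have h3 : √(n : ℝ) ^ 2 = n := Real.sq_sqrt (by positivity)
  calc ‖shiftC w c n‖ ^ 2 ≤ (√n * ‖c (n - 1)‖ + ‖w‖ * ‖c n‖) ^ 2 := by gcongr
    _ ≤ 2 * ((√(n : ℝ) ^ 2) * ‖c (n - 1)‖ ^ 2 + ‖w‖ ^ 2 * ‖c n‖ ^ 2) := by
        nlinarith [sq_nonneg (√n * ‖c (n - 1)‖ - ‖w‖ * ‖c n‖)]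
    _ = _ := by rw [h3]

theorem momC_zero {c : ℕ → ℂ} (hc : Tame c) : momC 0 c = massC c + angC c := by
  have h : ∀ n, ‖shiftC 0 c n‖ ^ 2 = (n : ℝ) * ‖c (n - 1)‖ ^ 2 := by
    intro n
    rw [shiftC, zero_mul, add_zero, norm_mul, mul_pow, Complex.norm_real, Real.norm_eq_abs, sq_abs,
      Real.sq_sqrt n.cast_nonneg]
  have hs := summable_norm_shiftC_sq hc 0
  rw [momC, hs.tsum_eq_zero_add, massC, angC, ← (summable_norm_sq_of_tame hc).tsum_add
    (summable_ang_of_tame hc)]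
  simp_rw [h]
  simp only [Nat.cast_zero, zero_mul, zero_add, Nat.add_sub_cancel]
  congr 1
  ext n
  push_cast
  ring

theorem ofReal_exp_mul_self (a b : ℝ) (h : 2 * a = b) :
    ENNReal.ofReal (Real.exp a) ^ 2 = ENNReal.ofReal (Real.exp b) := by
  rw [← ENNReal.ofReal_pow (Real.exp_pos _).le, ← Real.exp_nat_mul]
  congr 2

/-- The exponential in `fockState` is that of a magnetic translation: its modulus moves the centre
of the Gaussian from 0 to w. Mass and quartic energy therefore do not depend on w; only the second
moment does. -/
theorem norm_fockState (c : ℕ → ℂ) (w z : ℂ) :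
    ‖fockState c w z‖ = Real.exp (-‖z - w‖ ^ 2 / 2) * ‖fockFun c (z - w)‖ := by
  rw [fockState, norm_mul, norm_mul, Complex.norm_real, Real.norm_eq_abs, Real.abs_exp,
    Complex.norm_exp, ← mul_assoc, ← Real.exp_add]
  congr 2
  have h : ‖z - w‖ ^ 2 = ‖z‖ ^ 2 + ‖w‖ ^ 2 - 2 * (z * (starRingEnd ℂ) w).re := by
    rw [Complex.sq_norm, Complex.sq_norm, Complex.sq_norm, Complex.normSq_sub]
  rw [h]
  simp only [Complex.sub_re, Complex.ofReal_re]
  ring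

theorem enorm_fockState (c : ℕ → ℂ) (w z : ℂ) :
    ‖fockState c w z‖ₑ =
      ENNReal.ofReal (Real.exp (-‖z - w‖ ^ 2 / 2)) * ‖fockFun c (z - w)‖ₑ := by
  rw [← ofReal_norm, norm_fockState, ENNReal.ofReal_mul (Real.exp_pos _).le, ofReal_norm]

theorem continuous_fockState {c : ℕ → ℂ} (hc : Summable fun n => ‖c n‖ ^ 2) (w : ℂ) :
    Continuous (fockState c w) := by
  have := (differentiable_fockFun hc).continuous
  unfold fockState
  fun_prop

theorem mass_fockState {c : ℕ → ℂ} (hc : Summable fun n => ‖c n‖ ^ 2) (w : ℂ) :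
    mass (fockState c w) = ENNReal.ofReal (massC c) := by
  have h1 : ∀ z, ‖fockState c w z‖ₑ ^ 2 = (fun y => ‖fockFun c y‖ₑ ^ 2 *
      ENNReal.ofReal (Real.exp (-1 * ‖y‖ ^ 2))) (z - w) := by
    intro z
    rw [enorm_fockState, mul_pow, ofReal_exp_mul_self _ (-1 * ‖z - w‖ ^ 2) (by ring), mul_comm]
  rw [mass]
  simp_rw [h1]
  rw [lintegral_sub_right_eq_self (fun y => ‖fockFun c y‖ₑ ^ 2 *
      ENNReal.ofReal (Real.exp (-1 * ‖y‖ ^ 2))) w,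
    lintegral_norm_sq_gaussian (hasSum_fockFun hc) one_pos (differentiable_fockFun hc).continuous,
    massC, ENNReal.ofReal_tsum_of_nonneg (fun n => by positivity) hc]
  congr 1
  ext n
  rw [norm_taylorC_sq]
  congr 1
  have : (n.factorial : ℝ) ≠ 0 := by positivity
  field_simp
  simp

theorem lintegral_norm_fockState_pow_four {c : ℕ → ℂ} (hc : Summable fun n => ‖c n‖ ^ 2) (w : ℂ) :
    ∫⁻ z, ‖fockState c w z‖ₑ ^ 4 = ENNReal.ofReal (quartC c / (2 * Real.pi)) := by
  have hd := (differentiable_fockFun hc).continuous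
  have h1 : ∀ z, ‖fockState c w z‖ₑ ^ 4 = (fun y => ‖fockFun c y * fockFun c y‖ₑ ^ 2 *
      ENNReal.ofReal (Real.exp (-2 * ‖y‖ ^ 2))) (z - w) := by
    intro z
    simp only
    rw [enorm_fockState, mul_pow, show 4 = 2 * 2 from rfl, pow_mul,
      ofReal_exp_mul_self _ (-‖z - w‖ ^ 2) (by ring),
      ofReal_exp_mul_self _ (-2 * ‖z - w‖ ^ 2) (by ring), enorm_mul, pow_mul, ← sq, mul_comm]
  simp_rw [h1]
  rw [lintegral_sub_right_eq_self (fun y => ‖fockFun c y * fockFun c y‖ₑ ^ 2 *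
      ENNReal.ofReal (Real.exp (-2 * ‖y‖ ^ 2))) w,
    lintegral_norm_sq_gaussian (hasSum_fockFun_mul hc hc) two_pos (hd.mul hd),
    quartC, ← tsum_div_const, ENNReal.ofReal_tsum_of_nonneg (fun n => by positivity)
      ((summable_norm_quad_sq hc).div_const _)]
  congr 1
  ext k
  rw [norm_mul, mul_pow, Complex.norm_real, Real.norm_eq_abs, sq_abs, div_pow,
    Real.sq_sqrt (by positivity)]
  congr 1
  have : (k.factorial : ℝ) ≠ 0 := by positivity
  rw [quad, pow_succ (2 : ℝ) k]
  field_simp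

theorem hasSum_shift {F : ℂ → ℂ} {a : ℕ → ℂ}
    (ha : ∀ z, HasSum (fun n => a n * z ^ n) (F z)) (w z : ℂ) :
    HasSum (fun n => ((if n = 0 then 0 else a (n - 1)) + w * a n) * z ^ n) ((z + w) * F z) := by
  have h1 : HasSum (fun n => (if n = 0 then 0 else a (n - 1)) * z ^ n) (z * F z) := by
    rw [← hasSum_nat_add_iff' 1]
    simp only [Finset.range_one, Finset.sum_singleton, if_true, zero_mul, sub_zero,
      Nat.add_eq_zero_iff, one_ne_zero, and_false, if_false, Nat.add_sub_cancel]
    refine ((ha z).mul_left z).congr_fun fun n => ?_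
    ring
  rw [add_mul]
  refine (h1.add ((ha z).mul_left w)).congr_fun fun n => ?_
  ring

theorem lintegral_moment_fockState {c : ℕ → ℂ} (hc : Summable fun n => ‖c n‖ ^ 2) (w : ℂ) :
    ∫⁻ z, ‖z‖ₑ ^ 2 * ‖fockState c w z‖ₑ ^ 2 = ∑' n, ENNReal.ofReal (‖shiftC w c n‖ ^ 2) := by
  have hd := (differentiable_fockFun hc).continuous
  have h1 : ∀ z, ‖z‖ₑ ^ 2 * ‖fockState c w z‖ₑ ^ 2 = (fun y => ‖(y + w) * fockFun c y‖ₑ ^ 2 *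
      ENNReal.ofReal (Real.exp (-1 * ‖y‖ ^ 2))) (z - w) := by
    intro z
    simp only
    rw [enorm_fockState, mul_pow, ofReal_exp_mul_self _ (-1 * ‖z - w‖ ^ 2) (by ring),
      enorm_mul, sub_add_cancel, mul_pow]
    ring
  simp_rw [h1]
  rw [lintegral_sub_right_eq_self (fun y => ‖(y + w) * fockFun c y‖ₑ ^ 2 *
      ENNReal.ofReal (Real.exp (-1 * ‖y‖ ^ 2))) w,
    lintegral_norm_sq_gaussian (hasSum_shift (hasSum_fockFun hc) w) one_pos (by fun_prop)]
  congr 1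
  ext n
  have h2 : (if n = 0 then 0 else taylorC c (n - 1)) + w * taylorC c n =
      shiftC w c n / (√(Real.pi * n.factorial) : ℝ) := by
    -- At n = 0 the truncated index `n - 1` in `shiftC` is harmless, since it is multiplied by √0.
    rcases n with _ | n
    · simp [shiftC, taylorC, mul_div_assoc]
    · simp only [Nat.add_eq_zero_iff, one_ne_zero, and_false, if_false, Nat.add_sub_cancel,
        taylorC, shiftC, add_div, mul_div_assoc]
      congr 1
      rw [Nat.factorial_succ, Nat.cast_mul,
        show Real.pi * (((n + 1 : ℕ) : ℝ) * n.factorial) =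
          ((n + 1 : ℕ) : ℝ) * (Real.pi * n.factorial) by ring, Real.sqrt_mul (by positivity : (0 : ℝ) ≤ ((n + 1 : ℕ) : ℝ))]
      have h3 : ((√((n + 1 : ℕ) : ℝ) : ℝ) : ℂ) ≠ 0 := by
        rw [Complex.ofReal_ne_zero]
        positivity
      rw [Complex.ofReal_mul √((n + 1 : ℕ) : ℝ), ← mul_div_assoc, mul_div_mul_left _ _ h3]
  rw [h2, norm_div, div_pow, Complex.norm_real, Real.norm_eq_abs, sq_abs,
    Real.sq_sqrt (by positivity)]
  congr 1
  have : (n.factorial : ℝ) ≠ 0 := by positivity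
  field_simp
  simp

theorem massC_nonneg (c : ℕ → ℂ) : 0 ≤ massC c := tsum_nonneg fun _ => by positivity
theorem quartC_nonneg (c : ℕ → ℂ) : 0 ≤ quartC c := tsum_nonneg fun _ => by positivity
theorem momC_nonneg (w : ℂ) (c : ℕ → ℂ) : 0 ≤ momC w c := tsum_nonneg fun _ => by positivity

theorem energy_fockState {c : ℕ → ℂ} (hc : Tame c) (h1 : massC c = 1) (w : ℂ) (μ : ℝ) :
    energy μ (fockState c w) = ((quartC c + μ * (momC w c - 1) : ℝ) : EReal) := by
  have hs := summable_norm_sq_of_tame hc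
  have hm : mass (fockState c w) = 1 := by rw [mass_fockState hs, h1, ENNReal.ofReal_one]
  have hmom : ∫⁻ z, ‖z‖ₑ ^ 2 * ‖fockState c w z‖ₑ ^ 2 = ENNReal.ofReal (momC w c) := by
    rw [lintegral_moment_fockState hs, momC,
      ENNReal.ofReal_tsum_of_nonneg (fun n => by positivity) (summable_norm_shiftC_sq hc w)]
  have hham : hamiltonian (fockState c w) = ENNReal.ofReal (quartC c / (8 * Real.pi)) := by
    rw [hamiltonian, lintegral_norm_fockState_pow_four hs,
      show (4 : ℝ≥0∞) = ENNReal.ofReal 4 by simp, ← ENNReal.ofReal_div_of_pos (by norm_num)]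
    congr 1
    field_simp
    ring
  rw [mass] at hm
  rw [energy, angularMomentum, hmom, hm, hham, EReal.coe_ennreal_ofReal, EReal.coe_ennreal_ofReal,
    max_eq_left (div_nonneg (quartC_nonneg c) (by positivity)), max_eq_left (momC_nonneg w c)]
  rw [EReal.coe_ennreal_one, ← EReal.coe_one, ← EReal.coe_sub, ← EReal.coe_mul, ← EReal.coe_mul,
    ← EReal.coe_add]
  congr 2
  field_simp

theorem fockState_mem_bargmannFock {c : ℕ → ℂ} (hc : Summable fun n => ‖c n‖ ^ 2) (w : ℂ) :
    fockState c w ∈ bargmannFock := by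
  refine ⟨⟨fun z => Complex.exp (z * (starRingEnd ℂ) w - (‖w‖ ^ 2 / 2 : ℝ)) * fockFun c (z - w),
    ?_, fun z => rfl⟩, ?_⟩
  · have := differentiable_fockFun hc
    fun_prop
  · refine ⟨(continuous_fockState hc w).aestronglyMeasurable, ?_⟩
    rw [eLpNorm_lt_top_iff_lintegral_rpow_enorm_lt_top two_ne_zero ENNReal.ofNat_ne_top]
    have := mass_fockState hc w
    rw [mass] at this
    simp only [ENNReal.toReal_ofNat, ENNReal.rpow_ofNat]
    rw [this]
    exact ENNReal.ofReal_lt_top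

theorem fockState_mem_unitMass {c : ℕ → ℂ} (hc : Summable fun n => ‖c n‖ ^ 2) (h1 : massC c = 1)
    (w : ℂ) : fockState c w ∈ unitMass :=
  ⟨fockState_mem_bargmannFock hc w, by rw [mass_fockState hc, h1, ENNReal.ofReal_one]⟩

theorem fockState_zero_apply (c : ℕ → ℂ) (z : ℂ) :
    fockState c 0 z = (Real.exp (-‖z‖ ^ 2 / 2) : ℂ) * fockFun c z := by
  simp [fockState]

theorem exists_coeff_of_mem_unitMass {u : ℂ → ℂ} (hu : u ∈ unitMass) :
    ∃ c : ℕ → ℂ, (Summable fun n => ‖c n‖ ^ 2) ∧ massC c = 1 ∧ u = fockState c 0 := by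
  obtain ⟨⟨⟨f, hf, huf⟩, -⟩, hmass⟩ := hu
  set a : ℕ → ℂ := fun n => (n.factorial : ℂ)⁻¹ * iteratedDeriv n f 0 with ha_def
  have ha : ∀ z, HasSum (fun n => a n * z ^ n) (f z) := by
    intro z
    have := Complex.hasSum_taylorSeries_of_entire hf 0 z
    simp only [sub_zero, smul_eq_mul] at this
    refine this.congr_fun fun n => ?_
    rw [ha_def]
    ring
  set c : ℕ → ℂ := fun n => a n * (√(Real.pi * n.factorial) : ℝ) with hc_def
  have hac : ∀ n, taylorC c n = a n := by
    intro n
    have : ((√(Real.pi * n.factorial) : ℝ) : ℂ) ≠ 0 := by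
      rw [Complex.ofReal_ne_zero]
      positivity
    rw [taylorC, hc_def]
    field_simp
  have hff : fockFun c = f := by
    ext z
    rw [fockFun]
    simp_rw [hac]
    exact (ha z).tsum_eq
  have hu' : u = fockState c 0 := by
    ext z
    rw [fockState_zero_apply, hff, huf]
  have htot : ∑' n, ENNReal.ofReal (‖c n‖ ^ 2) = 1 := by
    rw [← hmass, mass]
    have h1 : ∀ z, ‖u z‖ₑ ^ 2 = ‖f z‖ₑ ^ 2 * ENNReal.ofReal (Real.exp (-1 * ‖z‖ ^ 2)) := by
      intro z
      rw [hu', enorm_fockState, sub_zero, mul_pow,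
        ofReal_exp_mul_self _ (-1 * ‖z‖ ^ 2) (by ring), hff, mul_comm]
    simp_rw [h1]
    rw [lintegral_norm_sq_gaussian ha one_pos hf.continuous]
    congr 1
    ext n
    rw [← hac, norm_taylorC_sq]
    congr 1
    have : (n.factorial : ℝ) ≠ 0 := by positivity
    field_simp
    simp
  have hsum : Summable fun n => ‖c n‖ ^ 2 := by
    have h2 : ∑' n, ENNReal.ofReal (‖c n‖ ^ 2) ≠ ⊤ := by rw [htot]; exact ENNReal.one_ne_top
    have h3 := ENNReal.summable_toReal h2
    simpa [ENNReal.toReal_ofReal, sq_nonneg] using h3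
  refine ⟨c, hsum, ?_, hu'⟩
  rw [← ENNReal.ofReal_tsum_of_nonneg (fun n => by positivity) hsum] at htot
  rw [massC]
  exact ENNReal.ofReal_eq_one.1 htot

/-- If c is not tame the second moment is infinite, so μP = +∞, and the nonnegative quartic term
cannot cancel it. -/
theorem tame_of_energy_ne_top {c : ℕ → ℂ} (hc : Summable fun n => ‖c n‖ ^ 2) (h1 : massC c = 1)
    {μ : ℝ} (hμ : 0 < μ) (h : energy μ (fockState c 0) ≠ ⊤) : Tame c := by
  by_contra hT
  apply h
  have hmom : ∫⁻ z, ‖z‖ₑ ^ 2 * ‖fockState c 0 z‖ₑ ^ 2 = ⊤ := by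
    rw [lintegral_moment_fockState hc]
    by_contra h2
    apply hT
    have h3 := ENNReal.summable_toReal h2
    rw [← summable_nat_add_iff 1] at h3
    refine h3.congr fun n => ?_
    rw [ENNReal.toReal_ofReal (by positivity), shiftC, zero_mul, add_zero, norm_mul, mul_pow,
      Complex.norm_real, Real.norm_eq_abs, sq_abs, Real.sq_sqrt (by positivity)]
    push_cast
    simp
  have hm : ∫⁻ z, ‖fockState c 0 z‖ₑ ^ 2 = 1 := by
    rw [← mass, mass_fockState hc, h1, ENNReal.ofReal_one]
  rw [energy, angularMomentum, hmom, hm, EReal.coe_ennreal_top, EReal.coe_ennreal_one,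
    ← EReal.coe_one, EReal.top_sub_coe, EReal.coe_mul_top_of_pos hμ]
  refine EReal.add_top_of_ne_bot ?_
  have h4 : (0 : EReal) ≤ ((8 * Real.pi : ℝ) : EReal) * (hamiltonian (fockState c 0) : EReal) := by
    refine mul_nonneg ?_ (EReal.coe_ennreal_nonneg _)
    exact_mod_cast (by positivity : (0 : ℝ) ≤ 8 * Real.pi)
  intro h5
  rw [h5] at h4
  simp at h4

/-! ### The basic inequality through centre of mass and relative coordinates -/

theorem lintegral_comp_two_mul (G : ℂ → ℝ≥0∞) (hG : Measurable G) :
    ∫⁻ x, G x = 4 * ∫⁻ t : ℂ, G (2 * t) := by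
  have h := Measure.map_addHaar_smul (volume : Measure ℂ) (r := 2) two_ne_zero
  have h2 : ∫⁻ t : ℂ, G ((2 : ℝ) • t) = ∫⁻ x, G x ∂(Measure.map ((2 : ℝ) • ·) volume) :=
    (lintegral_map hG (measurable_const_smul (2 : ℝ))).symm
  have h3 : ∀ t : ℂ, G (2 * t) = G ((2 : ℝ) • t) := fun t => by
    rw [Complex.real_smul]
    push_cast
    rfl
  simp_rw [h3]
  rw [h2, h, lintegral_smul_measure, Complex.finrank_real_complex, smul_eq_mul, ← mul_assoc,
    show (4 : ℝ≥0∞) = ENNReal.ofReal 4 by simp, ← ENNReal.ofReal_mul (by norm_num)]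
  norm_num

/-- Change of variables to the centre of mass and relative coordinates. -/
theorem lintegral_lintegral_add_sub {F : ℂ → ℂ → ℝ≥0∞} (hF : Measurable (Function.uncurry F)) :
    ∫⁻ x, ∫⁻ y, F x y = 4 * ∫⁻ s, ∫⁻ t, F (s + t) (s - t) := by
  have hc : ∀ (f g : ℂ × ℂ → ℂ), Measurable f → Measurable g →
      Measurable fun p => F (f p) (g p) := fun f g hf hg => hF.comp (hf.prodMk hg)
  calc ∫⁻ x, ∫⁻ y, F x y = ∫⁻ y, ∫⁻ x, F x y := lintegral_lintegral_swap hF.aemeasurable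
    _ = ∫⁻ y, 4 * ∫⁻ t, F (y + 2 * t) y := by
        refine lintegral_congr fun y => ?_
        rw [← lintegral_add_left_eq_self (fun x => F x y) y]
        exact lintegral_comp_two_mul (fun x => F (y + x) y)
          (hF.comp (by fun_prop : Measurable fun x : ℂ => (y + x, y)))
    _ = 4 * ∫⁻ y, ∫⁻ t, F (y + 2 * t) y := lintegral_const_mul' _ _ (by simp)
    _ = 4 * ∫⁻ t, ∫⁻ y, F (y + 2 * t) y := by
        rw [lintegral_lintegral_swap (f := fun y t => F (y + 2 * t) y)]
        exact (hc _ _ (by fun_prop) (by fun_prop)).aemeasurable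
    _ = 4 * ∫⁻ t, ∫⁻ s, F (s + t) (s - t) := by
        congr 1
        refine lintegral_congr fun t => ?_
        rw [← lintegral_sub_right_eq_self (fun y => F (y + 2 * t) y) t]
        refine lintegral_congr fun s => ?_
        congr 1
        ring
    _ = 4 * ∫⁻ s, ∫⁻ t, F (s + t) (s - t) := by
        rw [lintegral_lintegral_swap (f := fun t s => F (s + t) (s - t))]
        exact (hc _ _ (by fun_prop) (by fun_prop)).aemeasurable

theorem exists_taylor {h : ℂ → ℂ} (hd : Differentiable ℂ h) :
    ∃ a : ℕ → ℂ, (∀ z, HasSum (fun n => a n * z ^ n) (h z)) ∧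
      ∀ n, a n = (n.factorial : ℂ)⁻¹ * iteratedDeriv n h 0 := by
  refine ⟨fun n => (n.factorial : ℂ)⁻¹ * iteratedDeriv n h 0, fun z => ?_, fun n => rfl⟩
  have := Complex.hasSum_taylorSeries_of_entire hd 0 z
  simp only [sub_zero, smul_eq_mul] at this
  refine this.congr_fun fun n => ?_
  ring

theorem exists_taylor_even {h : ℂ → ℂ} (hd : Differentiable ℂ h) (he : ∀ t, h (-t) = h t) :
    ∃ a : ℕ → ℂ, (∀ z, HasSum (fun n => a n * z ^ n) (h z)) ∧ ∀ n, Odd n → a n = 0 := by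
  obtain ⟨a, ha, han⟩ := exists_taylor hd
  refine ⟨a, ha, fun n hn => ?_⟩
  have h1 := iteratedDeriv_comp_neg n h (0 : ℂ)
  simp only [he, neg_zero, hn.neg_one_pow, neg_smul, one_smul] at h1
  rw [han, self_eq_neg.1 h1, mul_zero]

/-- The Gaussian energy identity for an even entire function. -/
theorem slice_identity {h : ℂ → ℂ} {a : ℕ → ℂ}
    (ha : ∀ z, HasSum (fun n => a n * z ^ n) (h z)) (hodd : ∀ n, Odd n → a n = 0) :
    ENNReal.ofReal Real.pi * ‖h 0‖ₑ ^ 2 + 2 * ∫⁻ t : ℂ, ‖t * h t‖ₑ ^ 2 *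
        ENNReal.ofReal (Real.exp (-2 * ‖t‖ ^ 2)) =
      3 * (∫⁻ t : ℂ, ‖h t‖ₑ ^ 2 * ENNReal.ofReal (Real.exp (-2 * ‖t‖ ^ 2))) +
      ∑' n : ℕ, ENNReal.ofReal ((n - 2 : ℕ) *
        (‖a n‖ ^ 2 * (Real.pi * n.factorial / 2 ^ (n + 1)))) := by
  have hd := (differentiable_of_hasSum_pow ha).continuous
  have hs := fun z => hasSum_shift ha 0 z
  simp only [add_zero, zero_mul] at hs
  rw [lintegral_norm_sq_gaussian ha two_pos hd, lintegral_norm_sq_gaussian hs two_pos (by fun_prop)]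
  have h0 : h 0 = a 0 := by
    refine (ha 0).unique ?_
    convert hasSum_single (f := fun n => a n * (0 : ℂ) ^ n) 0 (fun n hn => by simp [hn]) using 1
    simp
  have h1 : ENNReal.ofReal Real.pi * ‖h 0‖ₑ ^ 2 =
      ∑' n : ℕ, if n = 0 then ENNReal.ofReal (Real.pi * ‖a n‖ ^ 2) else 0 := by
    rw [tsum_ite_eq, h0, ENNReal.ofReal_mul Real.pi_pos.le, ENNReal.ofReal_pow (norm_nonneg _),
      ofReal_norm]
  rw [h1, tsum_eq_zero_add' (f := fun n => ENNReal.ofReal (‖if n = 0 then (0 : ℂ) else a (n - 1)‖ ^ 2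
    * (Real.pi * n.factorial / 2 ^ (n + 1)))) ENNReal.summable]
  simp only [if_true, norm_zero, Nat.add_eq_zero_iff, one_ne_zero, and_false, if_false,
    Nat.add_sub_cancel]
  rw [zero_pow two_ne_zero, zero_mul, ENNReal.ofReal_zero, zero_add, ← ENNReal.tsum_mul_left,
    ← ENNReal.tsum_mul_left, ← ENNReal.tsum_add, ← ENNReal.tsum_add]
  congr 1
  ext n
  have e2 : (2 : ℝ≥0∞) = ENNReal.ofReal 2 := by simp
  have e3 : (3 : ℝ≥0∞) = ENNReal.ofReal 3 := by simp
  rw [e2, e3, ← ENNReal.ofReal_mul (by norm_num), ← ENNReal.ofReal_mul (by norm_num),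
    ← ENNReal.ofReal_add (by positivity) (by positivity)]
  -- On the n-th mode the moment term is n + 1 times the norm term, so the difference with 3 times
  -- the norm is n - 2. At n = 0 the deficit is exactly π|a 0|²; n = 1 is absent by parity. The
  -- truncated `n - 2` vanishes at both indices.
  rcases n with _ | _ | n
  · rw [if_pos rfl, ← ENNReal.ofReal_add (by positivity) (by positivity)]
    congr 1
    simp
    ring
  · rw [hodd _ (by decide)]
    simp
  · rw [if_neg (by omega), zero_add]
    congr 1
    rw [Nat.factorial_succ (n + 1 + 1)]
    push_cast
    field_simp
    ring

theorem integral_add_sub_sub {f₁ f₂ f₃ f₄ : ℂ → ℝ} (h₁ : Integrable f₁) (h₂ : Integrable f₂)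
    (h₃ : Integrable f₃) (h₄ : Integrable f₄) :
    Integrable (fun x => f₁ x + f₂ x - f₃ x - f₄ x) ∧
      ∫ x, (f₁ x + f₂ x - f₃ x - f₄ x) = (∫ x, f₁ x) + (∫ x, f₂ x) - (∫ x, f₃ x) - ∫ x, f₄ x := by
  refine ⟨((h₁.add h₂).sub h₃).sub h₄, ?_⟩
  rw [integral_sub (f := fun x => f₁ x + f₂ x - f₃ x) ((h₁.add h₂).sub h₃) h₄,
    integral_sub (f := fun x => f₁ x + f₂ x) (h₁.add h₂) h₃, integral_add h₁ h₂]

/-- The double integral equals 2A - 2|m|², where m = p + iq is the barycentre of v; the term in m is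
dropped. -/
theorem lintegral_lintegral_norm_sub_sq_le {v : ℂ → ℝ} (hv : Continuous v) (h0 : ∀ x, 0 ≤ v x)
    {A : ℝ} (h1 : ∫⁻ x, ENNReal.ofReal (v x) = 1)
    (h2 : ∫⁻ x, ENNReal.ofReal (‖x‖ ^ 2 * v x) = ENNReal.ofReal A) (hA : 0 ≤ A) :
    ∫⁻ x, ∫⁻ y, ENNReal.ofReal (‖x - y‖ ^ 2 * (v x * v y)) ≤ ENNReal.ofReal (2 * A) := by
  have i1 : Integrable v := by
    refine ⟨hv.aestronglyMeasurable, ?_⟩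
    rw [hasFiniteIntegral_iff_ofReal (Filter.Eventually.of_forall h0), h1]
    exact ENNReal.one_lt_top
  have i2 : Integrable fun x => ‖x‖ ^ 2 * v x := by
    refine ⟨(by fun_prop : Continuous _).aestronglyMeasurable, ?_⟩
    rw [hasFiniteIntegral_iff_ofReal (Filter.Eventually.of_forall fun x =>
      mul_nonneg (by positivity) (h0 x)), h2]
    exact ENNReal.ofReal_lt_top
  have v1 : ∫ x, v x = 1 := by
    rw [integral_eq_lintegral_of_nonneg_ae (Filter.Eventually.of_forall h0)
      hv.aestronglyMeasurable, h1, ENNReal.toReal_one]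
  have v2 : ∫ x, ‖x‖ ^ 2 * v x = A := by
    rw [integral_eq_lintegral_of_nonneg_ae (Filter.Eventually.of_forall fun x =>
      mul_nonneg (by positivity) (h0 x)) (by fun_prop : Continuous _).aestronglyMeasurable, h2,
      ENNReal.toReal_ofReal hA]
  have hlin : ∀ g : ℂ → ℝ, Continuous g → (∀ x, |g x| ≤ ‖x‖) → Integrable fun x => g x * v x := by
    intro g hg hgb
    refine (i1.add i2).mono' (by fun_prop : Continuous _).aestronglyMeasurable
      (Filter.Eventually.of_forall fun x => ?_)
    rw [norm_mul, Real.norm_eq_abs, Real.norm_eq_abs, abs_of_nonneg (h0 x)]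
    simp only [Pi.add_apply]
    have := hgb x
    nlinarith [h0 x, mul_nonneg (h0 x) (sq_nonneg (‖x‖ - 1)), mul_le_mul_of_nonneg_right this (h0 x),
      mul_nonneg (h0 x) (sq_nonneg ‖x‖)]
  have i3 := hlin Complex.re Complex.continuous_re Complex.abs_re_le_norm
  have i4 := hlin Complex.im Complex.continuous_im Complex.abs_im_le_norm
  set p := ∫ x : ℂ, x.re * v x with hp
  set q := ∫ x : ℂ, x.im * v x with hq
  have hexp : ∀ x y : ℂ, ‖x - y‖ ^ 2 * (v x * v y) =
      ‖x‖ ^ 2 * v x * v y + v x * (‖y‖ ^ 2 * v y) - 2 * x.re * v x * (y.re * v y)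
        - 2 * x.im * v x * (y.im * v y) := by
    intro x y
    have : ‖x - y‖ ^ 2 = ‖x‖ ^ 2 + ‖y‖ ^ 2 - 2 * (x.re * y.re + x.im * y.im) := by
      simp only [Complex.sq_norm, Complex.normSq_apply, Complex.sub_re, Complex.sub_im]
      ring
    rw [this]
    ring
  have hinner : ∀ x : ℂ, ∫⁻ y, ENNReal.ofReal (‖x - y‖ ^ 2 * (v x * v y)) =
      ENNReal.ofReal (‖x‖ ^ 2 * v x + A * v x - 2 * p * (x.re * v x) - 2 * q * (x.im * v x)) := by
    intro x
    have j1 := i1.const_mul (‖x‖ ^ 2 * v x)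
    have j2 := i2.const_mul (v x)
    have j3 := i3.const_mul (2 * x.re * v x)
    have j4 := i4.const_mul (2 * x.im * v x)
    rw [← ofReal_integral_eq_lintegral_ofReal]
    · congr 1
      simp_rw [hexp]
      rw [(integral_add_sub_sub j1 j2 j3 j4).2,
        integral_const_mul, integral_const_mul, integral_const_mul, integral_const_mul, v1, v2]
      ring
    · simp_rw [hexp]
      exact (integral_add_sub_sub j1 j2 j3 j4).1
    · exact Filter.Eventually.of_forall fun y =>
        mul_nonneg (by positivity) (mul_nonneg (h0 x) (h0 y))
  simp_rw [hinner]
  have k2 := i1.const_mul A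
  have k3 := i3.const_mul (2 * p)
  have k4 := i4.const_mul (2 * q)
  have hnn : ∀ x : ℂ, 0 ≤ ‖x‖ ^ 2 * v x + A * v x - 2 * p * (x.re * v x) - 2 * q * (x.im * v x) := by
    intro x
    by_cases hvx : v x = 0
    · simp [hvx]
    have hvx' : 0 < v x := lt_of_le_of_ne (h0 x) (Ne.symm hvx)
    have j1 := i1.const_mul (‖x‖ ^ 2 * v x)
    have j2 := i2.const_mul (v x)
    have j3 := i3.const_mul (2 * x.re * v x)
    have j4 := i4.const_mul (2 * x.im * v x)
    have : 0 ≤ ∫ y, ‖x - y‖ ^ 2 * (v x * v y) := integral_nonneg fun y =>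
      mul_nonneg (by positivity) (mul_nonneg (h0 x) (h0 y))
    simp_rw [hexp] at this
    rw [(integral_add_sub_sub j1 j2 j3 j4).2,
        integral_const_mul, integral_const_mul, integral_const_mul, integral_const_mul, v1, v2]
        at this
    linarith
  rw [← ofReal_integral_eq_lintegral_ofReal (integral_add_sub_sub i2 k2 k3 k4).1
    (Filter.Eventually.of_forall hnn)]
  refine ENNReal.ofReal_le_ofReal ?_
  rw [(integral_add_sub_sub i2 k2 k3 k4).2,
        integral_const_mul, integral_const_mul, integral_const_mul, v1, v2]
  nlinarith [sq_nonneg p, sq_nonneg q]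

/-- The product state in the relative coordinate. -/
def relProd (c : ℕ → ℂ) (s t : ℂ) : ℂ := fockFun c (s + t) * fockFun c (s - t)

/-- By the parallelogram law the product of two Gaussians separates in s and t, leaving the weight
exp(-2|t|²) on each slice. -/
theorem relProd_gaussian (c : ℕ → ℂ) (s t : ℂ) :
    ‖fockState c 0 (s + t)‖ₑ ^ 2 * ‖fockState c 0 (s - t)‖ₑ ^ 2 =
      ENNReal.ofReal (Real.exp (-2 * ‖s‖ ^ 2)) *
        (‖relProd c s t‖ₑ ^ 2 * ENNReal.ofReal (Real.exp (-2 * ‖t‖ ^ 2))) := by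
  have hpar : ‖s + t‖ ^ 2 + ‖s - t‖ ^ 2 = 2 * ‖s‖ ^ 2 + 2 * ‖t‖ ^ 2 := by
    have := parallelogram_law_with_norm ℝ s t
    nlinarith
  rw [enorm_fockState, enorm_fockState, sub_zero, sub_zero, mul_pow, mul_pow,
    ofReal_exp_mul_self _ (-‖s + t‖ ^ 2) (by ring), ofReal_exp_mul_self _ (-‖s - t‖ ^ 2) (by ring),
    relProd, enorm_mul, mul_pow]
  have h1 : ENNReal.ofReal (Real.exp (-‖s + t‖ ^ 2)) * ENNReal.ofReal (Real.exp (-‖s - t‖ ^ 2)) =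
      ENNReal.ofReal (Real.exp (-2 * ‖s‖ ^ 2)) * ENNReal.ofReal (Real.exp (-2 * ‖t‖ ^ 2)) := by
    rw [← ENNReal.ofReal_mul (Real.exp_pos _).le, ← ENNReal.ofReal_mul (Real.exp_pos _).le,
      ← Real.exp_add, ← Real.exp_add]
    congr 2
    linarith
  calc _ = (ENNReal.ofReal (Real.exp (-‖s + t‖ ^ 2)) * ENNReal.ofReal (Real.exp (-‖s - t‖ ^ 2))) *
        (‖fockFun c (s + t)‖ₑ ^ 2 * ‖fockFun c (s - t)‖ₑ ^ 2) := by ring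
    _ = _ := by rw [h1]; ring

/-- The change of variables has Jacobian 4, which gives 1/4 for the norm; in the moment |x - y|² =
4|t|² adds a further 4, so the bound 2A becomes A/8. The slice value at t = 0 is f(s)², whence the
quartic energy. -/
theorem relProd_integrals {c : ℕ → ℂ} (hc : Tame c) (h1 : massC c = 1) :
    (∫⁻ s, ENNReal.ofReal (Real.exp (-2 * ‖s‖ ^ 2)) *
      (ENNReal.ofReal Real.pi * ‖relProd c s 0‖ₑ ^ 2) = ENNReal.ofReal (quartC c / 2)) ∧
    (∫⁻ s, ENNReal.ofReal (Real.exp (-2 * ‖s‖ ^ 2)) *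
      (∫⁻ t, ‖relProd c s t‖ₑ ^ 2 * ENNReal.ofReal (Real.exp (-2 * ‖t‖ ^ 2))) =
        ENNReal.ofReal (1 / 4)) ∧
    (∫⁻ s, ENNReal.ofReal (Real.exp (-2 * ‖s‖ ^ 2)) *
      (∫⁻ t, ‖t * relProd c s t‖ₑ ^ 2 * ENNReal.ofReal (Real.exp (-2 * ‖t‖ ^ 2))) ≤
        ENNReal.ofReal (momC 0 c / 8)) := by
  have hs := summable_norm_sq_of_tame hc
  have hcont := continuous_fockState hs 0
  have hm : ∫⁻ x, ‖fockState c 0 x‖ₑ ^ 2 = 1 := by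
    rw [← mass, mass_fockState hs, h1, ENNReal.ofReal_one]
  have hmom : ∫⁻ x, ‖x‖ₑ ^ 2 * ‖fockState c 0 x‖ₑ ^ 2 = ENNReal.ofReal (momC 0 c) := by
    rw [lintegral_moment_fockState hs, momC,
      ENNReal.ofReal_tsum_of_nonneg (fun n => by positivity) (summable_norm_shiftC_sq hc 0)]
  have hofR : ∀ x, ENNReal.ofReal (‖fockState c 0 x‖ ^ 2) = ‖fockState c 0 x‖ₑ ^ 2 := fun x => by
    rw [ENNReal.ofReal_pow (norm_nonneg _), ofReal_norm]
  have hmeas : Measurable fun x => ‖fockState c 0 x‖ₑ ^ 2 := by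
    have := hcont.measurable
    fun_prop
  refine ⟨?_, ?_, ?_⟩
  · have h2 : ∀ s, ENNReal.ofReal (Real.exp (-2 * ‖s‖ ^ 2)) *
        (ENNReal.ofReal Real.pi * ‖relProd c s 0‖ₑ ^ 2) =
        ENNReal.ofReal Real.pi * ‖fockState c 0 s‖ₑ ^ 4 := by
      intro s
      have := relProd_gaussian c s 0
      rw [add_zero, sub_zero, ← pow_add, norm_zero, zero_pow two_ne_zero, mul_zero, Real.exp_zero,
        ENNReal.ofReal_one, mul_one] at this
      rw [this]
      ring
    simp_rw [h2]
    rw [lintegral_const_mul' _ _ ENNReal.ofReal_ne_top, lintegral_norm_fockState_pow_four hs,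
      ← ENNReal.ofReal_mul Real.pi_pos.le]
    congr 1
    have := Real.pi_ne_zero
    field_simp
  · have h2 := lintegral_lintegral_add_sub
      (F := fun x y => ‖fockState c 0 x‖ₑ ^ 2 * ‖fockState c 0 y‖ₑ ^ 2)
      (by
        have := hcont.measurable
        unfold Function.uncurry
        fun_prop)
    simp_rw [relProd_gaussian] at h2
    have h3 : ∀ x, ∫⁻ y, ‖fockState c 0 x‖ₑ ^ 2 * ‖fockState c 0 y‖ₑ ^ 2 =
        ‖fockState c 0 x‖ₑ ^ 2 := by
      intro x
      rw [lintegral_const_mul _ hmeas, hm, mul_one]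
    simp_rw [h3, lintegral_const_mul' _ _ ENNReal.ofReal_ne_top] at h2
    rw [hm] at h2
    rw [eq_comm, ← ENNReal.eq_div_iff (by norm_num) (by norm_num)] at h2
    rw [h2, ENNReal.ofReal_div_of_pos (by norm_num)]
    simp
  · have h2 := lintegral_lintegral_add_sub
      (F := fun x y => ENNReal.ofReal (‖x - y‖ ^ 2 * (‖fockState c 0 x‖ ^ 2 * ‖fockState c 0 y‖ ^ 2)))
      (by
        have := hcont.measurable
        unfold Function.uncurry
        fun_prop)
    have h3 : ∀ s t : ℂ, ENNReal.ofReal (‖(s + t) - (s - t)‖ ^ 2 *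
        (‖fockState c 0 (s + t)‖ ^ 2 * ‖fockState c 0 (s - t)‖ ^ 2)) =
        4 * (ENNReal.ofReal (Real.exp (-2 * ‖s‖ ^ 2)) *
        (‖t * relProd c s t‖ₑ ^ 2 * ENNReal.ofReal (Real.exp (-2 * ‖t‖ ^ 2)))) := by
      intro s t
      rw [ENNReal.ofReal_mul (by positivity), ENNReal.ofReal_mul (by positivity), hofR, hofR,
        relProd_gaussian, show (s + t) - (s - t) = 2 * t by ring, norm_mul, mul_pow,
        ENNReal.ofReal_mul (by positivity), ENNReal.ofReal_pow (norm_nonneg t), ofReal_norm,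
        enorm_mul, mul_pow, show ‖(2 : ℂ)‖ ^ 2 = 4 by norm_num]
      simp only [ENNReal.ofReal_ofNat]
      ring
    simp_rw [h3] at h2
    have h4 := lintegral_lintegral_norm_sub_sq_le (v := fun x => ‖fockState c 0 x‖ ^ 2)
      (by fun_prop) (fun x => by positivity) (A := momC 0 c)
      (by simp_rw [hofR]; exact hm)
      (by
        rw [← hmom]
        refine lintegral_congr fun x => ?_
        rw [ENNReal.ofReal_mul (by positivity), hofR, ENNReal.ofReal_pow (norm_nonneg _),
          ofReal_norm]) (momC_nonneg _ _)
    rw [h2] at h4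
    simp_rw [lintegral_const_mul' (4 : ℝ≥0∞) _ (by norm_num : (4 : ℝ≥0∞) ≠ ⊤),
      lintegral_const_mul' _ _ ENNReal.ofReal_ne_top] at h4
    rw [← mul_assoc, mul_comm, ← ENNReal.le_div_iff_mul_le (by norm_num) (by norm_num)] at h4
    refine h4.trans (le_of_eq ?_)
    rw [show (4 * 4 : ℝ≥0∞) = ENNReal.ofReal 16 by norm_num,
      ← ENNReal.ofReal_div_of_pos (by norm_num)]
    congr 1
    ring

/-- This integrates the slice identity over s. If the integrated inequality is saturated, the
pointwise one is an equality almost everywhere, and the positive weight W passes this on to the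
remainder R. -/
theorem lintegral_slice_comparison {X Y Z R W : ℂ → ℝ≥0∞} {Q A : ℝ} (hmX : Measurable X)
    (hmY : Measurable Y) (hmZ : Measurable Z) (hW : ∀ s, W s ≠ 0)
    (hsl : ∀ s, Z s + 2 * Y s = 3 * X s + W s * R s) (hX : ∫⁻ s, X s = ENNReal.ofReal (1 / 4))
    (hZ : ∫⁻ s, Z s = ENNReal.ofReal (Q / 2)) (hY : ∫⁻ s, Y s ≤ ENNReal.ofReal (A / 8))
    (hQ : 0 ≤ Q) (hA : 0 ≤ A) :
    3 ≤ 2 * Q + A ∧ (2 * Q + A ≤ 3 → ∀ᵐ s, R s = 0) := by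
  have hle : ∀ s, 3 * X s ≤ Z s + 2 * Y s := fun s => by
    rw [hsl]
    exact le_self_add
  have hI3 : ∫⁻ s, 3 * X s = ENNReal.ofReal (3 / 4) := by
    rw [lintegral_const_mul _ hmX, hX, show (3 : ℝ≥0∞) = ENNReal.ofReal 3 by simp,
      ← ENNReal.ofReal_mul (by norm_num)]
    norm_num
  have hI2 : ∫⁻ s, (Z s + 2 * Y s) ≤ ENNReal.ofReal (Q / 2 + A / 4) := by
    rw [lintegral_add_left hmZ, lintegral_const_mul _ hmY, hZ, ENNReal.ofReal_add
      (by positivity) (by positivity)]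
    gcongr
    calc 2 * ∫⁻ s, Y s ≤ ENNReal.ofReal 2 * ENNReal.ofReal (A / 8) := by
          rw [ENNReal.ofReal_ofNat]
          gcongr
      _ = _ := by
          rw [← ENNReal.ofReal_mul (by norm_num)]
          congr 1
          ring
  refine ⟨?_, fun heq => ?_⟩
  · have := (lintegral_mono hle).trans hI2
    rw [hI3, ENNReal.ofReal_le_ofReal_iff (by positivity)] at this
    linarith
  · have hae := ae_eq_of_ae_le_of_lintegral_le (μ := volume) (f := fun s => 3 * X s)
      (g := fun s => Z s + 2 * Y s) (Filter.Eventually.of_forall hle)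
      (by rw [hI3]; exact ENNReal.ofReal_ne_top) (by fun_prop)
      (by
        rw [hI3]
        refine hI2.trans (ENNReal.ofReal_le_ofReal ?_)
        linarith)
    have hfin : ∀ᵐ s, 3 * X s < ⊤ := ae_lt_top (by fun_prop)
      (by rw [hI3]; exact ENNReal.ofReal_ne_top)
    filter_upwards [hae, hfin] with s hse hsf
    have h2 : Z s + 2 * Y s = 3 * X s := hse.symm
    rw [hsl] at h2
    have h3 : W s * R s = 0 := by
      have h4 : 3 * X s + W s * R s = 3 * X s + 0 := by rw [h2, add_zero]
      exact (ENNReal.add_right_inj hsf.ne).1 h4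
    exact (mul_eq_zero.1 h3).resolve_left (hW s)

theorem eq_of_tsum_slice_eq_zero {h : ℂ → ℂ} {a : ℕ → ℂ}
    (ha : ∀ z, HasSum (fun n => a n * z ^ n) (h z)) (hodd : ∀ n, Odd n → a n = 0)
    (hR : ∑' n : ℕ, ENNReal.ofReal ((n - 2 : ℕ) *
        (‖a n‖ ^ 2 * (Real.pi * n.factorial / 2 ^ (n + 1)))) = 0) (t : ℂ) :
    h t = a 0 + a 2 * t ^ 2 := by
  have ha0 : ∀ n, n ≠ 0 → n ≠ 2 → a n = 0 := by
    intro n hn0 hn2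
    by_cases hn1 : n = 1
    · exact hodd n (by rw [hn1]; decide)
    have h2 := ENNReal.tsum_eq_zero.1 hR n
    rw [ENNReal.ofReal_eq_zero] at h2
    have h3 : (0 : ℝ) < (n - 2 : ℕ) := by
      have : 0 < n - 2 := by omega
      exact_mod_cast this
    have h4 : 0 < Real.pi * n.factorial / 2 ^ (n + 1) := by positivity
    by_contra hne'
    have h5 : 0 < ‖a n‖ := norm_pos_iff.2 hne'
    have : 0 < ((n - 2 : ℕ) : ℝ) * (‖a n‖ ^ 2 * (Real.pi * n.factorial / 2 ^ (n + 1))) := by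
      positivity
    linarith
  have h2 : HasSum (fun n => a n * t ^ n) (∑ n ∈ {0, 2}, a n * t ^ n) :=
    hasSum_sum_of_ne_finset_zero (by
      intro n hn
      simp only [Finset.mem_insert, Finset.mem_singleton, not_or] at hn
      rw [ha0 n hn.1 hn.2, zero_mul])
  rw [(ha t).unique h2]
  simp

/-- This allows the choice of one centre s at which the remainder vanishes and f(s) ≠ 0
simultaneously. -/
theorem frequently_fockFun_ne_zero {c : ℕ → ℂ} (hs : Summable fun n => ‖c n‖ ^ 2)
    (h1 : massC c = 1) : ∃ᵐ s : ℂ, fockFun c s ≠ 0 := by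
  intro hz
  have hz' : fockState c 0 =ᵐ[volume] 0 := by
    filter_upwards [hz] with s hs'
    rw [fockState_zero_apply, not_not.1 hs', mul_zero]
    rfl
  have hm := mass_fockState hs 0
  rw [mass, h1, ENNReal.ofReal_one, lintegral_congr_ae (g := fun _ => 0) (by
    filter_upwards [hz'] with s hs'
    rw [hs']
    simp), lintegral_zero] at hm
  exact zero_ne_one hm

/-- The slice identity for each t ↦ f(s+t) f(s-t), weighted by exp(-2|s|²) and integrated, turns
into Q/2 + A/4 ≥ 3/4. One good slice is all that the equality case needs. -/
theorem quartC_add_momC {c : ℕ → ℂ} (hc : Tame c) (h1 : massC c = 1) :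
    3 ≤ 2 * quartC c + momC 0 c ∧ (2 * quartC c + momC 0 c ≤ 3 →
      ∃ s a b : ℂ, fockFun c s ≠ 0 ∧ ∀ t, fockFun c (s + t) * fockFun c (s - t) = a + b * t ^ 2) := by
  have hs := summable_norm_sq_of_tame hc
  have hfd := differentiable_fockFun hs
  obtain ⟨hQ, hX, hY⟩ := relProd_integrals hc h1
  have hdiff : ∀ s, Differentiable ℂ (relProd c s) := fun s => by
    unfold relProd
    fun_prop
  have heven : ∀ s t, relProd c s (-t) = relProd c s t := fun s t => by
    rw [relProd, relProd, sub_neg_eq_add, ← sub_eq_add_neg, mul_comm]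
  choose a ha hodd using fun s => exists_taylor_even (hdiff s) (heven s)
  have hmc : Measurable fun p : ℂ × ℂ => relProd c p.1 p.2 := by
    have := hfd.continuous.measurable
    unfold relProd
    fun_prop
  have hmX : Measurable fun s =>
      (∫⁻ t, ‖relProd c s t‖ₑ ^ 2 * ENNReal.ofReal (Real.exp (-2 * ‖t‖ ^ 2))) :=
    Measurable.lintegral_prod_right' (f := fun p : ℂ × ℂ =>
      ‖relProd c p.1 p.2‖ₑ ^ 2 * ENNReal.ofReal (Real.exp (-2 * ‖p.2‖ ^ 2))) (by fun_prop)
  have hmY : Measurable fun s =>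
      (∫⁻ t, ‖t * relProd c s t‖ₑ ^ 2 * ENNReal.ofReal (Real.exp (-2 * ‖t‖ ^ 2))) :=
    Measurable.lintegral_prod_right' (f := fun p : ℂ × ℂ =>
      ‖p.2 * relProd c p.1 p.2‖ₑ ^ 2 * ENNReal.ofReal (Real.exp (-2 * ‖p.2‖ ^ 2))) (by fun_prop)
  have hmZ : Measurable fun s => relProd c s 0 := by
    have := hfd.continuous.measurable
    unfold relProd
    fun_prop
  have hmW : Measurable fun s : ℂ => ENNReal.ofReal (Real.exp (-2 * ‖s‖ ^ 2)) := by fun_prop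
  have hsl : ∀ s, ENNReal.ofReal (Real.exp (-2 * ‖s‖ ^ 2)) *
      (ENNReal.ofReal Real.pi * ‖relProd c s 0‖ₑ ^ 2) +
      2 * (ENNReal.ofReal (Real.exp (-2 * ‖s‖ ^ 2)) *
      (∫⁻ t, ‖t * relProd c s t‖ₑ ^ 2 * ENNReal.ofReal (Real.exp (-2 * ‖t‖ ^ 2)))) =
      3 * (ENNReal.ofReal (Real.exp (-2 * ‖s‖ ^ 2)) *
      (∫⁻ t, ‖relProd c s t‖ₑ ^ 2 * ENNReal.ofReal (Real.exp (-2 * ‖t‖ ^ 2)))) +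
      ENNReal.ofReal (Real.exp (-2 * ‖s‖ ^ 2)) * ∑' n : ℕ, ENNReal.ofReal ((n - 2 : ℕ) *
        (‖a s n‖ ^ 2 * (Real.pi * n.factorial / 2 ^ (n + 1)))) := by
    intro s
    rw [mul_left_comm 2, mul_left_comm 3, ← mul_add, ← mul_add, slice_identity (ha s) (hodd s)]
  obtain ⟨hge, heq⟩ := lintegral_slice_comparison
    (X := fun s => ENNReal.ofReal (Real.exp (-2 * ‖s‖ ^ 2)) *
      (∫⁻ t, ‖relProd c s t‖ₑ ^ 2 * ENNReal.ofReal (Real.exp (-2 * ‖t‖ ^ 2))))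
    (Y := fun s => ENNReal.ofReal (Real.exp (-2 * ‖s‖ ^ 2)) *
      (∫⁻ t, ‖t * relProd c s t‖ₑ ^ 2 * ENNReal.ofReal (Real.exp (-2 * ‖t‖ ^ 2))))
    (Z := fun s => ENNReal.ofReal (Real.exp (-2 * ‖s‖ ^ 2)) *
      (ENNReal.ofReal Real.pi * ‖relProd c s 0‖ₑ ^ 2))
    (W := fun s : ℂ => ENNReal.ofReal (Real.exp (-2 * ‖s‖ ^ 2)))
    (R := fun s => ∑' n : ℕ, ENNReal.ofReal ((n - 2 : ℕ) *
        (‖a s n‖ ^ 2 * (Real.pi * n.factorial / 2 ^ (n + 1)))))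
    (Q := quartC c) (A := momC 0 c)
    (hmW.mul hmX) (hmW.mul hmY)
    (hmW.mul ((hmZ.enorm.pow_const 2).const_mul (ENNReal.ofReal Real.pi)))
    (fun s => (ENNReal.ofReal_pos.2 (Real.exp_pos _)).ne') hsl hX hQ hY (quartC_nonneg c)
    (momC_nonneg 0 c)
  refine ⟨hge, fun hle => ?_⟩
  obtain ⟨s, hsne, hsR⟩ :=
    ((frequently_fockFun_ne_zero hs h1).and_eventually (heq hle)).exists
  exact ⟨s, a s 0, a s 2, hsne, fun t => eq_of_tsum_slice_eq_zero (ha s) (hodd s) hsR t⟩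

theorem two_le_quartC {c : ℕ → ℂ} (hc : Tame c) (h1 : massC c = 1) :
    2 ≤ 2 * quartC c + angC c := by
  have := (quartC_add_momC hc h1).1
  rw [momC_zero hc, h1] at this
  linarith

/-! ### Entire functions of order two with finitely many zeros -/

open Polynomial in
/-- An entire function with finitely many zeros is a polynomial times a zero-free entire
function. -/
theorem exists_polynomial_mul_of_finite_zeros {f : ℂ → ℂ} (hf : Differentiable ℂ f)
    (hfin : {z | f z = 0}.Finite) :
    ∃ (p : ℂ[X]) (g : ℂ → ℂ), Differentiable ℂ g ∧ (∀ z, g z ≠ 0) ∧ ∀ z, f z = p.eval z * g z := by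
  have han : AnalyticOnNhd ℂ f Set.univ := fun z _ => hf.analyticAt z
  have hmer : MeromorphicOn f Set.univ := han.meromorphicOn
  have hev : ∀ z, ∀ᶠ x in nhdsWithin z {z}ᶜ, f x ≠ 0 := by
    intro z
    have h1 : ({x | f x = 0} \ {z})ᶜ ∈ nhds z :=
      (hfin.subset Set.sdiff_subset).isClosed.isOpen_compl.mem_nhds (by simp)
    filter_upwards [nhdsWithin_le_nhds h1, self_mem_nhdsWithin] with x hx hxz h0
    exact hx ⟨h0, hxz⟩
  have hne : ∀ u : (Set.univ : Set ℂ), meromorphicOrderAt f u ≠ ⊤ := fun u =>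
    (meromorphicOrderAt_ne_top_iff_eventually_ne_zero (hmer u u.2)).2 (hev u)
  set D := MeromorphicOn.divisor f Set.univ with hD
  have hDfin : D.support.Finite := by
    refine hfin.subset fun z hz => ?_
    by_contra h0
    apply hz
    rw [hD, MeromorphicOn.divisor_apply hmer (Set.mem_univ z), (hf.analyticAt z).meromorphicOrderAt_eq,
      (hf.analyticAt z).analyticOrderAt_eq_zero.2 h0]
    rfl
  obtain ⟨g, hg, hg0, hfg⟩ := hmer.extract_zeros_poles hne hDfin
  have hDnn : ∀ u, 0 ≤ D u := fun u => MeromorphicOn.AnalyticOnNhd.divisor_nonneg han u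
  have hprod : ∀ z, (∏ᶠ u, (· - u) ^ D u : ℂ → ℂ) z =
      (∏ u ∈ hDfin.toFinset, (X - C u) ^ (D u).toNat : ℂ[X]).eval z := by
    intro z
    rw [finprod_eq_prod_of_mulSupport_subset (s := hDfin.toFinset)]
    · rw [Finset.prod_apply, eval_prod]
      refine Finset.prod_congr rfl fun u _ => ?_
      rw [Pi.pow_apply, eval_pow, eval_sub, eval_X, eval_C]
      conv_lhs => rw [← Int.toNat_of_nonneg (hDnn u)]
      rw [zpow_natCast]
    · intro u hu
      rw [Set.Finite.coe_toFinset]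
      intro h0
      apply hu
      show (fun x => x - u) ^ D u = 1
      rw [h0, zpow_zero]
  refine ⟨∏ u ∈ hDfin.toFinset, (X - C u) ^ (D u).toNat, g,
    fun z => (hg z trivial).differentiableAt, fun z => hg0 ⟨z, trivial⟩, fun z => ?_⟩
  have hgd : Continuous g := continuous_iff_continuousAt.2 fun z => (hg z trivial).continuousAt
  -- The factorisation is only known off a discrete set; it holds near z with z removed, and
  -- continuity of both sides restores the value at z.
  have hev2 : ∀ᶠ x in nhdsWithin z {z}ᶜ,
      f x = (∏ u ∈ hDfin.toFinset, (X - C u) ^ (D u).toNat : ℂ[X]).eval x * g x := by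
    have h1 := mem_codiscreteWithin.1 hfg z trivial
    rw [Filter.disjoint_principal_right] at h1
    filter_upwards [h1] with x hx
    simp only [Set.mem_compl_iff, Set.mem_sdiff, Set.mem_univ, true_and, not_not] at hx
    have hx' : f x = ((∏ᶠ u, (· - u) ^ D u : ℂ → ℂ) • g) x := hx
    rw [hx', Pi.smul_apply', hprod, smul_eq_mul]
  have t1 : Filter.Tendsto f (nhdsWithin z {z}ᶜ) (nhds (f z)) :=
    (hf.continuous.tendsto z).mono_left nhdsWithin_le_nhds
  have t2 : Filter.Tendsto
      (fun x => (∏ u ∈ hDfin.toFinset, (X - C u) ^ (D u).toNat : ℂ[X]).eval x * g x)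
      (nhdsWithin z {z}ᶜ)
      (nhds ((∏ u ∈ hDfin.toFinset, (X - C u) ^ (D u).toNat : ℂ[X]).eval z * g z)) := by
    refine Filter.Tendsto.mono_left (Continuous.tendsto ?_ z) nhdsWithin_le_nhds
    exact (Polynomial.continuous _).mul hgd
  exact tendsto_nhds_unique (t1.congr' hev2) t2

/-- The logarithmic derivative g'/g is entire, so it has a primitive G₀ on the plane, and g exp(-G₀)
is constant. -/
theorem exists_log_of_ne_zero {g : ℂ → ℂ} (hg : Differentiable ℂ g) (h0 : ∀ z, g z ≠ 0) :
    ∃ G : ℂ → ℂ, Differentiable ℂ G ∧ ∀ z, g z = Complex.exp (G z) := by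
  have hd : Differentiable ℂ fun z => deriv g z / g z := by
    intro z
    exact (hg.deriv z).div (hg z) (h0 z)
  obtain ⟨G₀, hG₀⟩ := hd.isExactOn_univ
  have hG : ∀ z, HasDerivAt G₀ (deriv g z / g z) z := fun z => hG₀ z trivial
  have hconst : ∀ z, g z * Complex.exp (-G₀ z) = g 0 * Complex.exp (-G₀ 0) := by
    intro z
    refine is_const_of_deriv_eq_zero (f := fun z => g z * Complex.exp (-G₀ z)) ?_ ?_ z 0
    · exact fun z => (hg z).mul (hG z).neg.cexp.differentiableAt
    · intro z
      have := ((hg z).hasDerivAt.mul (hG z).neg.cexp).deriv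
      have e : deriv (fun z => g z * Complex.exp (-G₀ z)) z = _ := this
      rw [e]
      field_simp [h0 z]
      ring
  obtain ⟨k, hk⟩ : ∃ k, Complex.exp k = g 0 * Complex.exp (-G₀ 0) :=
    ⟨Complex.log _, Complex.exp_log (mul_ne_zero (h0 0) (Complex.exp_ne_zero _))⟩
  refine ⟨fun z => k + G₀ z, fun z => ((hG z).differentiableAt).const_add k, fun z => ?_⟩
  rw [Complex.exp_add, hk, ← hconst z, mul_assoc, ← Complex.exp_add]
  simp

open Polynomial in
theorem exists_pos_le_norm_eval {p : ℂ[X]} (hp : p ≠ 0) :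
    ∃ δ > 0, ∃ R : ℝ, ∀ z : ℂ, R ≤ ‖z‖ → δ ≤ ‖p.eval z‖ := by
  rcases le_or_gt p.degree 0 with h | h
  · rw [eq_C_of_degree_le_zero h] at hp ⊢
    refine ⟨‖p.coeff 0‖, norm_pos_iff.2 fun h0 => hp (by rw [h0, C_0]), 0, fun z _ => by simp⟩
  · have h1 := p.tendsto_norm_atTop h (tendsto_norm_cobounded_atTop (E := ℂ))
    have h2 := h1.eventually_ge_atTop 1
    obtain ⟨R, -, hR⟩ := (Filter.hasBasis_cobounded_norm (E := ℂ)).eventually_iff.1 h2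
    exact ⟨1, one_pos, R, fun z hz => hR hz⟩

/-- An entire function whose real part grows at most quadratically is a quadratic polynomial. -/
theorem eq_quadratic_of_re_le {G : ℂ → ℂ} (hG : Differentiable ℂ G) {K : ℝ}
    (hK : ∀ z, (G z).re ≤ K + ‖z‖ ^ 2 / 2) :
    ∃ α β γ : ℂ, ∀ z, G z = α * z ^ 2 + β * z + γ := by
  set L : ℝ := |K| + 1 with hL
  have hLpos : 0 < L := by positivity
  have hbd : ∀ R : ℝ, 1 ≤ R → ∀ z ∈ Metric.sphere (0 : ℂ) R, ‖G z‖ ≤ (2 * L + 4 + 3 * ‖G 0‖) * R ^ 2 := by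
    intro R hR z hz
    have hzR : ‖z‖ = R := by simpa using hz
    have hM : 0 < L + 2 * R ^ 2 := by positivity
    -- The real part is controlled on the disc of radius 2R, which bounds the modulus on the circle
    -- of radius R by a constant times R². Cauchy's estimates then kill all derivatives at 0 from
    -- the third on.
    have h := Complex.borelCaratheodory (f := G) (M := L + 2 * R ^ 2) (R := 2 * R) (z := z) hM
      hG.differentiableOn (fun x hx => by
        have hx' : ‖x‖ < 2 * R := by simpa using hx
        have h1 := hK x
        have h2 := le_abs_self K
        have h3 : ‖x‖ ^ 2 ≤ (2 * R) ^ 2 := by gcongr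
        simp only [Set.mem_ofPred_eq]
        nlinarith) (by linarith) (by simp [hzR]; linarith)
    rw [hzR] at h
    have e1 : 2 * (L + 2 * R ^ 2) * R / (2 * R - R) = 2 * (L + 2 * R ^ 2) := by
      have : 2 * R - R ≠ 0 := by linarith
      field_simp
      ring
    have e2 : ‖G 0‖ * (2 * R + R) / (2 * R - R) = 3 * ‖G 0‖ := by
      have : 2 * R - R ≠ 0 := by linarith
      field_simp
      ring
    rw [e1, e2] at h
    have h4 : 1 ≤ R ^ 2 := by nlinarith
    nlinarith [norm_nonneg (G 0)]
  have hder : ∀ n, 3 ≤ n → iteratedDeriv n G 0 = 0 := by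
    intro n hn
    set B : ℝ := 2 * L + 4 + 3 * ‖G 0‖ with hB
    have hest : ∀ R : ℝ, 1 ≤ R → ‖iteratedDeriv n G 0‖ ≤ (n.factorial * B) / R := by
      intro R hR
      have h := Complex.norm_iteratedDeriv_le_of_forall_mem_sphere_norm_le n (by linarith : 0 < R)
        hG.diffContOnCl (hbd R hR)
      refine h.trans ?_
      have hRpos : 0 < R := by linarith
      rw [div_le_div_iff₀ (by positivity) hRpos]
      have : R ^ 3 ≤ R ^ n := pow_le_pow_right₀ hR hn
      have hBn : 0 ≤ (n.factorial : ℝ) * B := by positivity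
      calc (n.factorial : ℝ) * (B * R ^ 2) * R = (n.factorial * B) * R ^ 3 := by ring
        _ ≤ (n.factorial * B) * R ^ n := by gcongr
    have hlim : Filter.Tendsto (fun R : ℝ => (n.factorial * B) / R) Filter.atTop (nhds 0) :=
      Filter.Tendsto.div_atTop tendsto_const_nhds Filter.tendsto_id
    have : ‖iteratedDeriv n G 0‖ ≤ 0 := ge_of_tendsto hlim
      ((Filter.eventually_ge_atTop 1).mono hest)
    exact norm_le_zero_iff.1 this
  obtain ⟨a, ha, han⟩ := exists_taylor hG
  refine ⟨a 2, a 1, a 0, fun z => ?_⟩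
  have h2 : HasSum (fun n => a n * z ^ n) (∑ n ∈ Finset.range 3, a n * z ^ n) :=
    hasSum_sum_of_ne_finset_zero (by
      intro n hn
      rw [han, hder n (by simpa using hn)]
      simp)
  rw [(ha z).unique h2]
  simp [Finset.sum_range_succ]
  ring

-- Dividing by the polynomial costs only a constant factor outside a large disc, and inside it
-- compactness suffices. The zero-free factor thus keeps the Gaussian bound, and its logarithm is
-- quadratic; the constant term is absorbed into p.
open Polynomial in
theorem exists_factorization {f : ℂ → ℂ} (hf : Differentiable ℂ f) (hne : ∃ z, f z ≠ 0)
    (hfin : {z | f z = 0}.Finite) {K : ℝ} (hK : ∀ z, ‖f z‖ ≤ K * Real.exp (‖z‖ ^ 2 / 2)) :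
    ∃ (p : ℂ[X]) (α β : ℂ), p ≠ 0 ∧ ∀ z, f z = p.eval z * Complex.exp (α * z ^ 2 + β * z) := by
  obtain ⟨p, g, hg, hg0, hfg⟩ := exists_polynomial_mul_of_finite_zeros hf hfin
  have hp : p ≠ 0 := by
    rintro rfl
    obtain ⟨z, hz⟩ := hne
    exact hz (by rw [hfg, eval_zero, zero_mul])
  obtain ⟨δ, hδ, R, hR⟩ := exists_pos_le_norm_eval hp
  obtain ⟨K', hK'⟩ := (isCompact_closedBall (0 : ℂ) R).exists_bound_of_continuousOn
    hg.continuous.continuousOn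
  obtain ⟨G, hG, hgG⟩ := exists_log_of_ne_zero hg hg0
  have hKnn : 0 ≤ K := by
    have := (norm_nonneg _).trans (hK 0)
    simpa using this
  set T : ℝ := max 1 (max K' (K / δ)) with hT
  have hTpos : 0 < T := lt_of_lt_of_le one_pos (le_max_left _ _)
  have hgT : ∀ z, ‖g z‖ ≤ T * Real.exp (‖z‖ ^ 2 / 2) := by
    intro z
    rcases le_total ‖z‖ R with h | h
    · have h1 := hK' z (by simpa using h)
      have h2 : K' ≤ T := (le_max_left _ _).trans (le_max_right _ _)
      have h3 : 1 ≤ Real.exp (‖z‖ ^ 2 / 2) := Real.one_le_exp (by positivity)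
      nlinarith
    · have h1 := hR z h
      have h2 : K / δ ≤ T := (le_max_right _ _).trans (le_max_right _ _)
      have h3 := hK z
      rw [hfg, norm_mul] at h3
      have h4 : δ * ‖g z‖ ≤ K * Real.exp (‖z‖ ^ 2 / 2) :=
        (mul_le_mul_of_nonneg_right h1 (norm_nonneg _)).trans h3
      calc ‖g z‖ ≤ K * Real.exp (‖z‖ ^ 2 / 2) / δ := by
            rw [le_div_iff₀ hδ]
            linarith
        _ = K / δ * Real.exp (‖z‖ ^ 2 / 2) := by ring
        _ ≤ _ := by gcongr
  obtain ⟨α, β, γ, hq⟩ := eq_quadratic_of_re_le hG (K := Real.log T) (fun z => by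
    have h := hgT z
    rw [hgG, Complex.norm_exp] at h
    have h1 := Real.log_le_log (Real.exp_pos _) h
    rwa [Real.log_exp, Real.log_mul hTpos.ne' (Real.exp_pos _).ne', Real.log_exp] at h1)
  refine ⟨p * C (Complex.exp γ), α, β, ?_, fun z => ?_⟩
  · exact mul_ne_zero hp (by simp)
  · rw [hfg, hgG, hq, eval_mul, eval_C, Complex.exp_add, mul_assoc, mul_comm (Complex.exp γ)]

open Polynomial in
/-- Growth in the direction where the quadratic exponent is largest. -/
theorem norm_lt_of_growth {p : ℂ[X]} (hp : p ≠ 0) {α β : ℂ} {a C : ℝ}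
    (hC : ∀ z, ‖z‖ * ‖p.eval z * Complex.exp (α * z ^ 2 + β * z)‖ ≤ C * Real.exp (a * ‖z‖ ^ 2)) :
    ‖α‖ < a := by
  by_contra! hlt
  -- The condition on α leaves the sign of ω free; the sign is chosen so that the linear term does
  -- not reduce the growth.
  obtain ⟨ω, hω, hαω, hβω⟩ : ∃ ω : ℂ, ‖ω‖ = 1 ∧ α * ω ^ 2 = (‖α‖ : ℂ) ∧ 0 ≤ (β * ω).re := by
    have h1 : ∃ ω : ℂ, ‖ω‖ = 1 ∧ α * ω ^ 2 = (‖α‖ : ℂ) := by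
      refine ⟨Complex.exp ((-(α.arg / 2) : ℝ) * Complex.I), Complex.norm_exp_ofReal_mul_I _, ?_⟩
      rw [← Complex.exp_nat_mul]
      nth_rw 1 [← Complex.norm_mul_exp_arg_mul_I α]
      rw [mul_assoc, ← Complex.exp_add]
      have : (α.arg : ℂ) * Complex.I + (2 : ℕ) * (((-(α.arg / 2) : ℝ) : ℂ) * Complex.I) = 0 := by
        push_cast
        ring
      rw [this, Complex.exp_zero, mul_one]
    obtain ⟨ω, hω, hα⟩ := h1
    rcases le_total 0 (β * ω).re with h | h
    · exact ⟨ω, hω, hα, h⟩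
    · exact ⟨-ω, by rwa [norm_neg], by rwa [neg_sq], by rw [mul_neg, Complex.neg_re]; linarith⟩
  obtain ⟨δ, hδ, R, hR⟩ := exists_pos_le_norm_eval hp
  -- The additional factor ‖z‖ in the hypothesis excludes even equality ‖α‖ = a: along the ray it
  -- bounds r itself.
  have hbound : ∀ r : ℝ, 0 ≤ r → R ≤ r → r * δ ≤ C := by
    intro r hr hRr
    have hn : ‖(r : ℂ) * ω‖ = r := by
      rw [norm_mul, hω, mul_one, Complex.norm_real, Real.norm_eq_abs, abs_of_nonneg hr]
    have h1 := hC (r * ω)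
    have h2 := hR (r * ω) (by rwa [hn])
    rw [hn, norm_mul, Complex.norm_exp] at h1
    have h3 : (α * (r * ω) ^ 2 + β * (r * ω)).re = ‖α‖ * r ^ 2 + r * (β * ω).re := by
      have : α * (r * ω) ^ 2 + β * (r * ω) = ((‖α‖ * r ^ 2 : ℝ) : ℂ) + (r : ℂ) * (β * ω) := by
        push_cast
        rw [← hαω]
        ring
      rw [this, Complex.add_re, Complex.ofReal_re, Complex.re_ofReal_mul]
    rw [h3] at h1
    have h4 : Real.exp (a * r ^ 2) ≤ Real.exp (‖α‖ * r ^ 2 + r * (β * ω).re) := by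
      apply Real.exp_le_exp.2
      have := mul_nonneg hr hβω
      have := mul_le_mul_of_nonneg_right hlt (sq_nonneg r)
      linarith
    have h5 : r * δ * Real.exp (a * r ^ 2) ≤ C * Real.exp (a * r ^ 2) := by
      refine le_trans ?_ h1
      calc r * δ * Real.exp (a * r ^ 2) = r * (δ * Real.exp (a * r ^ 2)) := by ring
        _ ≤ _ := by gcongr
    exact le_of_mul_le_mul_right h5 (Real.exp_pos _)
  have := hbound (|R| + |C| / δ + 1) (by positivity) (by
    have := le_abs_self R
    have : 0 ≤ |C| / δ := by positivity
    linarith)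
  have h6 : |C| / δ * δ = |C| := by field_simp
  have := le_abs_self C
  nlinarith [abs_nonneg R]

/-! ### Fock coefficients, pointwise growth and translates -/

theorem coeff_unique {F : ℂ → ℂ} {a b : ℕ → ℂ} (ha : ∀ z, HasSum (fun n => a n * z ^ n) (F z))
    (hb : ∀ z, HasSum (fun n => b n * z ^ n) (F z)) : a = b := by
  have hd : ∀ z : ℂ, HasSum (fun n => (a n - b n) * z ^ n) ((fun _ => (0 : ℂ)) z) := fun z => by
    have := (ha z).sub (hb z)
    rw [sub_self] at this
    exact this.congr_fun fun n => by ring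
  have h := lintegral_norm_sq_gaussian hd one_pos continuous_const
  simp only [enorm_zero, ne_eq, OfNat.ofNat_ne_zero, not_false_eq_true, zero_pow, zero_mul,
    lintegral_zero] at h
  ext n
  have h2 := ENNReal.tsum_eq_zero.1 h.symm n
  rw [ENNReal.ofReal_eq_zero] at h2
  have h4 : 0 < Real.pi * n.factorial / 1 ^ (n + 1) := by positivity
  by_contra hne
  have h5 : 0 < ‖a n - b n‖ := norm_pos_iff.2 (sub_ne_zero.2 hne)
  have : 0 < ‖a n - b n‖ ^ 2 * (Real.pi * n.factorial / 1 ^ (n + 1)) := by positivity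
  linarith

theorem sqrt_pi_factorial_ne_zero (n : ℕ) : ((√(Real.pi * n.factorial) : ℝ) : ℂ) ≠ 0 := by
  rw [Complex.ofReal_ne_zero]
  positivity

theorem fockFun_injective {c d : ℕ → ℂ} (hc : Summable fun n => ‖c n‖ ^ 2)
    (hd : Summable fun n => ‖d n‖ ^ 2) (h : ∀ z, fockFun c z = fockFun d z) : c = d := by
  have h1 := coeff_unique (hasSum_fockFun hc) (fun z => by rw [h]; exact hasSum_fockFun hd z)
  ext n
  have h2 := congrFun h1 n
  rw [taylorC, taylorC, div_left_inj' (sqrt_pi_factorial_ne_zero n)] at h2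
  exact h2

/-- Cauchy-Schwarz between the coefficients and the series of exp(|z|²). -/
theorem norm_fockFun_le {c : ℕ → ℂ} (hc : Summable fun n => ‖c n‖ ^ 2) (z : ℂ) :
    ‖fockFun c z‖ ≤ √(massC c / Real.pi) * Real.exp (‖z‖ ^ 2 / 2) := by
  have h1 : HasSum (fun n : ℕ => (‖z‖ ^ 2) ^ n / n.factorial) (Real.exp (‖z‖ ^ 2)) := by
    rw [Real.exp_eq_exp_ℝ]
    exact NormedSpace.expSeries_div_hasSum_exp (‖z‖ ^ 2)
  have h2 : ∀ n, ‖taylorC c n * z ^ n‖ = (‖c n‖ / √Real.pi) * (‖z‖ ^ n / √n.factorial) := by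
    intro n
    rw [norm_mul, taylorC, norm_div, norm_pow, Complex.norm_real, Real.norm_eq_abs,
      abs_of_nonneg (Real.sqrt_nonneg _), Real.sqrt_mul Real.pi_pos.le]
    ring
  have h3 : ∀ n : ℕ, (‖z‖ ^ n / √n.factorial) ^ 2 = (‖z‖ ^ 2) ^ n / n.factorial := fun n => by
    rw [div_pow, Real.sq_sqrt (by positivity), ← pow_mul, ← pow_mul, mul_comm n 2]
  have h4 : ∀ n : ℕ, (‖c n‖ / √Real.pi) ^ 2 = ‖c n‖ ^ 2 / Real.pi := fun n => by
    rw [div_pow, Real.sq_sqrt Real.pi_pos.le]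
  have hs1 : Summable fun n => (‖c n‖ / √Real.pi) ^ 2 := by
    simp_rw [h4]
    exact hc.div_const _
  have hs2 : Summable fun n : ℕ => (‖z‖ ^ n / √n.factorial) ^ 2 := by
    simp_rw [h3]
    exact h1.summable
  have h5 : ‖fockFun c z‖ ≤ ∑' n, (‖c n‖ / √Real.pi) * (‖z‖ ^ n / √n.factorial) := by
    simp_rw [← h2]
    exact norm_tsum_le_tsum_norm (summable_taylorC hc z)
  have h6 := Real.inner_le_Lp_mul_Lq_tsum_of_nonneg (p := 2) (q := 2)
    (f := fun n => ‖c n‖ / √Real.pi) (g := fun n : ℕ => ‖z‖ ^ n / √n.factorial)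
    (by constructor <;> norm_num) (fun n => by positivity) (fun n => by positivity)
    (by simpa using hs1) (by simpa using hs2)
  refine h5.trans (h6.trans (le_of_eq ?_))
  simp only [Real.rpow_two]
  simp_rw [h3, h4]
  rw [h1.tsum_eq, tsum_div_const, ← Real.sqrt_eq_rpow, ← Real.sqrt_eq_rpow, ← massC]
  congr 1
  rw [Real.sqrt_eq_iff_mul_self_eq (Real.exp_pos _).le (Real.exp_pos _).le, ← Real.exp_add]
  congr 1
  ring

theorem fockFun_shiftC {c : ℕ → ℂ} (hc : Tame c) (z : ℂ) :
    fockFun (shiftC 0 c) z = z * fockFun c z := by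
  have hs := summable_norm_sq_of_tame hc
  have h := hasSum_shift (hasSum_fockFun hs) 0 z
  rw [add_zero] at h
  refine HasSum.unique (hasSum_fockFun (summable_norm_shiftC_sq hc 0) z) (h.congr_fun fun n => ?_)
  congr 1
  rw [zero_mul, add_zero]
  rcases n with _ | n
  · simp [shiftC, taylorC]
  · simp only [Nat.add_eq_zero_iff, one_ne_zero, and_false, if_false, Nat.add_sub_cancel,
        taylorC, shiftC, zero_mul, add_zero]
    rw [Nat.factorial_succ, Nat.cast_mul,
      show Real.pi * (((n + 1 : ℕ) : ℝ) * n.factorial) =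
        ((n + 1 : ℕ) : ℝ) * (Real.pi * n.factorial) by ring,
      Real.sqrt_mul (by positivity : (0 : ℝ) ≤ ((n + 1 : ℕ) : ℝ)), Complex.ofReal_mul,
      mul_div_mul_left]
    rw [Complex.ofReal_ne_zero]
    positivity

/-- Finite angular momentum means that z f is again a Fock function. The factor ‖z‖ gained here is
what makes ‖α‖ < 1/2 strict in the factorisation. -/
theorem norm_mul_fockFun_le {c : ℕ → ℂ} (hc : Tame c) (z : ℂ) :
    ‖z‖ * ‖fockFun c z‖ ≤ √(momC 0 c / Real.pi) * Real.exp (‖z‖ ^ 2 / 2) := by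
  have h := norm_fockFun_le (summable_norm_shiftC_sq hc 0) z
  rwa [fockFun_shiftC hc, norm_mul] at h

/-- The rescaling of Fock coefficients corresponds to a dilation. -/
theorem fockFun_scale (c : ℕ → ℂ) (ρ z : ℂ) :
    fockFun (fun n => c n * ρ ^ n) z = fockFun c (ρ * z) := by
  rw [fockFun, fockFun]
  congr 1
  ext n
  rw [taylorC, taylorC, mul_pow]
  ring

open Polynomial in
theorem exists_norm_eval_mul_exp_le (p : ℂ[X]) (B : ℝ) {δ : ℝ} (hδ : 0 < δ) :
    ∃ K, 0 ≤ K ∧ ∀ z : ℂ, ‖p.eval z‖ * Real.exp (B * ‖z‖) ≤ K * Real.exp (δ * ‖z‖ ^ 2) := by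
  have h1 : ∀ z : ℂ, ‖p.eval z‖ ≤
      (∑ i ∈ Finset.range (p.natDegree + 1), ‖p.coeff i‖ * i.factorial) * Real.exp ‖z‖ := by
    intro z
    rw [eval_eq_sum_range, Finset.sum_mul]
    refine (norm_sum_le _ _).trans (Finset.sum_le_sum fun i _ => ?_)
    rw [norm_mul, norm_pow, mul_assoc]
    have := Real.pow_div_factorial_le_exp ‖z‖ (norm_nonneg z) i
    rw [div_le_iff₀ (by positivity)] at this
    gcongr
    linarith
  set S := ∑ i ∈ Finset.range (p.natDegree + 1), ‖p.coeff i‖ * i.factorial with hS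
  have hSnn : 0 ≤ S := Finset.sum_nonneg fun i _ => by positivity
  refine ⟨S * Real.exp ((1 + B) ^ 2 / (4 * δ)), by positivity, fun z => ?_⟩
  calc ‖p.eval z‖ * Real.exp (B * ‖z‖) ≤ S * Real.exp ‖z‖ * Real.exp (B * ‖z‖) := by
        gcongr
        exact h1 z
    _ = S * Real.exp ((1 + B) * ‖z‖) := by
        rw [mul_assoc, ← Real.exp_add]
        ring_nf
    _ ≤ S * Real.exp ((1 + B) ^ 2 / (4 * δ) + δ * ‖z‖ ^ 2) := by
        gcongr
        have : (1 + B) ^ 2 / (4 * δ) + δ * ‖z‖ ^ 2 - (1 + B) * ‖z‖ =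
          (1 + B - 2 * δ * ‖z‖) ^ 2 / (4 * δ) := by
          field_simp
          ring
        have h2 : 0 ≤ (1 + B - 2 * δ * ‖z‖) ^ 2 / (4 * δ) := by positivity
        linarith
    _ = _ := by rw [Real.exp_add, mul_assoc]

/-- Fock coefficients of a polynomial. -/
def polyC (P : Polynomial ℂ) (n : ℕ) : ℂ := P.coeff n * (√(Real.pi * n.factorial) : ℝ)

theorem taylorC_polyC (P : Polynomial ℂ) (n : ℕ) : taylorC (polyC P) n = P.coeff n := by
  rw [taylorC, polyC, mul_div_assoc, div_self (sqrt_pi_factorial_ne_zero n), mul_one]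

theorem fockFun_polyC (P : Polynomial ℂ) (z : ℂ) : fockFun (polyC P) z = P.eval z := by
  rw [fockFun, Polynomial.eval_eq_sum_range]
  simp_rw [taylorC_polyC]
  refine tsum_eq_sum fun n hn => ?_
  rw [Polynomial.coeff_eq_zero_of_natDegree_lt (by simpa using hn), zero_mul]

theorem tame_of_finite {c : ℕ → ℂ} {N : ℕ} (h : ∀ n, N < n → c n = 0) : Tame c := by
  refine summable_of_ne_finset_zero (s := Finset.range (N + 1)) fun n hn => ?_
  rw [h n (by simpa using hn), norm_zero, zero_pow two_ne_zero, mul_zero]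

theorem polyC_eq_zero {P : Polynomial ℂ} {n : ℕ} (h : P.natDegree < n) : polyC P n = 0 := by
  rw [polyC, Polynomial.coeff_eq_zero_of_natDegree_lt h, zero_mul]

theorem tame_polyC (P : Polynomial ℂ) : Tame (polyC P) := tame_of_finite fun _ => polyC_eq_zero

/-- With ‖α‖ < a < b < 1/2, f is bounded by a multiple of exp(a|z|²), hence square integrable
against exp(-2b|z|²). Parseval for that weight bounds |c_n|² by a multiple of (2b)^n. -/
theorem exists_bound_of_eq_exp {c : ℕ → ℂ} (hc : Summable fun n => ‖c n‖ ^ 2)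
    {p : Polynomial ℂ} {α β : ℂ} (hα : ‖α‖ < 1 / 2)
    (hf : ∀ z, fockFun c z = p.eval z * Complex.exp (α * z ^ 2 + β * z)) :
    ∃ ρ C : ℝ, 0 < ρ ∧ ρ < 1 ∧ ∀ n, ‖c n‖ ≤ C * ρ ^ n := by
  obtain ⟨a, ha1, ha2⟩ := exists_between hα
  obtain ⟨b, hb1, hb2⟩ := exists_between ha2
  have hα0 := norm_nonneg α
  obtain ⟨K, hK0, hK⟩ := exists_norm_eval_mul_exp_le p ‖β‖ (sub_pos.2 ha1)
  have hfb : ∀ z, ‖fockFun c z‖ ≤ K * Real.exp (a * ‖z‖ ^ 2) := by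
    intro z
    rw [hf, norm_mul, Complex.norm_exp]
    have h1 : (α * z ^ 2 + β * z).re ≤ ‖β‖ * ‖z‖ + ‖α‖ * ‖z‖ ^ 2 := by
      refine (Complex.re_le_norm _).trans ((norm_add_le _ _).trans ?_)
      rw [norm_mul, norm_mul, norm_pow, add_comm]
    calc ‖p.eval z‖ * Real.exp (α * z ^ 2 + β * z).re
        ≤ ‖p.eval z‖ * Real.exp (‖β‖ * ‖z‖ + ‖α‖ * ‖z‖ ^ 2) := by gcongr
      _ = ‖p.eval z‖ * Real.exp (‖β‖ * ‖z‖) * Real.exp (‖α‖ * ‖z‖ ^ 2) := by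
          rw [Real.exp_add, mul_assoc]
      _ ≤ K * Real.exp ((a - ‖α‖) * ‖z‖ ^ 2) * Real.exp (‖α‖ * ‖z‖ ^ 2) := by
          exact mul_le_mul_of_nonneg_right (hK z) (Real.exp_pos _).le
      _ = _ := by
          rw [mul_assoc, ← Real.exp_add]
          ring_nf
  have hbpos : 0 < 2 * b := by linarith
  have hP := lintegral_norm_sq_gaussian (hasSum_fockFun hc) hbpos
    (differentiable_fockFun hc).continuous
  have hG := lintegral_norm_sq_gaussian (F := fun _ => 1) (a := fun n => if n = 0 then 1 else 0)
    (fun z => by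
      refine (hasSum_ite_eq 0 (1 : ℂ)).congr_fun fun n => ?_
      by_cases h : n = 0 <;> simp [h]) (sub_pos.2 (by linarith : 2 * a < 2 * b)) continuous_const
  have hGfin : ∫⁻ z : ℂ, ‖(1 : ℂ)‖ₑ ^ 2 * ENNReal.ofReal (Real.exp (-(2 * b - 2 * a) * ‖z‖ ^ 2)) ≠ ⊤ := by
    rw [hG, tsum_eq_single 0 (fun n hn => by simp [hn])]
    exact ENNReal.ofReal_ne_top
  have hfin : ∫⁻ z : ℂ, ‖fockFun c z‖ₑ ^ 2 * ENNReal.ofReal (Real.exp (-(2 * b) * ‖z‖ ^ 2)) ≠ ⊤ := by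
    refine ne_top_of_le_ne_top (ENNReal.mul_ne_top (ENNReal.ofReal_ne_top (r := K ^ 2)) hGfin) ?_
    rw [← lintegral_const_mul' _ _ ENNReal.ofReal_ne_top]
    refine lintegral_mono fun z => ?_
    rw [← ofReal_norm, ← ENNReal.ofReal_pow (norm_nonneg _), ← ENNReal.ofReal_mul (by positivity),
      enorm_one, one_pow, one_mul, ← ENNReal.ofReal_mul (by positivity)]
    refine ENNReal.ofReal_le_ofReal ?_
    calc ‖fockFun c z‖ ^ 2 * Real.exp (-(2 * b) * ‖z‖ ^ 2)
        ≤ (K * Real.exp (a * ‖z‖ ^ 2)) ^ 2 * Real.exp (-(2 * b) * ‖z‖ ^ 2) := by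
          gcongr
          exact hfb z
      _ = K ^ 2 * (Real.exp (a * ‖z‖ ^ 2) * Real.exp (a * ‖z‖ ^ 2) *
            Real.exp (-(2 * b) * ‖z‖ ^ 2)) := by ring
      _ = _ := by
          rw [← Real.exp_add, ← Real.exp_add]
          ring_nf
  rw [hP] at hfin
  have hbd := fun n => ENNReal.le_tsum (f := fun n => ENNReal.ofReal (‖taylorC c n‖ ^ 2 *
    (Real.pi * n.factorial / (2 * b) ^ (n + 1)))) n
  set T := (∑' n, ENNReal.ofReal (‖taylorC c n‖ ^ 2 *
    (Real.pi * n.factorial / (2 * b) ^ (n + 1)))).toReal with hT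
  have hT0 : 0 ≤ T := ENNReal.toReal_nonneg
  have hbd2 : ∀ n, ‖c n‖ ^ 2 ≤ T * (2 * b) ^ (n + 1) := by
    intro n
    have h1 := hbd n
    rw [← ENNReal.ofReal_toReal hfin, ← hT, ENNReal.ofReal_le_ofReal_iff hT0, norm_taylorC_sq] at h1
    have h2 : (n.factorial : ℝ) ≠ 0 := by positivity
    have h3 := Real.pi_ne_zero
    have h4 : ‖c n‖ ^ 2 / (Real.pi * n.factorial) * (Real.pi * n.factorial / (2 * b) ^ (n + 1)) =
      ‖c n‖ ^ 2 / (2 * b) ^ (n + 1) := by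
      field_simp
    rw [h4, div_le_iff₀ (by positivity)] at h1
    exact h1
  refine ⟨√(2 * b), √(T * (2 * b)), Real.sqrt_pos.2 hbpos, ?_, fun n => ?_⟩
  · rw [Real.sqrt_lt' one_pos]
    linarith
  · refine le_of_sq_le_sq ?_ (by positivity)
    rw [mul_pow, ← pow_mul, mul_comm n 2, pow_mul, Real.sq_sqrt (by positivity),
      Real.sq_sqrt (by positivity)]
    refine (hbd2 n).trans (le_of_eq ?_)
    ring

theorem massC_eq_of_fockState_eq {c d : ℕ → ℂ} {w w' : ℂ} (hc : Tame c) (hd : Tame d)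
    (h : fockState c w = fockState d w') : massC c = massC d := by
  have h1 := mass_fockState (summable_norm_sq_of_tame hc) w
  rw [h, mass_fockState (summable_norm_sq_of_tame hd)] at h1
  exact ((ENNReal.ofReal_eq_ofReal_iff (massC_nonneg _) (massC_nonneg _)).1 h1).symm

theorem quartC_eq_of_fockState_eq {c d : ℕ → ℂ} {w w' : ℂ} (hc : Tame c) (hd : Tame d)
    (h : fockState c w = fockState d w') : quartC c = quartC d := by
  have h1 := lintegral_norm_fockState_pow_four (summable_norm_sq_of_tame hc) w
  rw [h, lintegral_norm_fockState_pow_four (summable_norm_sq_of_tame hd)] at h1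
  have h2 := (ENNReal.ofReal_eq_ofReal_iff (div_nonneg (quartC_nonneg _) (by positivity))
    (div_nonneg (quartC_nonneg _) (by positivity))).1 h1
  have := Real.pi_pos
  field_simp at h2
  exact h2.symm

theorem momC_eq_of_fockState_eq {c d : ℕ → ℂ} {w w' : ℂ} (hc : Tame c) (hd : Tame d)
    (h : fockState c w = fockState d w') : momC w c = momC w' d := by
  have h1 := lintegral_moment_fockState (summable_norm_sq_of_tame hc) w
  rw [h, lintegral_moment_fockState (summable_norm_sq_of_tame hd),
    ← ENNReal.ofReal_tsum_of_nonneg (fun n => by positivity) (summable_norm_shiftC_sq hc w),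
    ← ENNReal.ofReal_tsum_of_nonneg (fun n => by positivity) (summable_norm_shiftC_sq hd w')] at h1
  exact ((ENNReal.ofReal_eq_ofReal_iff (momC_nonneg _ _) (momC_nonneg _ _)).1 h1).symm

open Polynomial in
/-- A polynomial times an exponential is the translate of a polynomial Fock state. -/
theorem exists_translate {c : ℕ → ℂ} {p : ℂ[X]} {β : ℂ}
    (hf : ∀ z, fockFun c z = p.eval z * Complex.exp (β * z)) :
    ∃ P : ℂ[X], P.natDegree = p.natDegree ∧
      fockState c 0 = fockState (polyC P) ((starRingEnd ℂ) β) := by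
  -- A translate by w carries exp(z conj w), so w must be conj β; the constant in the witness undoes
  -- the factor exp(-‖w‖²/2).
  set w := (starRingEnd ℂ) β with hw
  refine ⟨C (Complex.exp ((‖w‖ ^ 2 / 2 : ℝ) : ℂ)) * p.comp (X + C w), ?_, ?_⟩
  · rw [natDegree_C_mul (Complex.exp_ne_zero _), natDegree_comp, natDegree_X_add_C, mul_one]
  · ext z
    rw [fockState_zero_apply, fockState, fockFun_polyC, hf, eval_mul, eval_C, eval_comp, eval_add,
      eval_X, eval_C, sub_add_cancel, ← mul_assoc (Complex.exp _) (Complex.exp _), ← Complex.exp_add,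
      hw, Complex.conj_conj, sub_add_cancel, mul_comm (p.eval z), mul_comm z]

/-! ### Two-level states and the equality case -/

theorem quad_eq_zero {c : ℕ → ℂ} {N k : ℕ} (h : ∀ n, N < n → c n = 0) (hk : 2 * N < k) :
    quad c k = 0 := by
  rw [quad, bil]
  refine Finset.sum_eq_zero fun p hp => ?_
  have hp' := Finset.HasAntidiagonal.mem_antidiagonal.1 hp
  rcases lt_or_ge N p.1 with h1 | h1
  · rw [h _ h1, zero_mul, mul_zero]
  · rw [h p.2 (by omega), mul_zero, mul_zero]

theorem massC_eq_sum {c : ℕ → ℂ} {N : ℕ} (h : ∀ n, N < n → c n = 0) :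
    massC c = ∑ n ∈ Finset.range (N + 1), ‖c n‖ ^ 2 :=
  tsum_eq_sum fun n hn => by rw [h n (by simpa using hn), norm_zero, zero_pow two_ne_zero]

theorem angC_eq_sum {c : ℕ → ℂ} {N : ℕ} (h : ∀ n, N < n → c n = 0) :
    angC c = ∑ n ∈ Finset.range (N + 1), (n : ℝ) * ‖c n‖ ^ 2 :=
  tsum_eq_sum fun n hn => by rw [h n (by simpa using hn), norm_zero, zero_pow two_ne_zero, mul_zero]

theorem quartC_eq_sum {c : ℕ → ℂ} {N : ℕ} (h : ∀ n, N < n → c n = 0) :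
    quartC c = ∑ k ∈ Finset.range (2 * N + 1), ‖quad c k‖ ^ 2 :=
  tsum_eq_sum fun n hn => by
    rw [quad_eq_zero h (by simpa using hn), norm_zero, zero_pow two_ne_zero]

theorem momC_eq_sum {c : ℕ → ℂ} {N : ℕ} (h : ∀ n, N < n → c n = 0) (w : ℂ) :
    momC w c = ∑ n ∈ Finset.range (N + 2), ‖shiftC w c n‖ ^ 2 :=
  tsum_eq_sum fun n hn => by
    have : N + 2 ≤ n := by simpa using hn
    rw [shiftC, h n (by omega), h (n - 1) (by omega), mul_zero, mul_zero, add_zero, norm_zero,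
      zero_pow two_ne_zero]

theorem bil_eq_sum_range (c d : ℕ → ℂ) (k : ℕ) :
    bil c d k = ∑ i ∈ Finset.range (k + 1), (wt k i : ℂ) * (c i * d (k - i)) :=
  Finset.Nat.sum_antidiagonal_eq_sum_range_succ (fun i j => (wt k i : ℂ) * (c i * d j)) k

theorem norm_sq_ofReal_mul (x : ℝ) (z : ℂ) : ‖(x : ℂ) * z‖ ^ 2 = x ^ 2 * ‖z‖ ^ 2 := by
  rw [norm_mul, mul_pow, Complex.norm_real, Real.norm_eq_abs, sq_abs]

theorem quad_zero (c : ℕ → ℂ) : ‖quad c 0‖ ^ 2 = ‖c 0‖ ^ 4 := by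
  rw [quad, bil_eq_sum_range]
  simp [wt]
  ring

theorem quad_one (c : ℕ → ℂ) : ‖quad c 1‖ ^ 2 = 2 * (‖c 0‖ ^ 2 * ‖c 1‖ ^ 2) := by
  have h : quad c 1 = ((2 * wt 1 0 : ℝ) : ℂ) * (c 0 * c 1) := by
    rw [quad, bil_eq_sum_range]
    simp [Finset.sum_range_succ, wt]
    ring
  rw [h, norm_sq_ofReal_mul, mul_pow, wt_sq, norm_mul, mul_pow]
  norm_num

theorem quartC_two_level {v : ℕ → ℂ} (h : ∀ n, 1 < n → v n = 0) :
    quartC v = ‖v 0‖ ^ 4 + 2 * (‖v 0‖ ^ 2 * ‖v 1‖ ^ 2) + ‖v 1‖ ^ 4 / 2 := by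
  have h2 : quad v 2 = (wt 2 1 : ℂ) * (v 1 * v 1) := by
    rw [quad, bil_eq_sum_range]
    simp [Finset.sum_range_succ, h 2]
  rw [quartC_eq_sum h]
  simp only [Finset.sum_range_succ, Finset.range_one, Finset.sum_singleton, mul_one]
  rw [quad_zero, quad_one, h2, norm_sq_ofReal_mul, wt_sq, norm_mul]
  norm_num
  ring

theorem momC_two_level {v : ℕ → ℂ} (h : ∀ n, 1 < n → v n = 0) (w : ℂ) :
    momC w v = ‖w‖ ^ 2 * ‖v 0‖ ^ 2 + ‖v 0 + w * v 1‖ ^ 2 + 2 * ‖v 1‖ ^ 2 := by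
  rw [momC_eq_sum h]
  simp only [Finset.sum_range_succ, Finset.sum_range_zero, zero_add]
  have h0 : shiftC w v 0 = w * v 0 := by simp [shiftC]
  have h1 : shiftC w v 1 = v 0 + w * v 1 := by simp [shiftC]
  have h2 : shiftC w v 2 = (√2 : ℝ) * v 1 := by simp [shiftC, h 2]
  rw [h0, h1, h2, norm_sq_ofReal_mul, norm_mul, mul_pow, Real.sq_sqrt (by norm_num)]

/-- The reverse triangle inequality optimises the phase of w; completing the square in ‖w‖ then
isolates the best translation length ‖v 0‖ ‖v 1‖. -/
theorem momC_two_level_ge {v : ℕ → ℂ} (h : ∀ n, 1 < n → v n = 0)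
    (h1 : ‖v 0‖ ^ 2 + ‖v 1‖ ^ 2 = 1) (w : ℂ) :
    1 + ‖v 1‖ ^ 4 + (‖w‖ - ‖v 0‖ * ‖v 1‖) ^ 2 ≤ momC w v := by
  rw [momC_two_level h]
  have h2 : (‖v 0‖ - ‖w‖ * ‖v 1‖) ^ 2 ≤ ‖v 0 + w * v 1‖ ^ 2 := by
    have := abs_norm_sub_norm_le (v 0) (-(w * v 1))
    rw [sub_neg_eq_add, norm_neg, norm_mul] at this
    rw [← sq_abs]
    gcongr
  have h3 : ‖v 0‖ ^ 2 = 1 - ‖v 1‖ ^ 2 := by linarith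
  have h4 : ‖v 1‖ ^ 4 = (‖v 1‖ ^ 2) ^ 2 := by ring
  have h5 : ‖w‖ ^ 2 * ‖v 0‖ ^ 2 + (‖v 0‖ - ‖w‖ * ‖v 1‖) ^ 2 + 2 * ‖v 1‖ ^ 2 =
      1 + ‖v 1‖ ^ 4 + (‖w‖ - ‖v 0‖ * ‖v 1‖) ^ 2 := by
    have : ‖w‖ ^ 2 * ‖v 0‖ ^ 2 + (‖v 0‖ - ‖w‖ * ‖v 1‖) ^ 2 + 2 * ‖v 1‖ ^ 2 =
      ‖w‖ ^ 2 * (‖v 0‖ ^ 2 + ‖v 1‖ ^ 2) + ‖v 0‖ ^ 2 + 2 * ‖v 1‖ ^ 2 - 2 * ‖v 0‖ * ‖w‖ * ‖v 1‖ := by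
      ring
    rw [this, h1, sub_sq, mul_pow, h3, h4]
    ring
  linarith

theorem quartC_two_level' {v : ℕ → ℂ} (h : ∀ n, 1 < n → v n = 0)
    (h1 : ‖v 0‖ ^ 2 + ‖v 1‖ ^ 2 = 1) : quartC v = 1 - ‖v 1‖ ^ 4 / 2 := by
  rw [quartC_two_level h]
  have h3 : ‖v 0‖ ^ 2 = 1 - ‖v 1‖ ^ 2 := by linarith
  have h4 : ‖v 0‖ ^ 4 = (‖v 0‖ ^ 2) ^ 2 := by ring
  rw [h4, h3]
  ring

/-- Two-level translated states with energy not above the vortex state are the vortex state. -/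
theorem two_level_rigidity {v : ℕ → ℂ} (h : ∀ n, 1 < n → v n = 0) (h1 : massC v = 1) {w : ℂ} {μ : ℝ}
    (hμ : 0 < μ) (hE : quartC v + μ * (momC w v - 1) ≤ 1 / 2 + μ)
    (hcase : μ < 1 / 2 ∨ (μ = 1 / 2 ∧ 2 ≤ momC w v)) : v 0 = 0 ∧ ‖v 1‖ = 1 ∧ w = 0 := by
  have hm : ‖v 0‖ ^ 2 + ‖v 1‖ ^ 2 = 1 := by
    rw [massC_eq_sum h] at h1
    simpa [Finset.sum_range_succ] using h1
  have h2 := momC_two_level_ge h hm w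
  rw [quartC_two_level' h hm] at hE
  have hx1 : ‖v 1‖ ^ 2 ≤ 1 := by nlinarith [sq_nonneg ‖v 0‖]
  have hx4 : ‖v 1‖ ^ 4 = (‖v 1‖ ^ 2) ^ 2 := by ring
  rw [hx4] at hE h2
  set x := ‖v 1‖ ^ 2 with hx
  have hx0 : 0 ≤ x := by positivity
  have hs := sq_nonneg (‖w‖ - ‖v 0‖ * ‖v 1‖)
  have hmul : μ * (x ^ 2 + (‖w‖ - ‖v 0‖ * ‖v 1‖) ^ 2) ≤ μ * (momC w v - 1) :=
    mul_le_mul_of_nonneg_left (by linarith) hμ.le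
  -- With x = ‖v 1‖² the energy bound gives (1/2 - μ)(1 - x²) ≤ 0. At μ = 1/2 this is void, because
  -- a whole family of translates is then optimal; the assumption on the second moment forces x² ≥ 1
  -- instead.
  have hxx : x = 1 ∧ μ * (‖w‖ - ‖v 0‖ * ‖v 1‖) ^ 2 ≤ 0 := by
    have hx2 : x ^ 2 ≤ 1 := by nlinarith
    rcases hcase with hlt | ⟨rfl, h3⟩
    · have h4 : (1 / 2 - μ) * (1 - x ^ 2) ≤ 0 := by nlinarith
      have h5 : x ^ 2 = 1 := by nlinarith
      have h6 : x = 1 := by nlinarith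
      exact ⟨h6, by rw [h6] at hmul hE; nlinarith⟩
    · have h5 : 1 ≤ x ^ 2 := by nlinarith
      have h6 : x = 1 := by nlinarith
      exact ⟨h6, by rw [h6] at hmul hE; nlinarith⟩
  obtain ⟨hx1', hw⟩ := hxx
  have hv0 : v 0 = 0 := by
    have : ‖v 0‖ ^ 2 = 0 := by linarith
    simpa using this
  refine ⟨hv0, ?_, ?_⟩
  · have := norm_nonneg (v 1)
    nlinarith
  · rw [hv0, norm_zero, zero_mul, sub_zero] at hw
    have : ‖w‖ ^ 2 ≤ 0 := by nlinarith
    have : ‖w‖ ^ 2 = 0 := le_antisymm this (by positivity)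
    simpa using this

theorem fockState_eq_imp {c d : ℕ → ℂ} (hc : Summable fun n => ‖c n‖ ^ 2)
    (hd : Summable fun n => ‖d n‖ ^ 2) (h : fockState c 0 = fockState d 0) : c = d := by
  refine fockFun_injective hc hd fun z => ?_
  have h1 := congrFun h z
  rw [fockState_zero_apply, fockState_zero_apply] at h1
  refine mul_left_cancel₀ ?_ h1
  rw [Complex.ofReal_ne_zero]
  exact (Real.exp_pos _).ne'

-- A zero z of f makes the right side vanish at t = z - s, and a = f(s)² ≠ 0 ensures that this
-- polynomial is not zero.
open Polynomial in
theorem finite_zeros_of_slice {f : ℂ → ℂ} {s a b : ℂ} (hs : f s ≠ 0)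
    (h : ∀ t, f (s + t) * f (s - t) = a + b * t ^ 2) : {z | f z = 0}.Finite := by
  have ha : a ≠ 0 := by
    have := h 0
    simp only [add_zero, sub_zero, ne_eq, OfNat.ofNat_ne_zero, not_false_eq_true, zero_pow,
      mul_zero] at this
    rw [← this]
    exact mul_ne_zero hs hs
  set q : ℂ[X] := C a + C b * (X - C s) ^ 2 with hq
  have hq0 : q ≠ 0 := by
    intro h0
    have := congrArg (Polynomial.eval s) h0
    simp [hq] at this
    exact ha this
  refine (q.roots.toFinset.finite_toSet).subset fun z hz => ?_
  have hz' : f z = 0 := hz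
  have h1 := h (z - s)
  rw [add_sub_cancel, hz', zero_mul] at h1
  simp only [Multiset.mem_toFinset, Finset.mem_coe, mem_roots hq0, IsRoot.def]
  simp [hq, ← h1]

theorem exists_factorization_fockFun {c : ℕ → ℂ} (hc : Tame c) (h1 : massC c = 1)
    (hfin : {z | fockFun c z = 0}.Finite) :
    ∃ (p : Polynomial ℂ) (α β : ℂ), p ≠ 0 ∧ ‖α‖ < 1 / 2 ∧
      ∀ z, fockFun c z = p.eval z * Complex.exp (α * z ^ 2 + β * z) := by
  have hs := summable_norm_sq_of_tame hc
  obtain ⟨p, α, β, hp, hf⟩ := exists_factorization (differentiable_fockFun hs)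
    (frequently_fockFun_ne_zero hs h1).exists hfin (norm_fockFun_le hs)
  refine ⟨p, α, β, hp, norm_lt_of_growth hp (β := β) (C := √(momC 0 c / Real.pi)) fun z => ?_, hf⟩
  rw [← hf]
  refine (norm_mul_fockFun_le hc z).trans (le_of_eq ?_)
  ring_nf

-- The linear exponents cancel in t in the product, which leaves exp(2αt²) times a polynomial of
-- degree 2 deg p. Growth along a ray excludes α ≠ 0, and comparing degrees gives 2 deg p ≤ 2.
open Polynomial in
theorem eq_of_slice {f : ℂ → ℂ} {s a b α β : ℂ} {p : ℂ[X]} (hp : p ≠ 0)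
    (hf : ∀ z, f z = p.eval z * Complex.exp (α * z ^ 2 + β * z))
    (h : ∀ t, f (s + t) * f (s - t) = a + b * t ^ 2) : α = 0 ∧ p.natDegree ≤ 1 := by
  set p₁ : ℂ[X] := p.comp (X + C s) * p.comp (C s - X) with hp₁
  set k : ℂ := Complex.exp (2 * α * s ^ 2 + 2 * β * s) with hk
  have hk0 : k ≠ 0 := Complex.exp_ne_zero _
  have hdeg1 : (X + C s : ℂ[X]).natDegree = 1 := natDegree_X_add_C s
  have hdeg2 : (C s - X : ℂ[X]).natDegree = 1 := by
    rw [← neg_sub, natDegree_neg, natDegree_X_sub_C]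
  have hc1 : p.comp (X + C s) ≠ 0 := by
    intro h0
    rcases comp_eq_zero_iff.1 h0 with h1 | h1
    · exact hp h1
    · rw [h1.2, natDegree_C] at hdeg1
      exact zero_ne_one hdeg1
  have hc2 : p.comp (C s - X) ≠ 0 := by
    intro h0
    rcases comp_eq_zero_iff.1 h0 with h1 | h1
    · exact hp h1
    · rw [h1.2, natDegree_C] at hdeg2
      exact zero_ne_one hdeg2
  have hp₁0 : p₁ ≠ 0 := mul_ne_zero hc1 hc2
  have hprod : ∀ t, k * (p₁.eval t * Complex.exp (2 * α * t ^ 2 + 0 * t)) = a + b * t ^ 2 := by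
    intro t
    rw [← h t, hf, hf, hp₁, eval_mul, eval_comp, eval_comp, eval_add, eval_sub, eval_X, eval_C, hk]
    rw [show ∀ A B D E : ℂ, A * (B * D * E) = B * D * (A * E) from fun _ _ _ _ => by ring,
      ← Complex.exp_add, show ∀ A B D E : ℂ, A * B * (D * E) = A * D * (B * E) from
      fun _ _ _ _ => by ring, ← Complex.exp_add, add_comm s t]
    congr 2
    ring
  have hα : α = 0 := by
    by_contra hα
    have hαpos : 0 < ‖2 * α‖ := by
      rw [norm_pos_iff]
      exact mul_ne_zero two_ne_zero hα
    obtain ⟨K, hK0, hK⟩ := exists_norm_eval_mul_exp_le (X * (C a + C b * X ^ 2)) 0 hαpos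
    have := norm_lt_of_growth hp₁0 (α := 2 * α) (β := 0) (a := ‖2 * α‖) (C := K / ‖k‖) fun z => by
      have h1 := hK z
      rw [zero_mul, Real.exp_zero, mul_one] at h1
      simp only [eval_mul, eval_add, eval_X, eval_C, eval_pow] at h1
      rw [← hprod z, norm_mul, norm_mul k] at h1
      rw [div_mul_eq_mul_div, le_div_iff₀ (norm_pos_iff.2 hk0)]
      linarith
    exact lt_irrefl _ this
  refine ⟨hα, ?_⟩
  have hpoly : C k * p₁ = C a + C b * X ^ 2 := by
    refine Polynomial.funext fun t => ?_
    have := hprod t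
    rw [hα, mul_zero, zero_mul, zero_mul, add_zero, Complex.exp_zero, mul_one] at this
    simpa using this
  have hd : (C k * p₁).natDegree = 2 * p.natDegree := by
    rw [natDegree_C_mul hk0, hp₁, natDegree_mul hc1 hc2, natDegree_comp, natDegree_comp, hdeg1, hdeg2]
    ring
  have hd2 : (C a + C b * X ^ 2 : ℂ[X]).natDegree ≤ 2 := by
    compute_degree
  rw [← hpoly, hd] at hd2
  omega

/-- The equality case of the basic inequality, with angular momentum at least one. -/
theorem equality_case {c : ℕ → ℂ} (hc : Tame c) (h1 : massC c = 1)
    (hE : 2 * quartC c + angC c ≤ 2) (hP : 1 ≤ angC c) : ‖c 1‖ = 1 ∧ ∀ n, n ≠ 1 → c n = 0 := by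
  have hmom := momC_zero hc
  rw [h1] at hmom
  obtain ⟨s, a, b, hs, hab⟩ := (quartC_add_momC hc h1).2 (by linarith)
  obtain ⟨p, α, β, hp, -, hf⟩ := exists_factorization_fockFun hc h1 (finite_zeros_of_slice hs hab)
  obtain ⟨rfl, hdeg⟩ := eq_of_slice hp hf hab
  simp only [zero_mul, zero_add] at hf
  obtain ⟨P, hPdeg, hst⟩ := exists_translate hf
  have hT := tame_polyC P
  have hz : ∀ n, 1 < n → polyC P n = 0 := fun n hn => polyC_eq_zero (by omega)
  have hQ := quartC_eq_of_fockState_eq hc hT hst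
  have hM := momC_eq_of_fockState_eq hc hT hst
  have hm := massC_eq_of_fockState_eq hc hT hst
  -- This is the degenerate parameter 1/2; P ≥ 1 enters as second moment at least 2.
  obtain ⟨h0, h11, hw⟩ := two_level_rigidity hz (hm ▸ h1) (μ := 1 / 2) (by norm_num)
    (by rw [← hQ, ← hM]; linarith) (Or.inr ⟨rfl, by rw [← hM]; linarith⟩)
  rw [hw] at hst
  have hcP := fockState_eq_imp (summable_norm_sq_of_tame hc) (summable_norm_sq_of_tame hT) hst
  rw [hcP]
  refine ⟨h11, fun n hn => ?_⟩
  rcases Nat.lt_or_ge 1 n with h | h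
  · exact hz n h
  · have : n = 0 := by omega
    rw [this, h0]

/-! ### Strictness of the basic inequality: expansion at φ₁ and compactness -/

theorem norm_add_sq_ge (a b : ℂ) : ‖a‖ ^ 2 - 2 * (‖a‖ * ‖b‖) ≤ ‖a + b‖ ^ 2 := by
  have h := norm_sub_le (a + b) b
  rw [add_sub_cancel_right] at h
  nlinarith [norm_nonneg a, norm_nonneg b, norm_nonneg (a + b), sq_nonneg (‖a + b‖ - ‖a‖),
    sq_nonneg ‖b‖]

theorem norm_wt_mul (k i : ℕ) (z : ℂ) : ‖(wt k i : ℂ) * z‖ = wt k i * ‖z‖ := by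
  rw [norm_mul, Complex.norm_real, Real.norm_eq_abs, abs_of_nonneg (wt_nonneg k i)]

theorem quad_two_ge (c : ℕ → ℂ) :
    ‖c 1‖ ^ 4 / 2 - √2 * (‖c 1‖ ^ 2 * (‖c 0‖ * ‖c 2‖)) ≤ ‖quad c 2‖ ^ 2 := by
  have h : quad c 2 = (wt 2 1 : ℂ) * (c 1 * c 1) + (wt 2 0 : ℂ) * (2 * (c 0 * c 2)) := by
    rw [quad, bil_eq_sum_range]
    simp only [Finset.sum_range_succ, Finset.sum_range_zero]
    rw [← wt_symm (show 0 + 2 = 2 from rfl)]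
    ring
  rw [h]
  refine le_trans (le_of_eq ?_) (norm_add_sq_ge _ _)
  have h1 : wt 2 0 = 1 / 2 := by
    rw [wt, Real.sqrt_eq_iff_mul_self_eq] <;> norm_num
  have h2 : wt 2 1 = √2 / 2 := by
    rw [wt, Real.sqrt_eq_iff_mul_self_eq (by norm_num) (by positivity)]
    norm_num [div_mul_div_comm]
  rw [norm_wt_mul, norm_wt_mul, norm_mul, norm_mul, norm_mul, mul_pow, wt_sq, h1, h2]
  norm_num
  ring

theorem quad_three_ge (c : ℕ → ℂ) :
    3 / 2 * (‖c 1‖ ^ 2 * ‖c 2‖ ^ 2) - 2 * (‖c 1‖ * ‖c 2‖ * (‖c 0‖ * ‖c 3‖)) ≤ ‖quad c 3‖ ^ 2 := by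
  have h : quad c 3 = (wt 3 1 : ℂ) * (2 * (c 1 * c 2)) + (wt 3 0 : ℂ) * (2 * (c 0 * c 3)) := by
    rw [quad, bil_eq_sum_range]
    simp only [Finset.sum_range_succ, Finset.sum_range_zero]
    rw [← wt_symm (show 0 + 3 = 3 from rfl), ← wt_symm (show 1 + 2 = 3 from rfl)]
    ring
  rw [h]
  refine le_trans ?_ (norm_add_sq_ge _ _)
  have h3 : wt 3 1 * wt 3 0 ≤ 1 / 4 := by
    have e1 := wt_sq 3 1
    have e0 := wt_sq 3 0
    norm_num at e1 e0
    refine abs_le_of_sq_le_sq' ?_ (by norm_num) |>.2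
    rw [mul_pow, e1, e0]
    norm_num
  rw [norm_wt_mul, norm_wt_mul, norm_mul, norm_mul, norm_mul, norm_mul, mul_pow, wt_sq]
  have hnn : 0 ≤ ‖c 1‖ * ‖c 2‖ * (‖c 0‖ * ‖c 3‖) := by positivity
  have := mul_le_mul_of_nonneg_right h3 hnn
  norm_num
  nlinarith

theorem quad_four_ge (c : ℕ → ℂ) :
    ‖c 1‖ ^ 2 * ‖c 3‖ ^ 2 - 2 * (‖c 1‖ * ‖c 3‖ * (‖c 2‖ ^ 2 + ‖c 0‖ * ‖c 4‖)) ≤ ‖quad c 4‖ ^ 2 := by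
  have h : quad c 4 = (wt 4 1 : ℂ) * (2 * (c 1 * c 3)) +
      ((wt 4 2 : ℂ) * (c 2 * c 2) + (wt 4 0 : ℂ) * (2 * (c 0 * c 4))) := by
    rw [quad, bil_eq_sum_range]
    simp only [Finset.sum_range_succ, Finset.sum_range_zero]
    rw [← wt_symm (show 0 + 4 = 4 from rfl), ← wt_symm (show 1 + 3 = 4 from rfl)]
    ring
  rw [h]
  refine le_trans ?_ (norm_add_sq_ge _ _)
  have h1 : wt 4 1 = 1 / 2 := by
    rw [wt, Real.sqrt_eq_iff_mul_self_eq] <;> norm_num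
  have h0 : wt 4 0 = 1 / 4 := by
    rw [wt, Real.sqrt_eq_iff_mul_self_eq] <;> norm_num
  have h2 : wt 4 2 ≤ 1 := by
    have e := wt_sq 4 2
    have e' : ((4 : ℕ).choose 2 : ℝ) = 6 := by norm_num [Nat.choose]
    rw [e'] at e
    nlinarith [wt_nonneg 4 2]
  have hb : ‖(wt 4 2 : ℂ) * (c 2 * c 2) + (wt 4 0 : ℂ) * (2 * (c 0 * c 4))‖ ≤
      ‖c 2‖ ^ 2 + ‖c 0‖ * ‖c 4‖ := by
    refine (norm_add_le _ _).trans ?_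
    rw [norm_wt_mul, norm_wt_mul, h0, norm_mul, norm_mul, norm_mul, ← sq]
    have : wt 4 2 * ‖c 2‖ ^ 2 ≤ 1 * ‖c 2‖ ^ 2 := by gcongr
    have : 0 ≤ ‖c 0‖ * ‖c 4‖ := by positivity
    norm_num
    linarith
  have ha : ‖(wt 4 1 : ℂ) * (2 * (c 1 * c 3))‖ = ‖c 1‖ * ‖c 3‖ := by
    rw [norm_wt_mul, h1, norm_mul, norm_mul]
    norm_num
    ring
  rw [ha, mul_pow]
  gcongr

/-- Near φ₁ only c 1 is large. The modes k ≤ 4 are kept, and each is bounded below by its main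
square minus the cross term; the rest is nonnegative and can be dropped, since angular momentum
controls the high levels. -/
theorem quartC_ge {c : ℕ → ℂ} (hc : Tame c) :
    ‖c 0‖ ^ 4 + 2 * (‖c 0‖ ^ 2 * ‖c 1‖ ^ 2) +
      (‖c 1‖ ^ 4 / 2 - √2 * (‖c 1‖ ^ 2 * (‖c 0‖ * ‖c 2‖))) +
      (3 / 2 * (‖c 1‖ ^ 2 * ‖c 2‖ ^ 2) - 2 * (‖c 1‖ * ‖c 2‖ * (‖c 0‖ * ‖c 3‖))) +
      (‖c 1‖ ^ 2 * ‖c 3‖ ^ 2 - 2 * (‖c 1‖ * ‖c 3‖ * (‖c 2‖ ^ 2 + ‖c 0‖ * ‖c 4‖))) ≤ quartC c := by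
  have h := (summable_norm_quad_sq (summable_norm_sq_of_tame hc)).sum_le_tsum (Finset.range 5)
    (fun _ _ => by positivity)
  simp only [Finset.sum_range_succ, Finset.sum_range_zero, zero_add] at h
  rw [quad_zero, quad_one, ← quartC] at h
  have := quad_two_ge c
  have := quad_three_ge c
  have := quad_four_ge c
  linarith

theorem tail_decomposition {c : ℕ → ℂ} (hc : Tame c) : ∃ R S : ℝ, 0 ≤ R ∧ 5 * R ≤ S ∧
    massC c = ‖c 0‖ ^ 2 + ‖c 1‖ ^ 2 + ‖c 2‖ ^ 2 + ‖c 3‖ ^ 2 + ‖c 4‖ ^ 2 + R ∧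
    angC c = ‖c 1‖ ^ 2 + 2 * ‖c 2‖ ^ 2 + 3 * ‖c 3‖ ^ 2 + 4 * ‖c 4‖ ^ 2 + S := by
  have h1 := summable_norm_sq_of_tame hc
  have h2 := summable_ang_of_tame hc
  refine ⟨∑' n, ‖c (n + 5)‖ ^ 2, ∑' n : ℕ, ((n + 5 : ℕ) : ℝ) * ‖c (n + 5)‖ ^ 2,
    tsum_nonneg fun _ => by positivity, ?_, ?_, ?_⟩
  · rw [← tsum_mul_left]
    refine Summable.tsum_le_tsum (fun n => ?_) (((summable_nat_add_iff 5).2 h1).mul_left 5)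
      ((summable_nat_add_iff (f := fun n : ℕ => (n : ℝ) * ‖c n‖ ^ 2) 5).2 h2)
    gcongr
    push_cast
    have : (0 : ℝ) ≤ n := n.cast_nonneg
    linarith
  · rw [massC, ← h1.sum_add_tsum_nat_add 5]
    simp [Finset.sum_range_succ]
  · rw [angC, ← h2.sum_add_tsum_nat_add 5]
    simp [Finset.sum_range_succ]

/-- Eliminating y1² by the mass constraint, Q + P/2 - 1 is to leading order at least y0²/2 - √2 y0
y2 + y2² + y3² + y4²/2 plus a nonnegative tail. This form degenerates along y0 = √2 y2, where P - 1
= y2² - y0² < 0, so P ≥ 1 keeps away from the null direction. -/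
theorem local_inequality_real {y0 y1 y2 y3 y4 R S Q s2 : ℝ} (h0 : 0 ≤ y0) (h1 : 0 ≤ y1)
    (h2 : 0 ≤ y2) (h3 : 0 ≤ y3) (h4 : 0 ≤ y4) (hR : 0 ≤ R) (hRS : 5 * R ≤ S) (hs2 : s2 ^ 2 = 2)
    (hs2n : 0 ≤ s2)
    (hM : y0 ^ 2 + y1 ^ 2 + y2 ^ 2 + y3 ^ 2 + y4 ^ 2 + R = 1)
    (hP : 1 ≤ y1 ^ 2 + 2 * y2 ^ 2 + 3 * y3 ^ 2 + 4 * y4 ^ 2 + S)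
    (hclose : 1 - y1 ^ 2 ≤ (1 / 400) ^ 2)
    (hQ : y0 ^ 4 + 2 * (y0 ^ 2 * y1 ^ 2) + (y1 ^ 4 / 2 - s2 * (y1 ^ 2 * (y0 * y2))) +
      (3 / 2 * (y1 ^ 2 * y2 ^ 2) - 2 * (y1 * y2 * (y0 * y3))) +
      (y1 ^ 2 * y3 ^ 2 - 2 * (y1 * y3 * (y2 ^ 2 + y0 * y4))) ≤ Q) :
    1 / 40 * (y1 ^ 2 + 2 * y2 ^ 2 + 3 * y3 ^ 2 + 4 * y4 ^ 2 + S - 1) ≤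
      Q + (y1 ^ 2 + 2 * y2 ^ 2 + 3 * y3 ^ 2 + 4 * y4 ^ 2 + S) / 2 - 1 := by
  have hy1 : y1 ≤ 1 := by nlinarith [sq_nonneg y0, sq_nonneg y2, sq_nonneg y3, sq_nonneg y4]
  have hy3 : y3 ≤ 1 / 400 := by nlinarith [sq_nonneg y0, sq_nonneg y2, sq_nonneg y4]
  have e1 : y1 ^ 4 / 2 ≥ 1 / 2 - (y0 ^ 2 + y2 ^ 2 + y3 ^ 2 + y4 ^ 2 + R) := by
    nlinarith [sq_nonneg (y1 ^ 2 - 1)]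
  have hx1 : 1 - 1 / 400 ≤ y1 ^ 2 := by norm_num at hclose ⊢; linarith
  have hx1' : y1 ^ 2 ≤ 1 := by nlinarith
  have e2 : 2 * (y0 ^ 2 * y1 ^ 2) ≥ 2 * (1 - 1 / 400) * y0 ^ 2 := by
    nlinarith [mul_le_mul_of_nonneg_left hx1 (sq_nonneg y0)]
  have e3 : 3 / 2 * (y1 ^ 2 * y2 ^ 2) ≥ 3 / 2 * (1 - 1 / 400) * y2 ^ 2 := by
    nlinarith [mul_le_mul_of_nonneg_left hx1 (sq_nonneg y2)]
  have e4 : y1 ^ 2 * y3 ^ 2 ≥ (1 - 1 / 400) * y3 ^ 2 := by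
    nlinarith [mul_le_mul_of_nonneg_left hx1 (sq_nonneg y3)]
  -- The split is sharp, as 7/12 · 6/7 = 1/2. It leaves -y0²/12 + y2²/7 up to errors of order 1/400;
  -- the negative part is paid for by a multiple of P - 1 ≥ 0.
  have e5 : s2 * (y1 ^ 2 * (y0 * y2)) ≤ 7 / 12 * y0 ^ 2 + 6 / 7 * y2 ^ 2 := by
    have a1 : s2 * (y1 ^ 2 * (y0 * y2)) ≤ s2 * (1 * (y0 * y2)) := by gcongr
    have a2 : (s2 * y0) ^ 2 = 2 * y0 ^ 2 := by rw [mul_pow, hs2]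
    have a3 := sq_nonneg (7 / 12 * (s2 * y0) - y2)
    have a4 : 7 / 6 * (s2 * y0 * y2) ≤ 49 / 144 * (s2 * y0) ^ 2 + y2 ^ 2 := by linarith
    rw [a2] at a4
    linarith
  have y13 : y1 * y3 ≤ 1 / 400 := by
    calc y1 * y3 ≤ 1 * (1 / 400) := by gcongr
      _ = _ := by norm_num
  have e6 : 2 * (y1 * y2 * (y0 * y3)) ≤ 1 / 400 * (y0 ^ 2 + y2 ^ 2) := by
    have a1 : y1 * y3 * (y0 * y2) ≤ 1 / 400 * (y0 * y2) := by gcongr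
    have a2 := two_mul_le_add_sq y0 y2
    linarith
  have e7 : 2 * (y1 * y3 * (y2 ^ 2 + y0 * y4)) ≤ 1 / 400 * (2 * y2 ^ 2 + y0 ^ 2 + y4 ^ 2) := by
    have a1 : y1 * y3 * (y2 ^ 2 + y0 * y4) ≤ 1 / 400 * (y2 ^ 2 + y0 * y4) := by gcongr
    have a2 := two_mul_le_add_sq y0 y4
    linarith
  have e8 : 0 ≤ y0 ^ 4 := by positivity
  linarith [sq_nonneg y0, sq_nonneg y2, sq_nonneg y3, sq_nonneg y4]

/-- The energy inequality near the vortex state. -/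
theorem local_inequality {c : ℕ → ℂ} (hc : Tame c) (h1 : massC c = 1) (hP : 1 ≤ angC c)
    (hclose : 1 - ‖c 1‖ ^ 2 ≤ (1 / 400) ^ 2) :
    1 / 40 * (angC c - 1) ≤ quartC c + angC c / 2 - 1 := by
  obtain ⟨R, S, hR, hRS, hM, hA⟩ := tail_decomposition hc
  rw [hA] at hP ⊢
  exact local_inequality_real (norm_nonneg _) (norm_nonneg _) (norm_nonneg _) (norm_nonneg _)
    (norm_nonneg _) hR hRS (Real.sq_sqrt (by norm_num)) (Real.sqrt_nonneg 2) (by rw [← h1, hM]) hP hclose (quartC_ge hc)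

/-- Markov's inequality for the distribution |c_n|²: bounded angular momentum makes the mass tight.
-/
theorem sum_range_ge_of_ang {c : ℕ → ℂ} (hc : Tame c) {B : ℝ} (hB : angC c ≤ B) (K : ℕ) :
    massC c - B / (K + 1) ≤ ∑ n ∈ Finset.range (K + 1), ‖c n‖ ^ 2 := by
  have h1 := summable_norm_sq_of_tame hc
  have h2 := summable_ang_of_tame hc
  have h3 : ∑' n, ‖c (n + (K + 1))‖ ^ 2 ≤ angC c / (K + 1) := by
    rw [angC, ← h2.sum_add_tsum_nat_add (K + 1), le_div_iff₀ (by positivity), ← tsum_mul_right]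
    refine le_trans ?_ (le_add_of_nonneg_left (Finset.sum_nonneg fun i _ => by positivity))
    refine Summable.tsum_le_tsum (fun n => ?_) (((summable_nat_add_iff (K + 1)).2 h1).mul_right _)
      ((summable_nat_add_iff (f := fun n : ℕ => (n : ℝ) * ‖c n‖ ^ 2) (K + 1)).2 h2)
    rw [mul_comm]
    gcongr
    push_cast
    have : (0 : ℝ) ≤ n := n.cast_nonneg
    linarith
  have h4 : angC c / (K + 1) ≤ B / (K + 1) := by gcongr
  rw [massC, ← h1.sum_add_tsum_nat_add (K + 1)]
  linarith

/-- An ultrafilter gives limits of all coefficients and energies at once, in place of a diagonal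
extraction. -/
theorem exists_tendsto_ultrafilter {X : Type*} [TopologicalSpace X] {s : Set X} (hs : IsCompact s)
    (F : Ultrafilter ℕ) {f : ℕ → X} (hf : ∀ n, f n ∈ s) :
    ∃ x ∈ s, Filter.Tendsto f F (nhds x) :=
  hs.ultrafilter_le_nhds' (F.map f) (by
    rw [Ultrafilter.mem_map]
    exact Filter.univ_mem' hf)

theorem norm_le_one_of_massC {c : ℕ → ℂ} (hc : Tame c) (h1 : massC c = 1) (k : ℕ) : ‖c k‖ ≤ 1 := by
  have h := (summable_norm_sq_of_tame hc).le_tsum k (fun _ _ => by positivity)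
  rw [← massC, h1] at h
  nlinarith [norm_nonneg (c k)]

/-- A sequence of states of unit mass and bounded angular momentum has a limit of unit mass along
an ultrafilter; energies are lower semicontinuous. -/
theorem exists_limit_state (F : Ultrafilter ℕ) {c : ℕ → ℕ → ℂ} (hc : ∀ n, Tame (c n))
    (h1 : ∀ n, massC (c n) = 1) {B : ℝ} (hB : ∀ n, angC (c n) ≤ B) :
    ∃ d : ℕ → ℂ, Tame d ∧ massC d = 1 ∧ (∀ k, Filter.Tendsto (fun n => c n k) F (nhds (d k))) ∧
      (∀ p, Filter.Tendsto (fun n => angC (c n)) F (nhds p) → angC d ≤ p) ∧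
      ∀ q, Filter.Tendsto (fun n => quartC (c n)) F (nhds q) → quartC d ≤ q := by
  have hlim : ∀ k, ∃ x ∈ Metric.closedBall (0 : ℂ) 1,
      Filter.Tendsto (fun n => c n k) F (nhds x) := fun k =>
    exists_tendsto_ultrafilter (isCompact_closedBall _ _) F fun n => by
      simpa using norm_le_one_of_massC (hc n) (h1 n) k
  choose d _ hd using hlim
  have hsq : ∀ k, Filter.Tendsto (fun n => ‖c n k‖ ^ 2) F (nhds (‖d k‖ ^ 2)) := fun k =>
    (hd k).norm.pow 2
  have hangK : ∀ K, Filter.Tendsto (fun n => ∑ k ∈ Finset.range K, (k : ℝ) * ‖c n k‖ ^ 2) F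
      (nhds (∑ k ∈ Finset.range K, (k : ℝ) * ‖d k‖ ^ 2)) := fun K =>
    tendsto_finsetSum _ fun k _ => (hsq k).const_mul _
  have hmK : ∀ K, Filter.Tendsto (fun n => ∑ k ∈ Finset.range K, ‖c n k‖ ^ 2) F
      (nhds (∑ k ∈ Finset.range K, ‖d k‖ ^ 2)) := fun K =>
    tendsto_finsetSum _ fun k _ => hsq k
  have hang_le : ∀ n K, ∑ k ∈ Finset.range K, (k : ℝ) * ‖c n k‖ ^ 2 ≤ angC (c n) := fun n K =>
    (summable_ang_of_tame (hc n)).sum_le_tsum _ fun _ _ => by positivity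
  have hm_le : ∀ n K, ∑ k ∈ Finset.range K, ‖c n k‖ ^ 2 ≤ 1 := fun n K => by
    rw [← h1 n]
    exact (summable_norm_sq_of_tame (hc n)).sum_le_tsum _ fun _ _ => by positivity
  have hangd : ∀ K, ∑ k ∈ Finset.range K, (k : ℝ) * ‖d k‖ ^ 2 ≤ B := fun K =>
    le_of_tendsto (hangK K) (Filter.Eventually.of_forall fun n => (hang_le n K).trans (hB n))
  have hmd : ∀ K, ∑ k ∈ Finset.range K, ‖d k‖ ^ 2 ≤ 1 := fun K =>
    le_of_tendsto (hmK K) (Filter.Eventually.of_forall fun n => hm_le n K)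
  have s1 : Summable fun k => ‖d k‖ ^ 2 := summable_of_sum_range_le (fun _ => by positivity) hmd
  have s2 : Summable fun k : ℕ => (k : ℝ) * ‖d k‖ ^ 2 :=
    summable_of_sum_range_le (fun _ => by positivity) hangd
  have hT : Tame d := by
    refine (s2.add s1).congr fun n => ?_
    ring
  refine ⟨d, hT, ?_, hd, fun p hp => ?_, fun q hq => ?_⟩
  · refine le_antisymm (s1.tsum_le_of_sum_range_le hmd) ?_
    -- No mass escapes to high levels, by the uniform tail bound.
    have hge : ∀ K : ℕ, 1 - B / (K + 1) ≤ massC d := by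
      intro K
      refine le_trans ?_ (s1.sum_le_tsum (Finset.range (K + 1)) fun _ _ => by positivity)
      refine ge_of_tendsto (hmK (K + 1)) (Filter.Eventually.of_forall fun n => ?_)
      have h := sum_range_ge_of_ang (hc n) (hB n) K
      rwa [h1 n] at h
    have hl : Filter.Tendsto (fun K : ℕ => 1 - B * (1 / ((K : ℝ) + 1))) Filter.atTop
        (nhds (1 - B * 0)) :=
      (tendsto_one_div_add_atTop_nhds_zero_nat.const_mul B).const_sub 1
    rw [mul_zero, sub_zero] at hl
    refine le_of_tendsto hl (Filter.Eventually.of_forall fun K => ?_)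
    rw [mul_one_div]
    exact hge K
  · refine s2.tsum_le_of_sum_range_le fun K => ?_
    exact le_of_tendsto_of_tendsto (hangK K) hp (Filter.Eventually.of_forall fun n => hang_le n K)
  · refine (summable_norm_quad_sq s1).tsum_le_of_sum_range_le fun K => ?_
    have hqK : Filter.Tendsto (fun n => ∑ k ∈ Finset.range K, ‖quad (c n) k‖ ^ 2) F
        (nhds (∑ k ∈ Finset.range K, ‖quad d k‖ ^ 2)) := by
      refine tendsto_finsetSum _ fun k _ => Filter.Tendsto.pow (Filter.Tendsto.norm ?_) 2
      unfold quad bil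
      exact tendsto_finsetSum _ fun p _ => ((hd p.1).mul (hd p.2)).const_mul _
    exact le_of_tendsto_of_tendsto hqK hq (Filter.Eventually.of_forall fun n =>
      (summable_norm_quad_sq (summable_norm_sq_of_tame (hc n))).sum_le_tsum _
        fun _ _ => by positivity)

/-- Away from the vortex state the basic inequality is uniformly strict. -/
theorem exists_gap {η : ℝ} (hη : 0 < η) : ∃ δ > 0, ∀ c : ℕ → ℂ, Tame c → massC c = 1 →
    1 ≤ angC c → angC c ≤ 3 → ‖c 1‖ ^ 2 ≤ 1 - η → δ ≤ quartC c + angC c / 2 - 1 := by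
  by_contra! hcon
  choose c hT hM hP1 hP3 hη1 hE using fun n : ℕ => hcon (1 / ((n : ℝ) + 1)) (by positivity)
  set F : Ultrafilter ℕ := Filter.hyperfilter ℕ
  obtain ⟨d, hdT, hdM, hd, hdP, hdQ⟩ := exists_limit_state F hT hM hP3
  obtain ⟨p, hp, hpt⟩ := exists_tendsto_ultrafilter (isCompact_Icc (a := (1 : ℝ)) (b := 3)) F
    (f := fun n => angC (c n)) fun n => ⟨hP1 n, hP3 n⟩
  obtain ⟨q, hq, hqt⟩ := exists_tendsto_ultrafilter (isCompact_Icc (a := (0 : ℝ)) (b := 2)) F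
    (f := fun n => quartC (c n)) fun n => ⟨quartC_nonneg _, by
      have h1 := hE n
      have h2 : 1 / ((n : ℝ) + 1) ≤ 1 := by
        rw [div_le_one (by positivity)]
        have : (0 : ℝ) ≤ n := n.cast_nonneg
        linarith
      have h3 := hP1 n
      linarith⟩
  have h0 : Filter.Tendsto (fun n : ℕ => 1 / ((n : ℝ) + 1)) F (nhds 0) :=
    tendsto_one_div_add_atTop_nhds_zero_nat.mono_left (by
      rw [← Nat.cofinite_eq_atTop]
      exact Filter.hyperfilter_le_cofinite)
  have hpq : q + p / 2 - 1 ≤ 0 := le_of_tendsto_of_tendsto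
    ((hqt.add (hpt.div_const 2)).sub_const 1) h0 (Filter.Eventually.of_forall fun n => (hE n).le)
  have hle := two_le_quartC hdT hdM
  have h1 := hdP p hpt
  have h2 := hdQ q hqt
  -- Angular momentum is only lower semicontinuous, but the basic inequality for d together with q ≤
  -- 1 - p/2 yields `angC d ≥ p ≥ 1`, so the equality case does apply to the limit.
  have h3 := (equality_case hdT hdM (by linarith) (by linarith [hp.1])).1
  have h4 : ‖d 1‖ ^ 2 ≤ 1 - η := le_of_tendsto ((hd 1).norm.pow 2) (Filter.Eventually.of_forall hη1)
  rw [h3] at h4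
  linarith

/-- The vortex state has minimal energy among states with finite angular momentum. -/
def VortexMin (μ : ℝ) : Prop :=
  ∀ c : ℕ → ℂ, Tame c → massC c = 1 → 1 / 2 + μ ≤ quartC c + μ * angC c

/-- The claim is ε(P - 1) ≤ Q + P/2 - 1. For P ≤ 1 it is the basic inequality; near φ₁ it is the
local inequality; for 1 ≤ P ≤ 3 away from φ₁ the gap δ ≥ 2ε suffices; for P ≥ 3 the term P/2 alone
is enough. -/
theorem exists_vortexMin : ∃ ε > 0, ε < 1 / 2 ∧ VortexMin (1 / 2 - ε) := by
  obtain ⟨δ, hδ, hgap⟩ := exists_gap (η := (1 / 400) ^ 2) (by norm_num)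
  refine ⟨min (1 / 40) (δ / 2), by positivity, (min_le_left _ _).trans_lt (by norm_num), ?_⟩
  intro c hc h1
  set ε := min (1 / 40) (δ / 2) with hε
  have hε0 : 0 < ε := by positivity
  have hεa : ε ≤ 1 / 40 := min_le_left _ _
  have hεb : ε ≤ δ / 2 := min_le_right _ _
  have hA := two_le_quartC hc h1
  have hQ := quartC_nonneg c
  suffices h : ε * (angC c - 1) ≤ quartC c + angC c / 2 - 1 by linarith
  rcases le_total (angC c) 1 with hP | hP
  · nlinarith
  rcases le_total (1 - ‖c 1‖ ^ 2) ((1 / 400) ^ 2) with hx | hx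
  · have := local_inequality hc h1 hP hx
    nlinarith
  rcases le_total (angC c) 3 with hP3 | hP3
  · have := hgap c hc h1 hP hP3 (by linarith)
    nlinarith
  · nlinarith

/-! ### First and second variation of the energy -/

/-- The real inner product of two sequences. -/
def ipC (x y : ℕ → ℂ) : ℝ := ∑' k, ((starRingEnd ℂ) (x k) * y k).re

theorem summable_ipC_terms {x y : ℕ → ℂ} (hx : Summable fun k => ‖x k‖ ^ 2)
    (hy : Summable fun k => ‖y k‖ ^ 2) : Summable fun k => (starRingEnd ℂ) (x k) * y k := by
  refine Summable.of_norm_bounded ((hx.add hy).mul_left (1 / 2)) fun k => ?_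
  rw [norm_mul, RCLike.norm_conj]
  nlinarith [sq_nonneg (‖x k‖ - ‖y k‖)]

theorem summable_ipC {x y : ℕ → ℂ} (hx : Summable fun k => ‖x k‖ ^ 2)
    (hy : Summable fun k => ‖y k‖ ^ 2) :
    Summable fun k => ((starRingEnd ℂ) (x k) * y k).re :=
  (Complex.hasSum_re (summable_ipC_terms hx hy).hasSum).summable

theorem norm_sq_add_mul (x y z : ℂ) (t : ℝ) : ‖x + t * y + (t : ℂ) ^ 2 * z‖ ^ 2 =
    ‖x‖ ^ 2 + 2 * t * ((starRingEnd ℂ) x * y).re +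
      t ^ 2 * (‖y‖ ^ 2 + 2 * ((starRingEnd ℂ) x * z).re) +
      2 * t ^ 3 * ((starRingEnd ℂ) y * z).re + t ^ 4 * ‖z‖ ^ 2 := by
  simp only [← Complex.normSq_eq_norm_sq, Complex.normSq_apply, Complex.mul_re, Complex.mul_im,
    Complex.add_re, Complex.add_im, Complex.ofReal_re, Complex.ofReal_im, Complex.conj_re,
    Complex.conj_im, pow_two (t : ℂ)]
  ring

theorem massC_add_mul {x y z : ℕ → ℂ} (hx : Summable fun k => ‖x k‖ ^ 2)
    (hy : Summable fun k => ‖y k‖ ^ 2) (hz : Summable fun k => ‖z k‖ ^ 2) (t : ℝ) :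
    massC (fun k => x k + t * y k + (t : ℂ) ^ 2 * z k) =
      massC x + 2 * t * ipC x y + t ^ 2 * (massC y + 2 * ipC x z) + 2 * t ^ 3 * ipC y z +
        t ^ 4 * massC z := by
  have h := ((((hx.hasSum.add ((summable_ipC hx hy).hasSum.mul_left (2 * t))).add
    ((hy.hasSum.add ((summable_ipC hx hz).hasSum.mul_left 2)).mul_left (t ^ 2))).add
    ((summable_ipC hy hz).hasSum.mul_left (2 * t ^ 3))).add (hz.hasSum.mul_left (t ^ 4)))
  exact (h.congr_fun fun k => norm_sq_add_mul (x k) (y k) (z k) t).tsum_eq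

theorem massC_add_mul' {x y : ℕ → ℂ} (hx : Summable fun k => ‖x k‖ ^ 2)
    (hy : Summable fun k => ‖y k‖ ^ 2) (t : ℝ) :
    massC (fun k => x k + t * y k) = massC x + 2 * t * ipC x y + t ^ 2 * massC y := by
  have h := massC_add_mul hx hy (z := fun _ => 0) (by simp) t
  simpa [massC, ipC] using h

theorem bil_comm (c d : ℕ → ℂ) : bil c d = bil d c := by
  ext k
  unfold bil
  rw [← Finset.Nat.sum_antidiagonal_swap]
  refine Finset.sum_congr rfl fun p hp => ?_
  have hp' := Finset.HasAntidiagonal.mem_antidiagonal.1 hp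
  rw [Prod.fst_swap, Prod.snd_swap, wt_symm hp', mul_comm (c _)]

theorem quad_add_mul (c d : ℕ → ℂ) (t : ℝ) (k : ℕ) : quad (fun n => c n + t * d n) k =
    quad c k + t * (2 * bil c d k) + (t : ℂ) ^ 2 * quad d k := by
  have h : bil d c k = bil c d k := by rw [bil_comm]
  have h2 : quad (fun n => c n + t * d n) k =
      quad c k + t * (bil c d k + bil d c k) + (t : ℂ) ^ 2 * quad d k := by
    unfold quad bil
    rw [← Finset.sum_add_distrib, Finset.mul_sum, Finset.mul_sum, ← Finset.sum_add_distrib,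
      ← Finset.sum_add_distrib]
    refine Finset.sum_congr rfl fun p _ => ?_
    ring
  rw [h2, h, two_mul]

theorem shiftC_add_mul (w : ℂ) (c d : ℕ → ℂ) (t : ℝ) (k : ℕ) :
    shiftC w (fun n => c n + t * d n) k = shiftC w c k + t * shiftC w d k := by
  unfold shiftC
  ring

theorem tame_add_mul {c d : ℕ → ℂ} (hc : Tame c) (hd : Tame d) (t : ℝ) :
    Tame fun n => c n + t * d n := by
  refine Summable.of_nonneg_of_le (fun n => by positivity) (fun n => ?_)
    ((hc.mul_left 2).add (hd.mul_left (2 * t ^ 2)))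
  have h : ‖c n + t * d n‖ ^ 2 ≤ 2 * ‖c n‖ ^ 2 + 2 * t ^ 2 * ‖d n‖ ^ 2 := by
    have h1 := norm_add_le (c n) (t * d n)
    have h2 : ‖(t : ℂ) * d n‖ ^ 2 = t ^ 2 * ‖d n‖ ^ 2 := norm_sq_ofReal_mul t (d n)
    nlinarith [norm_nonneg (c n + t * d n), sq_nonneg (‖c n‖ - ‖(t : ℂ) * d n‖)]
  have hn : (0 : ℝ) ≤ n := n.cast_nonneg
  nlinarith

theorem massC_ofReal_mul (s : ℝ) (x : ℕ → ℂ) : massC (fun n => s * x n) = s ^ 2 * massC x := by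
  rw [massC, massC, ← tsum_mul_left]
  exact tsum_congr fun n => norm_sq_ofReal_mul _ _

theorem tame_ofReal_mul {c : ℕ → ℂ} (hc : Tame c) (s : ℝ) : Tame fun n => s * c n := by
  refine (hc.mul_left (s ^ 2)).congr fun n => ?_
  rw [norm_sq_ofReal_mul]
  ring

theorem quartC_ofReal_mul (s : ℝ) (c : ℕ → ℂ) :
    quartC (fun n => s * c n) = s ^ 4 * quartC c := by
  rw [quartC, quartC, ← tsum_mul_left]
  refine tsum_congr fun k => ?_
  have h : quad (fun n => s * c n) k = ((s ^ 2 : ℝ) : ℂ) * quad c k := by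
    unfold quad bil
    rw [Finset.mul_sum]
    refine Finset.sum_congr rfl fun p _ => ?_
    push_cast
    ring
  rw [h, norm_sq_ofReal_mul]
  ring

theorem momC_ofReal_mul (s : ℝ) (w : ℂ) (c : ℕ → ℂ) :
    momC w (fun n => s * c n) = s ^ 2 * momC w c := by
  rw [momC, momC, ← tsum_mul_left]
  refine tsum_congr fun k => ?_
  have h : shiftC w (fun n => s * c n) k = s * shiftC w c k := by
    unfold shiftC
    ring
  rw [h, norm_sq_ofReal_mul]

/-- The sequence `c` minimises the energy, written in the Fock basis centred at `w`. -/
def IsMinC (μ : ℝ) (w : ℂ) (c : ℕ → ℂ) : Prop :=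
  Tame c ∧ massC c = 1 ∧ ∀ d, Tame d → massC d = 1 →
    quartC c + μ * momC w c ≤ quartC d + μ * momC w d

/-- Rescaling to unit mass removes the constraint and leaves an inequality between homogeneous
quartics, so that variations c + t d need no normalisation. -/
theorem IsMinC.homogeneous {μ : ℝ} {w : ℂ} {c d : ℕ → ℂ} (h : IsMinC μ w c)
    (hd : Tame d) : (quartC c + μ * momC w c) * massC d ^ 2 ≤
      quartC d + μ * (momC w d * massC d) := by
  rcases (massC_nonneg d).eq_or_lt with h0 | h0
  · rw [← h0]
    have := quartC_nonneg d
    simpa using this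
  · set s := (√(massC d))⁻¹
    have hs : s ^ 2 * massC d = 1 := by
      rw [inv_pow, Real.sq_sqrt h0.le, inv_mul_cancel₀ h0.ne']
    have h1 := h.2.2 (fun n => s * d n) (tame_ofReal_mul hd s) (by rw [massC_ofReal_mul, hs])
    rw [quartC_ofReal_mul, momC_ofReal_mul] at h1
    calc (quartC c + μ * momC w c) * massC d ^ 2
        ≤ (s ^ 4 * quartC d + μ * (s ^ 2 * momC w d)) * massC d ^ 2 := by gcongr
      _ = (s ^ 2 * massC d) ^ 2 * quartC d +
          μ * ((s ^ 2 * massC d) * (momC w d * massC d)) := by ring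
      _ = _ := by rw [hs]; ring

theorem coeff_of_quartic_nonneg {a b c e : ℝ}
    (h : ∀ t : ℝ, 0 ≤ a * t + b * t ^ 2 + c * t ^ 3 + e * t ^ 4) : a = 0 ∧ 0 ≤ b := by
  have key : ∀ {f : ℝ → ℝ} {l : ℝ}, Continuous f → f 0 = l → (∀ t, 0 < t → 0 ≤ f t) → 0 ≤ l := by
    intro f l hf hl hp
    have h1 : Filter.Tendsto f (nhdsWithin 0 (Set.Ioi 0)) (nhds l) :=
      hl ▸ (hf.tendsto 0).mono_left nhdsWithin_le_nhds
    exact ge_of_tendsto h1 (eventually_mem_nhdsWithin.mono fun t ht => hp t ht)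
  have ha : 0 ≤ a := key (f := fun t => a + b * t + c * t ^ 2 + e * t ^ 3) (by fun_prop) (by simp)
    fun t ht => by
      have := h t
      have h2 : 0 ≤ t * (a + b * t + c * t ^ 2 + e * t ^ 3) := by nlinarith
      exact nonneg_of_mul_nonneg_right h2 ht
  have hna : 0 ≤ -a := key (f := fun t => -a + b * t - c * t ^ 2 + e * t ^ 3) (by fun_prop) (by simp)
    fun t ht => by
      have := h (-t)
      have h2 : 0 ≤ t * (-a + b * t - c * t ^ 2 + e * t ^ 3) := by nlinarith
      exact nonneg_of_mul_nonneg_right h2 ht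
  have ha0 : a = 0 := by linarith
  refine ⟨ha0, key (f := fun t => b + c * t + e * t ^ 2) (by fun_prop) (by simp) fun t ht => ?_⟩
  have := h t
  rw [ha0] at this
  have h2 : 0 ≤ t ^ 2 * (b + c * t + e * t ^ 2) := by nlinarith
  exact nonneg_of_mul_nonneg_right h2 (by positivity)

/-- First and second variation of the energy at a minimiser. -/
theorem IsMinC.variation {μ : ℝ} {w : ℂ} {c d : ℕ → ℂ} (h : IsMinC μ w c)
    (hd : Tame d) :
    (2 * ipC (quad c) (fun k => 2 * bil c d k) +
      μ * (2 * ipC (shiftC w c) (shiftC w d) + momC w c * (2 * ipC c d)) -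
      (quartC c + μ * momC w c) * (4 * ipC c d) = 0) ∧
    0 ≤ massC (fun k => 2 * bil c d k) + 2 * ipC (quad c) (quad d) +
      μ * (momC w d + 2 * ipC (shiftC w c) (shiftC w d) * (2 * ipC c d) + momC w c * massC d) -
      (quartC c + μ * momC w c) * (2 * massC d + (2 * ipC c d) ^ 2) := by
  have sc := summable_norm_sq_of_tame h.1
  have sd := summable_norm_sq_of_tame hd
  have sbil : Summable fun k => ‖2 * bil c d k‖ ^ 2 := by
    refine ((summable_norm_bil_sq sc sd).mul_left 4).congr fun k => ?_
    rw [norm_mul, mul_pow]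
    norm_num
  have hM := massC_add_mul' sc sd
  -- Quartic energy and second moment are the `massC` of `quad` and `shiftC`, which are polynomial
  -- in t; one expansion of `massC` serves for both.
  have hQ : ∀ t : ℝ, quartC (fun n => c n + t * d n) = _ := fun t =>
    (congrArg massC (funext (quad_add_mul c d t))).trans
      (massC_add_mul (summable_norm_quad_sq sc) sbil (summable_norm_quad_sq sd) t)
  have hB : ∀ t : ℝ, momC w (fun n => c n + t * d n) = _ := fun t =>
    (congrArg massC (funext (shiftC_add_mul w c d t))).trans
      (massC_add_mul' (summable_norm_shiftC_sq h.1 w) (summable_norm_shiftC_sq hd w) t)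
  have e1 : massC (quad c) = quartC c := rfl
  have e2 : massC (quad d) = quartC d := rfl
  have e3 : massC (shiftC w c) = momC w c := rfl
  have e4 : massC (shiftC w d) = momC w d := rfl
  rw [e1, e2] at hQ
  rw [e3, e4] at hB
  refine coeff_of_quartic_nonneg
    (c := 2 * ipC (fun k => 2 * bil c d k) (quad d) +
      μ * (2 * ipC (shiftC w c) (shiftC w d) * massC d + momC w d * (2 * ipC c d)) -
      (quartC c + μ * momC w c) * (2 * (2 * ipC c d) * massC d))
    (e := quartC d + μ * (momC w d * massC d) - (quartC c + μ * momC w c) * massC d ^ 2)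
    fun t => ?_
  have hJ := h.homogeneous (tame_add_mul h.1 hd t)
  rw [hQ, hB, hM, h.2.1] at hJ
  rw [← sub_nonneg] at hJ
  refine hJ.trans_eq ?_
  ring

/-! ### Stability of pure Fock states and the range of minimality of φ₁ -/

theorem tsum_single_comp (n : ℕ) (a : ℂ) {f : ℕ → ℂ → ℝ} (hf : ∀ k, f k 0 = 0) :
    ∑' k, f k ((Pi.single n a : ℕ → ℂ) k) = f n a := by
  rw [tsum_eq_single n fun k hk => by rw [Pi.single_eq_of_ne hk, hf], Pi.single_eq_same]

theorem massC_single (n : ℕ) (a : ℂ) : massC (Pi.single n a) = ‖a‖ ^ 2 :=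
  tsum_single_comp n a (f := fun _ z => ‖z‖ ^ 2) (by simp)

theorem angC_single (n : ℕ) (a : ℂ) : angC (Pi.single n a) = n * ‖a‖ ^ 2 :=
  tsum_single_comp n a (f := fun k z => (k : ℝ) * ‖z‖ ^ 2) (by simp)

theorem tame_single (n : ℕ) (a : ℂ) : Tame (Pi.single n a) := by
  refine tame_of_finite (N := n) fun k hk => ?_
  rw [Pi.single_eq_of_ne (by omega)]

theorem ipC_single_left (n : ℕ) (a : ℂ) (y : ℕ → ℂ) :
    ipC (Pi.single n a) y = ((starRingEnd ℂ) a * y n).re :=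
  tsum_single_comp n a (f := fun k z => ((starRingEnd ℂ) z * y k).re) (by simp)

theorem ipC_single_right (n : ℕ) (a : ℂ) (x : ℕ → ℂ) :
    ipC x (Pi.single n a) = ((starRingEnd ℂ) (x n) * a).re :=
  tsum_single_comp n a (f := fun k z => ((starRingEnd ℂ) (x k) * z).re) (by simp)

theorem bil_single (c : ℕ → ℂ) (l : ℕ) (a : ℂ) (j : ℕ) :
    bil c (Pi.single l a) (j + l) = (wt (j + l) j : ℂ) * (c j * a) := by
  rw [bil, Finset.sum_eq_single (j, l)]
  · simp
  · rintro ⟨i, k⟩ hp hne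
    have hp' := Finset.HasAntidiagonal.mem_antidiagonal.1 hp
    rw [Pi.single_eq_of_ne (by rintro rfl; exact hne (by simp at hp'; simp [hp'])), mul_zero, mul_zero]
  · intro h
    exact absurd (Finset.HasAntidiagonal.mem_antidiagonal.2 (by simp)) h

theorem bil_single_of_lt (c : ℕ → ℂ) {l k : ℕ} (a : ℂ) (h : k < l) :
    bil c (Pi.single l a) k = 0 := by
  refine Finset.sum_eq_zero fun p hp => ?_
  have hp' := Finset.HasAntidiagonal.mem_antidiagonal.1 hp
  rw [Pi.single_eq_of_ne (by omega), mul_zero, mul_zero]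

theorem bil_single_single (n l : ℕ) (a b : ℂ) :
    bil (Pi.single n a) (Pi.single l b) = Pi.single (n + l) ((wt (n + l) n : ℂ) * (a * b)) := by
  ext k
  rcases lt_or_ge k l with h | h
  · rw [bil_single_of_lt _ _ h, Pi.single_eq_of_ne (by omega)]
  · obtain ⟨j, rfl⟩ := Nat.exists_eq_add_of_le' h
    rw [bil_single]
    rcases eq_or_ne j n with rfl | hj
    · rw [Pi.single_eq_same, Pi.single_eq_same]
    · rw [Pi.single_eq_of_ne hj, Pi.single_eq_of_ne (by omega), zero_mul, mul_zero]

theorem quartC_single (n : ℕ) : quartC (Pi.single n 1) = wt (n + n) n ^ 2 := by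
  have h : quad (Pi.single n 1) = Pi.single (n + n) (wt (n + n) n : ℂ) := by
    ext k
    rw [quad, bil_single_single, mul_one, mul_one]
  have h2 : quartC (Pi.single n 1) = massC (quad (Pi.single n 1)) := rfl
  rw [h2, h, massC_single, Complex.norm_real, Real.norm_eq_abs, sq_abs]

theorem momC_single (n : ℕ) : momC 0 (Pi.single n 1) = n + 1 := by
  rw [momC_zero (tame_single n 1), massC_single, angC_single]
  norm_num
  ring

/-- Second variation at a pure Fock state, in a direction orthogonal to it. -/
theorem IsMinC.single_variation {μ : ℝ} {N : ℕ} (h : IsMinC μ 0 (Pi.single N 1)) {d : ℕ → ℂ}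
    (hd : Tame d) (hN : d N = 0) :
    0 ≤ massC (fun k => 2 * bil (Pi.single N 1) d k) + 2 * wt (N + N) N * (quad d (N + N)).re +
      μ * (angC d - N * massC d) - 2 * wt (N + N) N ^ 2 * massC d := by
  have h1 := (h.variation hd).2
  have hq : quad (Pi.single N 1) = Pi.single (N + N) (wt (N + N) N : ℂ) := by
    ext k
    rw [quad, bil_single_single, mul_one, mul_one]
  rw [ipC_single_left, hN, hq, ipC_single_left, quartC_single, momC_single, momC_zero hd,
    Complex.conj_ofReal, Complex.re_ofReal_mul] at h1
  simp only [mul_zero, Complex.zero_re] at h1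
  linarith

/-- Second variation in the direction of mode l; the term `quad d (N + N)` drops out because l + l ≠
N + N. -/
theorem IsMinC.single_coeff {μ : ℝ} {N l : ℕ} (hl : l ≠ N) (h : IsMinC μ 0 (Pi.single N 1)) :
    0 ≤ 4 * ((N + l).choose N / 2 ^ (N + l) : ℝ) + μ * (l - N) -
      2 * ((N + N).choose N / 2 ^ (N + N) : ℝ) := by
  have h1 := h.single_variation (tame_single l 1) (Pi.single_eq_of_ne hl.symm _)
  have h2 : (fun k => 2 * bil (Pi.single N 1) (Pi.single l 1) k) =
      Pi.single (N + l) (2 * (wt (N + l) N : ℂ)) := by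
    ext k
    rw [bil_single_single, mul_one, mul_one]
    rcases eq_or_ne k (N + l) with rfl | hk
    · rw [Pi.single_eq_same, Pi.single_eq_same]
    · rw [Pi.single_eq_of_ne hk, Pi.single_eq_of_ne hk, mul_zero]
  have h3 : quad (Pi.single l 1) (N + N) = 0 := by
    rw [quad, bil_single_single, Pi.single_eq_of_ne (by omega)]
  rw [h2, h3, massC_single, massC_single, angC_single, norm_mul, mul_pow, Complex.norm_real,
    Real.norm_eq_abs, sq_abs, wt_sq, wt_sq] at h1
  norm_num at h1 ⊢
  linarith

theorem two_mul_two_pow_le_centralBinom {N : ℕ} (hN : 3 ≤ N) : 2 * 2 ^ N ≤ (N + N).choose N := by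
  rw [← two_mul, ← Nat.centralBinom_eq_two_mul_choose]
  induction N, hN using Nat.le_induction with
  | base => decide
  | succ n hn ih =>
    have h := Nat.succ_mul_centralBinom_succ n
    have h2 : (n + 1) * (2 * n.centralBinom) ≤ (n + 1) * (n + 1).centralBinom := by
      rw [h]
      nlinarith [Nat.centralBinom_pos n]
    have := Nat.le_of_mul_le_mul_left h2 (Nat.succ_pos n)
    rw [pow_succ]
    omega

/-- Mode 0 is a strictly descending direction: the central binomial bound makes the two interaction
terms total at most 0, and -μN is negative. -/
theorem not_isMinC_single_of_three_le {μ : ℝ} (hμ : 0 < μ) {N : ℕ} (hN : 3 ≤ N) :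
    ¬ IsMinC μ 0 (Pi.single N 1) := by
  intro h
  have h1 := h.single_coeff (l := 0) (by omega)
  have h2 : (2 * 2 ^ N : ℝ) ≤ (N + N).choose N := by
    exact_mod_cast two_mul_two_pow_le_centralBinom hN
  have h3 : 2 / 2 ^ N ≤ ((N + N).choose N / 2 ^ (N + N) : ℝ) := by
    rw [pow_add, div_le_div_iff₀ (by positivity) (by positivity)]
    nlinarith [pow_pos (two_pos : (0 : ℝ) < 2) N]
  have h4 : 0 < μ * N := by positivity
  rw [add_zero, Nat.choose_self] at h1
  push_cast at h1
  have h5 : (2 : ℝ) / 2 ^ N = 2 * (1 / 2 ^ N) := by ring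
  linarith

/-- No single mode works for every μ, so modes 0 and 4 are combined: their mean angular momentum is
2, which removes μ. Opposite signs make the cross term negative, and 31/16 - √(3/8) - 3/2 < 0. -/
theorem not_isMinC_single_two {μ : ℝ} : ¬ IsMinC μ 0 (Pi.single 2 1) := by
  intro h
  obtain ⟨e0, he0⟩ : ∃ e : ℕ → ℂ, e = Pi.single 0 1 := ⟨_, rfl⟩
  obtain ⟨e4, he4⟩ : ∃ e : ℕ → ℂ, e = Pi.single 4 1 := ⟨_, rfl⟩
  have t0 : Tame e0 := he0 ▸ tame_single 0 1
  have t4 : Tame e4 := he4 ▸ tame_single 4 1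
  have h1 := h.single_variation (tame_add_mul t0 t4 (-1)) (by simp [he0, he4])
  have s0 := summable_norm_sq_of_tame t0
  have s4 := summable_norm_sq_of_tame t4
  have hM : massC (fun n => e0 n + ((-1 : ℝ) : ℂ) * e4 n) = 2 := by
    rw [massC_add_mul' s0 s4, he0, he4, massC_single, massC_single, ipC_single_left]
    norm_num
  have hA : angC (fun n => e0 n + ((-1 : ℝ) : ℂ) * e4 n) = 4 := by
    rw [angC_eq_sum (N := 4) fun n hn => ?_]
    · simp [Finset.sum_range_succ, he0, he4]
    · rw [he0, he4, Pi.single_eq_of_ne (by omega), Pi.single_eq_of_ne (by omega)]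
      simp
  have hb : massC (fun k => 2 * bil (Pi.single 2 1) (fun n => e0 n + ((-1 : ℝ) : ℂ) * e4 n) k) =
      31 / 16 := by
    have e : (fun k => 2 * bil (Pi.single 2 1) (fun n => e0 n + ((-1 : ℝ) : ℂ) * e4 n) k) =
        fun k => (Pi.single 2 (2 * (wt 2 2 : ℂ)) : ℕ → ℂ) k +
          ((-1 : ℝ) : ℂ) * (Pi.single 6 (2 * (wt 6 2 : ℂ)) : ℕ → ℂ) k := by
      ext k
      have e' : bil (Pi.single 2 1) (fun n => e0 n + ((-1 : ℝ) : ℂ) * e4 n) k =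
          bil (Pi.single 2 1) e0 k + ((-1 : ℝ) : ℂ) * bil (Pi.single 2 1) e4 k := by
        unfold bil
        rw [Finset.mul_sum, ← Finset.sum_add_distrib]
        exact Finset.sum_congr rfl fun p _ => by ring
      rw [e', he0, he4, bil_single_single, bil_single_single]
      simp only [Pi.single_apply]
      split_ifs <;> first | omega | simp
    rw [e, massC_add_mul' (summable_norm_sq_of_tame (tame_single _ _))
      (summable_norm_sq_of_tame (tame_single _ _)), massC_single, massC_single, ipC_single_left,
      norm_mul, norm_mul, mul_pow, mul_pow, Complex.norm_real, Complex.norm_real, Real.norm_eq_abs,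
      Real.norm_eq_abs, sq_abs, sq_abs, wt_sq, wt_sq]
    have : Nat.choose 6 2 = 15 := rfl
    norm_num [this]
  have h40 : wt 4 0 = 1 / 4 := by
    rw [wt, Real.sqrt_eq_iff_mul_self_eq] <;> norm_num
  have hq : quad (fun n => e0 n + ((-1 : ℝ) : ℂ) * e4 n) (2 + 2) = ((-(1 / 2) : ℝ) : ℂ) := by
    have q0 : quad e0 (2 + 2) = 0 := by
      rw [quad, he0, bil_single_single, Pi.single_eq_of_ne (by norm_num)]
    have q4 : quad e4 (2 + 2) = 0 := by
      rw [quad, he4, bil_single_single, Pi.single_eq_of_ne (by norm_num)]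
    have q04 : bil e0 e4 (2 + 2) = (wt 4 0 : ℂ) := by
      rw [he0, he4, bil_single_single, Pi.single_eq_same, mul_one, mul_one]
    rw [quad_add_mul, q0, q4, q04, h40]
    norm_num
  rw [hM, hA, hb, hq, Complex.ofReal_re, wt_sq] at h1
  have h42 : wt 4 2 ^ 2 = 3 / 8 := by
    have : Nat.choose 4 2 = 6 := rfl
    rw [wt_sq, this]
    norm_num
  have := wt_nonneg 4 2
  have hc : ((2 + 2).choose 2 : ℝ) = 6 := by norm_num [Nat.choose]
  norm_num [Nat.choose] at h1
  nlinarith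

theorem not_isMinC_single {μ : ℝ} (hμ : 0 < μ) {N : ℕ} (hN : 2 ≤ N) :
    ¬ IsMinC μ 0 (Pi.single N 1) := by
  rcases hN.eq_or_lt with rfl | hN
  · exact not_isMinC_single_two
  · exact not_isMinC_single_of_three_le hμ hN

theorem VortexMin.isMinC {μ : ℝ} (h : VortexMin μ) : IsMinC μ 0 (Pi.single 1 1) := by
  refine ⟨tame_single 1 1, by rw [massC_single]; norm_num, fun d hd h1 => ?_⟩
  rw [momC_single, quartC_single, momC_zero hd, h1, wt_sq]
  have := h d hd h1
  norm_num
  linarith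

/-- Mode 5 gives 24/64 + 4μ - 1 ≥ 0. This is the best bound obtained from a single mode, tied with
mode 6. -/
theorem VortexMin.ge {μ : ℝ} (h : VortexMin μ) : 5 / 32 ≤ μ := by
  have h1 := h.isMinC.single_coeff (l := 5) (by norm_num)
  norm_num at h1
  linarith

/-- For fixed c the inequality is affine in μ; it holds at s and, by `two_le_quartC`, at 1/2. -/
theorem VortexMin.mono {s μ : ℝ} (h : VortexMin s) (h1 : s ≤ μ) (h2 : μ < 1 / 2) :
    VortexMin μ := by
  intro c hc hm
  have ha := h c hc hm
  have hb := two_le_quartC hc hm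
  nlinarith

/-- Uniqueness of the vortex state in the interior of the range where it is minimal. -/
theorem VortexMin.rigidity {s μ : ℝ} (h : VortexMin s) (h1 : s < μ) (h2 : μ < 1 / 2) {c : ℕ → ℂ}
    (hc : Tame c) (hm : massC c = 1) (hE : quartC c + μ * angC c ≤ 1 / 2 + μ) :
    ‖c 1‖ = 1 ∧ ∀ n ≠ 1, c n = 0 := by
  have ha := h c hc hm
  have hb := two_le_quartC hc hm
  -- Comparison with the inequality at s gives P ≤ 1, comparison with the one at 1/2 gives P ≥ 1;
  -- then both are equalities.
  have e1 : angC c ≤ 1 := by nlinarith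
  have e2 : 1 ≤ angC c := by nlinarith
  exact equality_case hc hm (by nlinarith) e2

/-! ### Euler-Lagrange equation and self-improving decay -/

/-- The gradient of the interaction energy in coefficients. -/
def gradC (c : ℕ → ℂ) (l : ℕ) : ℂ :=
  ∑' j, (wt (j + l) j : ℂ) * ((starRingEnd ℂ) (c j) * quad c (j + l))

theorem ipC_quad_bil_single {c : ℕ → ℂ} (hc : Summable fun n => ‖c n‖ ^ 2) (l : ℕ) (ζ : ℂ) :
    ipC (quad c) (fun k => 2 * bil c (Pi.single l ζ) k) =
      (2 * (starRingEnd ℂ) (gradC c l) * ζ).re := by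
  have sd : Summable fun n => ‖(Pi.single l ζ : ℕ → ℂ) n‖ ^ 2 :=
    summable_norm_sq_of_tame (tame_single l ζ)
  have sb : Summable fun k => ‖2 * bil c (Pi.single l ζ) k‖ ^ 2 := by
    refine ((summable_norm_bil_sq hc sd).mul_left 4).congr fun k => ?_
    rw [norm_mul, mul_pow]
    norm_num
  have hs := summable_ipC_terms (summable_norm_quad_sq hc) sb
  have h1 : ∑' k, (starRingEnd ℂ) (quad c k) * (2 * bil c (Pi.single l ζ) k) =
      2 * (starRingEnd ℂ) (gradC c l) * ζ := by
    rw [← hs.sum_add_tsum_nat_add l, Finset.sum_eq_zero, zero_add, gradC, Complex.conj_tsum,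
      ← tsum_mul_left, ← tsum_mul_right]
    · refine tsum_congr fun j => ?_
      rw [bil_single, map_mul, map_mul, Complex.conj_ofReal, Complex.conj_conj]
      ring
    · intro k hk
      rw [bil_single_of_lt _ _ (Finset.mem_range.1 hk), mul_zero, mul_zero]
  rw [← h1, Complex.re_tsum hs, ipC]

theorem ipC_shiftC_single (w : ℂ) (c : ℕ → ℂ) (l : ℕ) (ζ : ℂ) :
    ipC (shiftC w c) (shiftC w (Pi.single l ζ)) =
      (((starRingEnd ℂ) (shiftC w c l) * w +
        (starRingEnd ℂ) (shiftC w c (l + 1)) * (√((l : ℝ) + 1) : ℂ)) * ζ).re := by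
  have h1 : shiftC w (Pi.single l ζ) l = w * ζ := by
    rcases l with _ | l
    · simp [shiftC]
    · simp [shiftC]
  have h2 : shiftC w (Pi.single l ζ) (l + 1) = (√((l : ℝ) + 1) : ℂ) * ζ := by
    simp [shiftC]
  have h3 : ∀ k, k ≠ l → k ≠ l + 1 → shiftC w (Pi.single l ζ) k = 0 := by
    intro k hk hk1
    rcases k with _ | k
    · simp [shiftC, Pi.single_eq_of_ne hk]
    · rw [shiftC, Nat.add_sub_cancel, Pi.single_eq_of_ne (by omega), Pi.single_eq_of_ne hk]
      simp
  rw [ipC, tsum_eq_sum (s := {l, l + 1}), Finset.sum_pair (by omega), h1, h2, ← Complex.add_re]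
  · congr 1
    ring
  · intro k hk
    simp only [Finset.mem_insert, Finset.mem_singleton, not_or] at hk
    rw [h3 k hk.1 hk.2]
    simp

/-- The Euler-Lagrange equation in the Fock basis centred at `w`. -/
theorem IsMinC.euler_lagrange {μ : ℝ} {w : ℂ} {c : ℕ → ℂ} (h : IsMinC μ w c) :
    ∃ τ : ℝ, ∀ l, 2 * gradC c l + μ * (shiftC w c l * (starRingEnd ℂ) w +
      shiftC w c (l + 1) * (√((l : ℝ) + 1) : ℂ)) = τ * c l := by
  refine ⟨2 * (quartC c + μ * momC w c) - μ * momC w c, fun l => ?_⟩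
  have sc := summable_norm_sq_of_tame h.1
  set Z : ℂ := 4 * (starRingEnd ℂ) (gradC c l) + 2 * μ * ((starRingEnd ℂ) (shiftC w c l) * w +
        (starRingEnd ℂ) (shiftC w c (l + 1)) * (√((l : ℝ) + 1) : ℂ)) -
      ((4 * (quartC c + μ * momC w c) - 2 * (μ * momC w c) : ℝ) : ℂ) * (starRingEnd ℂ) (c l) with hZ
  have hre : ∀ ζ, (Z * ζ).re = 0 := by
    intro ζ
    have h1 := (h.variation (tame_single l ζ)).1
    rw [ipC_quad_bil_single sc, ipC_shiftC_single, ipC_single_right] at h1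
    rw [← h1, hZ]
    simp only [Complex.mul_re, Complex.mul_im, Complex.add_re, Complex.add_im, Complex.sub_re,
      Complex.sub_im, Complex.ofReal_re, Complex.ofReal_im, Complex.re_ofNat, Complex.im_ofNat]
    ring
  -- Only real parts are known to vanish, but for every complex ζ; testing with ζ = conj Z gives
  -- |Z|² = 0.
  have hZ0 : Z = 0 := by
    have h2 := hre ((starRingEnd ℂ) Z)
    rw [Complex.mul_conj, Complex.ofReal_re, Complex.normSq_eq_zero] at h2
    exact h2
  have h3 : (starRingEnd ℂ) Z = 0 := by rw [hZ0, map_zero]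
  rw [hZ] at h3
  simp only [map_sub, map_add, map_mul, Complex.conj_conj, Complex.conj_ofReal, map_ofNat] at h3
  push_cast at h3 ⊢
  linear_combination h3 / 2

theorem gradC_eq_sum {c : ℕ → ℂ} {N : ℕ} (h : ∀ n, N < n → c n = 0) (l : ℕ) :
    gradC c l = ∑ j ∈ Finset.range (N + 1),
      (wt (j + l) j : ℂ) * ((starRingEnd ℂ) (c j) * quad c (j + l)) :=
  tsum_eq_sum fun j hj => by
    rw [h j (by simpa using hj), map_zero, zero_mul, mul_zero]

theorem wt_le_one (k i : ℕ) : wt k i ≤ 1 := by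
  refine Real.sqrt_le_one.2 ?_
  rw [div_le_one (by positivity)]
  exact_mod_cast Nat.choose_le_two_pow k i

/-- The relation on a and b says that 1/(2a²) and 1/(2b²) are complementary probabilities, and a
single binomial probability is at most 1. -/
theorem wt_add_le {a b : ℝ} (ha : 0 < a) (hb : 0 < b) (hab : a ^ 2 + b ^ 2 = 2 * a ^ 2 * b ^ 2)
    (j l : ℕ) : wt (j + l) j ≤ a ^ j * b ^ l := by
  refine abs_le_of_sq_le_sq' ?_ (by positivity) |>.2
  rw [wt_sq, div_le_iff₀ (by positivity)]
  have hx : 1 / (2 * a ^ 2) + 1 / (2 * b ^ 2) = 1 := by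
    field_simp
    linarith
  have h := add_pow (1 / (2 * a ^ 2)) (1 / (2 * b ^ 2)) (j + l)
  rw [hx, one_pow] at h
  have h1 : (1 / (2 * a ^ 2)) ^ j * (1 / (2 * b ^ 2)) ^ (j + l - j) * ((j + l).choose j : ℝ) ≤ 1 := by
    refine le_trans ?_ h.ge
    exact Finset.single_le_sum
      (f := fun m => (1 / (2 * a ^ 2)) ^ m * (1 / (2 * b ^ 2)) ^ (j + l - m) * ((j + l).choose m : ℝ))
      (fun i _ => by positivity) (Finset.mem_range.2 (show j < j + l + 1 by omega))
  rw [Nat.add_sub_cancel_left] at h1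
  calc ((j + l).choose j : ℝ) = ((1 / (2 * a ^ 2)) ^ j * (1 / (2 * b ^ 2)) ^ l *
        ((j + l).choose j : ℝ)) * ((a ^ j * b ^ l) ^ 2 * 2 ^ (j + l)) := by
        rw [one_div_pow, one_div_pow, mul_pow, mul_pow, mul_pow, pow_add, ← pow_mul, ← pow_mul,
          ← pow_mul, ← pow_mul, mul_comm j 2, mul_comm l 2]
        field_simp
    _ ≤ 1 * ((a ^ j * b ^ l) ^ 2 * 2 ^ (j + l)) := by gcongr
    _ = _ := one_mul _

theorem norm_quad_le {c : ℕ → ℂ} {C ρ : ℝ} (hC : 0 ≤ C) (hρ : 0 < ρ) (h : ∀ n, ‖c n‖ ≤ C * ρ ^ n)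
    (k : ℕ) : ‖quad c k‖ ≤ (k + 1) * (C ^ 2 * ρ ^ k) := by
  rw [quad, bil]
  refine (norm_sum_le _ _).trans ?_
  have : ∀ p ∈ Finset.HasAntidiagonal.antidiagonal k,
      ‖(wt k p.1 : ℂ) * (c p.1 * c p.2)‖ ≤ C ^ 2 * ρ ^ k := by
    intro p hp
    have hp' := Finset.HasAntidiagonal.mem_antidiagonal.1 hp
    rw [norm_wt_mul, norm_mul]
    calc wt k p.1 * (‖c p.1‖ * ‖c p.2‖) ≤ 1 * ((C * ρ ^ p.1) * (C * ρ ^ p.2)) := by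
          gcongr
          · exact wt_le_one _ _
          · exact h _
          · exact h _
      _ = C ^ 2 * ρ ^ k := by rw [← hp', pow_add]; ring
  refine (Finset.sum_le_card_nsmul _ _ _ this).trans_eq ?_
  rw [Finset.Nat.card_antidiagonal, nsmul_eq_mul]
  push_cast
  rfl

/-- The weight contributes a^j b^l. The factor a^j is absorbed by the convergent sum over j, as aρ²
< 1, while b^l is a genuine gain over ρ^l. -/
theorem norm_gradC_le {c : ℕ → ℂ} {C ρ a b : ℝ} (hC : 0 ≤ C) (hρ : 0 < ρ)
    (h : ∀ n, ‖c n‖ ≤ C * ρ ^ n) (ha : 0 < a) (hb : 0 < b)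
    (hab : a ^ 2 + b ^ 2 = 2 * a ^ 2 * b ^ 2) (hr : a * ρ ^ 2 < 1) :
    ∃ K, 0 ≤ K ∧ ∀ l : ℕ, ‖gradC c l‖ ≤ K * ((l + 1) * (b * ρ) ^ l) := by
  have hs : Summable fun j : ℕ => ((j : ℝ) + 1) * (a * ρ ^ 2) ^ j := by
    have h0 : ‖a * ρ ^ 2‖ < 1 := by
      rw [Real.norm_eq_abs, abs_of_pos (by positivity)]
      exact hr
    refine ((summable_pow_mul_geometric_of_norm_lt_one 1 h0).add
      (summable_geometric_of_norm_lt_one h0)).congr fun j => ?_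
    rw [pow_one]
    ring
  refine ⟨C ^ 3 * ∑' j : ℕ, ((j : ℝ) + 1) * (a * ρ ^ 2) ^ j,
    mul_nonneg (by positivity) (tsum_nonneg fun j => by positivity), fun l => ?_⟩
  have h1 := hs.hasSum.mul_left (C ^ 3 * ((l + 1) * (b * ρ) ^ l))
  refine (tsum_of_norm_bounded h1 fun j => ?_).trans_eq (by ring)
  rw [norm_wt_mul, norm_mul, RCLike.norm_conj]
  calc wt (j + l) j * (‖c j‖ * ‖quad c (j + l)‖)
      ≤ (a ^ j * b ^ l) * ((C * ρ ^ j) * (((j + 1) * (l + 1)) * (C ^ 2 * ρ ^ (j + l)))) := by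
        have hq := norm_quad_le hC hρ h (j + l)
        have hjl : (((j + l : ℕ) : ℝ) + 1) ≤ (j + 1) * (l + 1) := by
          push_cast
          nlinarith [(Nat.cast_nonneg j : (0 : ℝ) ≤ j), (Nat.cast_nonneg l : (0 : ℝ) ≤ l),
            mul_nonneg (Nat.cast_nonneg j : (0 : ℝ) ≤ j) (Nat.cast_nonneg l : (0 : ℝ) ≤ l)]
        have hq' : ‖quad c (j + l)‖ ≤ ((j + 1) * (l + 1)) * (C ^ 2 * ρ ^ (j + l)) :=
          hq.trans (by gcongr)
        gcongr
        · exact wt_add_le ha hb hab j l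
        · exact h j
    _ = _ := by
        rw [mul_pow, mul_pow, ← pow_mul, pow_add, two_mul, pow_add]
        ring

/-- The Euler-Lagrange equation improves exponential decay of the coefficients. -/
theorem IsMinC.decay_step {μ : ℝ} (hμ : 0 < μ) {c : ℕ → ℂ} (hm : IsMinC μ 0 c) {C ρ a b : ℝ}
    (hρ : 0 < ρ) (h : ∀ n, ‖c n‖ ≤ C * ρ ^ n) (ha : 0 < a) (hb : 0 < b) (hb1 : b ≤ 1)
    (hab : a ^ 2 + b ^ 2 = 2 * a ^ 2 * b ^ 2) (hr : a * ρ ^ 2 < 1) :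
    ∃ C', ∀ n, ‖c n‖ ≤ C' * (b * ρ) ^ n := by
  have hC : 0 ≤ C := by simpa using (norm_nonneg _).trans (h 0)
  obtain ⟨K, hK, hg⟩ := norm_gradC_le hC hρ h ha hb hab hr
  obtain ⟨τ, hτ⟩ := hm.euler_lagrange
  -- Beyond L the factor μ(n+1) - τ is at least μ(n+1)/2, and this n + 1 cancels the polynomial loss
  -- in the gradient bound. The finitely many lower indices are covered by enlarging the constant by
  -- b⁻¹ ^ L.
  obtain ⟨L, hL⟩ := exists_nat_ge (2 * |τ| / μ)
  refine ⟨4 * K / μ + C * b⁻¹ ^ L, fun n => ?_⟩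
  rcases le_total L n with hn | hn
  · have h1 : ((μ * (n + 1) - τ : ℝ) : ℂ) * c n = -(2 * gradC c n) := by
      have h2 := hτ n
      have h3 : shiftC 0 c (n + 1) * (√((n : ℝ) + 1) : ℂ) = ((n : ℂ) + 1) * c n := by
        have h4 : (√((n : ℝ) + 1) : ℂ) * (√((n : ℝ) + 1) : ℂ) = (n : ℂ) + 1 := by
          rw [← Complex.ofReal_mul, Real.mul_self_sqrt (by positivity)]
          push_cast
          rfl
        simp only [shiftC, zero_mul, add_zero, Nat.add_sub_cancel]
        push_cast
        rw [← h4]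
        ring
      rw [map_zero, mul_zero, zero_add, h3] at h2
      push_cast
      linear_combination h2
    have h5 : μ * (n + 1) / 2 ≤ |μ * (n + 1) - τ| := by
      have h6 : 2 * |τ| ≤ μ * n := by
        rw [div_le_iff₀ hμ] at hL
        have : (L : ℝ) ≤ n := by exact_mod_cast hn
        nlinarith
      have := le_abs_self (μ * (n + 1) - τ)
      have := le_abs_self τ
      linarith
    have h7 := congrArg norm h1
    rw [norm_neg, norm_mul, norm_mul, Complex.norm_real, Real.norm_eq_abs, Complex.norm_ofNat] at h7
    have h8 : μ * (n + 1) / 2 * ‖c n‖ ≤ 2 * (K * ((n + 1) * (b * ρ) ^ n)) := by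
      calc μ * (n + 1) / 2 * ‖c n‖ ≤ |μ * (n + 1) - τ| * ‖c n‖ := by gcongr
        _ = 2 * ‖gradC c n‖ := h7
        _ ≤ _ := by gcongr; exact hg n
    have h9 : ‖c n‖ ≤ 4 * K / μ * (b * ρ) ^ n := by
      rw [div_mul_eq_mul_div, le_div_iff₀ hμ]
      have hn0 : (0 : ℝ) < n + 1 := by positivity
      refine le_of_mul_le_mul_left ?_ hn0
      linarith
    refine h9.trans ?_
    gcongr
    exact le_add_of_nonneg_right (by positivity)
  · have h1 : ‖c n‖ ≤ (C * b⁻¹ ^ L) * (b * ρ) ^ n := by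
      have hbn : 1 ≤ b⁻¹ ^ L * b ^ n := by
        have : b ^ L ≤ b ^ n := pow_le_pow_of_le_one hb.le hb1 hn
        rw [inv_pow, inv_mul_eq_div, one_le_div (by positivity)]
        exact this
      calc ‖c n‖ ≤ C * ρ ^ n := h n
        _ ≤ C * ρ ^ n * (b⁻¹ ^ L * b ^ n) := le_mul_of_one_le_right (by positivity) hbn
        _ = _ := by rw [mul_pow]; ring
    refine h1.trans ?_
    gcongr
    exact le_add_of_nonneg_left (by positivity)

/-- With a² = 1/x and b² = 1/(2 - x) the relation holds identically; b < 1 means x < 1 and aρ² < 1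
means ρ⁴ < x, so the midpoint of ρ⁴ and 1 serves. -/
theorem exists_decay_params {ρ : ℝ} (hρ : 0 < ρ) (hρ1 : ρ < 1) : ∃ a b : ℝ, 0 < a ∧ 0 < b ∧ b < 1 ∧
    a ^ 2 + b ^ 2 = 2 * a ^ 2 * b ^ 2 ∧ a * ρ ^ 2 < 1 := by
  have h4 : ρ ^ 4 < 1 := pow_lt_one₀ hρ.le hρ1 (by norm_num)
  have h40 : 0 < ρ ^ 4 := by positivity
  set x := (ρ ^ 4 + 1) / 2 with hx
  have hx0 : 0 < x := by positivity
  have hx1 : x < 1 := by linarith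
  have hy : 0 < 2 - x := by linarith
  refine ⟨(√x)⁻¹, (√(2 - x))⁻¹, by positivity, by positivity, ?_, ?_, ?_⟩
  · refine inv_lt_one_of_one_lt₀ ?_
    rw [Real.lt_sqrt (by norm_num)]
    linarith
  · rw [inv_pow, inv_pow, Real.sq_sqrt hx0.le, Real.sq_sqrt hy.le]
    field_simp
    ring
  · rw [inv_mul_lt_one₀ (by positivity), Real.lt_sqrt (by positivity), ← pow_mul]
    norm_num
    linarith

/-- Exponential decay of the coefficients of a minimiser self-improves to superexponential decay. -/
theorem IsMinC.superexponential_decay {μ : ℝ} (hμ : 0 < μ) {c : ℕ → ℂ} (hm : IsMinC μ 0 c)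
    {C ρ : ℝ} (hρ : 0 < ρ) (hρ1 : ρ < 1) (h : ∀ n, ‖c n‖ ≤ C * ρ ^ n) {r : ℝ} (hr : 0 < r) :
    ∃ C', ∀ n, ‖c n‖ ≤ C' * r ^ n := by
  obtain ⟨a, b, ha, hb, hb1, hab, har⟩ := exists_decay_params hρ hρ1
  -- The same a and b serve in every step, since aρ² < 1 persists as the rate shrinks.
  have key : ∀ k : ℕ, ∃ C', ∀ n, ‖c n‖ ≤ C' * (b ^ k * ρ) ^ n := by
    intro k
    induction k with
    | zero => exact ⟨C, by simpa using h⟩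
    | succ k ih =>
      obtain ⟨C₁, h₁⟩ := ih
      have hbk : b ^ k ≤ 1 := pow_le_one₀ hb.le hb1.le
      have h2 : a * (b ^ k * ρ) ^ 2 < 1 := by
        refine lt_of_le_of_lt ?_ har
        gcongr
        exact mul_le_of_le_one_left hρ.le hbk
      obtain ⟨C₂, h₃⟩ := hm.decay_step hμ (by positivity) h₁ ha hb hb1.le hab h2
      refine ⟨C₂, fun n => ?_⟩
      rw [pow_succ', mul_assoc]
      exact h₃ n
  obtain ⟨k, hk⟩ := exists_pow_lt_of_lt_one hr hb1
  obtain ⟨C', h'⟩ := key k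
  have hC : 0 ≤ C' := by simpa using (norm_nonneg _).trans (h' 0)
  refine ⟨C', fun n => (h' n).trans ?_⟩
  gcongr
  nlinarith

theorem tame_of_norm_le {c : ℕ → ℂ} {C r : ℝ} (hr : 0 ≤ r) (hr1 : r < 1)
    (h : ∀ n, ‖c n‖ ≤ C * r ^ n) : Tame c := by
  have h0 : ‖r ^ 2‖ < 1 := by
    rw [Real.norm_eq_abs, abs_of_nonneg (by positivity)]
    exact pow_lt_one₀ hr hr1 two_ne_zero
  have hs := ((summable_pow_mul_geometric_of_norm_lt_one 1 h0).add
      (summable_geometric_of_norm_lt_one h0)).mul_left (C ^ 2)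
  refine Summable.of_nonneg_of_le (fun n => by positivity) (fun n => ?_) hs
  calc ((n : ℝ) + 1) * ‖c n‖ ^ 2 ≤ ((n : ℝ) + 1) * (C * r ^ n) ^ 2 := by gcongr; exact h n
    _ = _ := by ring

/-- Superexponential decay keeps every dilate of f a tame Fock function. Dilating by R with R²‖α‖ =
1 gives quadratic exponent of modulus 1, against the limit 1/2. -/
theorem quadratic_exponent_eq_zero {c : ℕ → ℂ} {p : Polynomial ℂ} {α β : ℂ} (hp : p ≠ 0)
    (hf : ∀ z, fockFun c z = p.eval z * Complex.exp (α * z ^ 2 + β * z))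
    (h : ∀ r > 0, ∃ C, ∀ n, ‖c n‖ ≤ C * r ^ n) : α = 0 := by
  by_contra hα
  have hα' : 0 < ‖α‖ := norm_pos_iff.2 hα
  set R : ℝ := √(‖α‖)⁻¹ with hR
  have hR0 : 0 < R := by positivity
  have hR2 : R ^ 2 * ‖α‖ = 1 := by
    rw [hR, Real.sq_sqrt (by positivity), inv_mul_cancel₀ hα'.ne']
  obtain ⟨C, hC⟩ := h ((2 * R)⁻¹) (by positivity)
  set d : ℕ → ℂ := fun n => c n * (R : ℂ) ^ n with hd
  have hdT : Tame d := by
    refine tame_of_norm_le (C := C) (r := 1 / 2) (by norm_num) (by norm_num) fun n => ?_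
    rw [hd, norm_mul, norm_pow, Complex.norm_real, Real.norm_eq_abs, abs_of_pos hR0]
    calc ‖c n‖ * R ^ n ≤ C * (2 * R)⁻¹ ^ n * R ^ n := by gcongr; exact hC n
      _ = C * (1 / 2) ^ n := by
        rw [mul_assoc, ← mul_pow]
        congr 2
        field_simp
  have hq : p.comp (Polynomial.C (R : ℂ) * Polynomial.X) ≠ 0 := by
    refine fun h0 => hp (Polynomial.funext fun z => ?_)
    have h1 := congrArg (Polynomial.eval ((R : ℂ)⁻¹ * z)) h0
    have hRc : (R : ℂ) ≠ 0 := by exact_mod_cast hR0.ne'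
    simpa [mul_inv_cancel_left₀ hRc] using h1
  have h1 := norm_lt_of_growth (p := p.comp (Polynomial.C (R : ℂ) * Polynomial.X))
    (α := α * (R : ℂ) ^ 2) (β := β * R) (a := 1 / 2) (C := √(momC 0 d / Real.pi)) hq fun z => by
      have h2 := norm_mul_fockFun_le hdT z
      rw [fockFun_scale, hf] at h2
      have h3 : (p.comp (Polynomial.C (R : ℂ) * Polynomial.X)).eval z = p.eval (R * z) := by
        simp
      rw [h3]
      convert h2 using 3
      · ring_nf
      · ring
  rw [norm_mul, norm_pow, Complex.norm_real, Real.norm_eq_abs, abs_of_pos hR0] at h1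
  linarith

/-! ### Rigidity of finitely supported minimisers -/

theorem wt_pos {k i : ℕ} (h : i ≤ k) : 0 < wt k i := by
  have := Nat.choose_pos h
  exact Real.sqrt_pos.2 (by positivity)

theorem quad_add_self {v : ℕ → ℂ} {m : ℕ} (h : ∀ i j, i + j = m + m → i ≠ m → v i = 0 ∨ v j = 0) :
    quad v (m + m) = (wt (m + m) m : ℂ) * v m ^ 2 := by
  rw [quad, bil, Finset.sum_eq_single (m, m), sq]
  · rintro ⟨i, j⟩ hp hne
    have hp' : i + j = m + m := Finset.HasAntidiagonal.mem_antidiagonal.1 hp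
    have hi : i ≠ m := by
      rintro rfl
      exact hne (by rw [Nat.add_left_cancel hp'])
    rcases h i j hp' hi with h0 | h0
    · simp [h0]
    · simp [h0]
  · intro hn
    exact absurd (Finset.HasAntidiagonal.mem_antidiagonal.2 (by simp)) hn

theorem quad_eq_zero_of_lt {v : ℕ → ℂ} {m k : ℕ} (h : ∀ n < m, v n = 0) (hk : k < m + m) :
    quad v k = 0 := by
  rw [quad, bil]
  refine Finset.sum_eq_zero fun p hp => ?_
  have hp' := Finset.HasAntidiagonal.mem_antidiagonal.1 hp
  rcases lt_or_ge p.1 m with h1 | h1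
  · rw [h _ h1, zero_mul, mul_zero]
  · rw [h p.2 (by omega), mul_zero, mul_zero]

/-- The coefficients of a finitely supported minimiser vanish up to the last two. -/
theorem IsMinC.coeff_eq_zero {μ : ℝ} {w : ℂ} {v : ℕ → ℂ} (hm : IsMinC μ w v) {N : ℕ}
    (hv : ∀ n, N < n → v n = 0) (hN : v N ≠ 0) (i : ℕ) (hi : i + 2 ≤ N) : v i = 0 := by
  obtain ⟨τ, hτ⟩ := hm.euler_lagrange
  induction i using Nat.strong_induction_on with
  | _ i ih =>
    -- At l = 2N - i ≥ N + 2 all linear terms vanish, and in the gradient only j = i survives: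
    -- smaller j are zero by induction, larger j would require `quad` beyond 2N.
    obtain ⟨l, hl⟩ : ∃ l, i + l = N + N := ⟨N + N - i, by omega⟩
    have h1 := hτ l
    have s1 : shiftC w v l = 0 := by
      rw [shiftC, hv (l - 1) (by omega), hv l (by omega), mul_zero, mul_zero, add_zero]
    have s2 : shiftC w v (l + 1) = 0 := by
      rw [shiftC, hv (l + 1 - 1) (by omega), hv (l + 1) (by omega), mul_zero, mul_zero, add_zero]
    have hg : gradC v l = (wt (N + N) i : ℂ) *
        ((starRingEnd ℂ) (v i) * ((wt (N + N) N : ℂ) * v N ^ 2)) := by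
      rw [gradC_eq_sum hv, Finset.sum_eq_single i, hl, quad_add_self]
      · intro a b hab hne
        rcases lt_or_ge N a with h | h
        · exact Or.inl (hv a h)
        · exact Or.inr (hv b (by omega))
      · intro j _ hji
        rcases lt_or_gt_of_ne hji with h | h
        · rw [ih j h (by omega), map_zero, zero_mul, mul_zero]
        · rw [quad_eq_zero hv (by omega), mul_zero, mul_zero]
      · intro h
        exact absurd (Finset.mem_range.2 (by omega)) h
    rw [s1, s2, hv l (by omega), hg] at h1
    have w1 : (wt (N + N) i : ℂ) ≠ 0 := by exact_mod_cast (wt_pos (by omega)).ne'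
    have w2 : (wt (N + N) N : ℂ) ≠ 0 := by exact_mod_cast (wt_pos (by omega)).ne'
    simpa [w1, w2, hN] using h1

theorem wt_sq_ratio (k i : ℕ) : wt k (i + 1) ^ 2 * (i + 1) = wt k i ^ 2 * ((k - i : ℕ) : ℝ) := by
  rw [wt_sq, wt_sq]
  have h : ((k.choose (i + 1) : ℕ) : ℝ) * (i + 1) = k.choose i * ((k - i : ℕ) : ℝ) := by
    exact_mod_cast Nat.choose_succ_right_eq k i
  rw [div_mul_eq_mul_div, h]
  ring

theorem wt_central_ratio (p : ℕ) :
    2 * (p + 1) * wt (p + 1 + (p + 1)) (p + 1) ^ 2 = (2 * p + 1) * wt (p + p) p ^ 2 := by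
  rw [wt_sq, wt_sq, ← two_mul, ← two_mul, ← Nat.centralBinom_eq_two_mul_choose,
    ← Nat.centralBinom_eq_two_mul_choose]
  have h : ((p : ℝ) + 1) * (p + 1).centralBinom = 2 * (2 * p + 1) * p.centralBinom := by
    exact_mod_cast Nat.succ_mul_centralBinom_succ p
  have h2 : (2 : ℝ) ^ (2 * (p + 1)) = 4 * 2 ^ (2 * p) := by
    rw [mul_add, pow_add]
    norm_num
    ring
  rw [h2]
  field_simp
  linear_combination 2 * h

/-- This makes the two equations for w in `IsMinC.eq_single` incompatible. Ratios of binomial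
coefficients reduce it to (2p+3)² / (4(p+2)(p+3)) < (p+3)/(p+2). -/
theorem wt_product_lt (p : ℕ) :
    (wt (p + 2 + (p + 2)) (p + 1) * wt (p + 2 + (p + 2)) (p + 2)) ^ 2 * (p + 1) <
      (wt (p + 1 + (p + 1)) (p + 2) * wt (p + 1 + (p + 1)) (p + 1)) ^ 2 * (p + 3) := by
  have h1 := wt_sq_ratio (p + 2 + (p + 2)) (p + 1)
  have h2 := wt_sq_ratio (p + 1 + (p + 1)) (p + 1)
  have h3 := wt_central_ratio (p + 1)
  rw [show p + 2 + (p + 2) - (p + 1) = p + 3 by omega] at h1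
  rw [show p + 1 + (p + 1) - (p + 1) = p + 1 by omega] at h2
  have hb : 0 < wt (p + 1 + (p + 1)) (p + 1) ^ 2 := pow_pos (wt_pos (by omega)) 2
  push_cast at h1 h2 h3
  rw [show p + 1 + 1 + (p + 1 + 1) = p + 2 + (p + 2) by ring, show p + 1 + 1 = p + 2 by ring] at h3
  rw [show p + 1 + 1 = p + 2 by ring] at h1 h2
  rw [mul_pow, mul_pow]
  set a1 := wt (p + 2 + (p + 2)) (p + 1) ^ 2
  set a2 := wt (p + 2 + (p + 2)) (p + 2) ^ 2
  set b1 := wt (p + 1 + (p + 1)) (p + 2) ^ 2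
  set b2 := wt (p + 1 + (p + 1)) (p + 1) ^ 2
  have hp : (0 : ℝ) ≤ p := p.cast_nonneg
  have e1 : a1 = a2 * (p + 2) / (p + 3) := by
    field_simp
    linarith
  have e2 : b1 = b2 * (p + 1) / (p + 2) := by
    field_simp
    linarith
  have e3 : a2 = (2 * p + 3) * b2 / (2 * (p + 2)) := by
    field_simp
    linarith
  rw [e1, e2, e3]
  have e4 : (2 * (p : ℝ) + 3) * b2 / (2 * (p + 2)) * (p + 2) / (p + 3) *
      ((2 * p + 3) * b2 / (2 * (p + 2))) * (p + 1) =
      b2 ^ 2 * (p + 1) * ((2 * p + 3) ^ 2 / (4 * (p + 2) * (p + 3))) := by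
    field_simp
    ring
  have e5 : b2 * ((p : ℝ) + 1) / (p + 2) * b2 * (p + 3) =
      b2 ^ 2 * (p + 1) * ((p + 3) / (p + 2)) := by
    field_simp
  rw [e4, e5]
  refine mul_lt_mul_of_pos_left ?_ (by positivity)
  rw [div_lt_div_iff₀ (by positivity) (by positivity)]
  have : 0 < ((p : ℝ) + 2) := by positivity
  nlinarith [mul_pos this this]

/-- A finitely supported minimiser of degree at least two is a pure Fock state at the origin. -/
theorem IsMinC.eq_single {μ : ℝ} (hμ : 0 < μ) {w : ℂ} {v : ℕ → ℂ} (hm : IsMinC μ w v) {p : ℕ}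
    (hv : ∀ n, p + 2 < n → v n = 0) (hN : v (p + 2) ≠ 0) :
    w = 0 ∧ v = Pi.single (p + 2) (v (p + 2)) := by
  obtain ⟨τ, hτ⟩ := hm.euler_lagrange
  have hlow : ∀ n < p + 1, v n = 0 := fun n hn => hm.coeff_eq_zero hv hN n (by omega)
  set a1 := wt (p + 2 + (p + 2)) (p + 1) with ha1
  set a2 := wt (p + 2 + (p + 2)) (p + 2) with ha2
  set b1 := wt (p + 1 + (p + 1)) (p + 2) with hb1
  set b2 := wt (p + 1 + (p + 1)) (p + 1) with hb2
  -- With N = p + 2, this is the equation at l = N + 1, one level above the support.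
  have hupper : 2 * (a1 : ℂ) * a2 * (starRingEnd ℂ) (v (p + 1)) * v (p + 2) +
      μ * (√((p : ℝ) + 3) : ℂ) * (starRingEnd ℂ) w = 0 := by
    have h1 := hτ (p + 3)
    have hg : gradC v (p + 3) = (a1 : ℂ) * ((starRingEnd ℂ) (v (p + 1)) * (a2 * v (p + 2) ^ 2)) := by
      rw [gradC_eq_sum hv, Finset.sum_eq_single (p + 1),
        show p + 1 + (p + 3) = p + 2 + (p + 2) by ring, quad_add_self]
      · intro a b hab hne
        rcases lt_or_ge (p + 2) a with h | h
        · exact Or.inl (hv a h)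
        · exact Or.inr (hv b (by omega))
      · intro j _ hj
        rcases lt_or_gt_of_ne hj with h | h
        · rw [hlow j h, map_zero, zero_mul, mul_zero]
        · rw [quad_eq_zero hv (by omega), mul_zero, mul_zero]
      · intro h
        exact absurd (Finset.mem_range.2 (by omega)) h
    have s1 : shiftC w v (p + 3) = (√((p : ℝ) + 3) : ℂ) * v (p + 2) := by
      rw [shiftC, hv (p + 3) (by omega), mul_zero, add_zero]
      push_cast
      rfl
    have s2 : shiftC w v (p + 3 + 1) = 0 := by
      rw [shiftC, hv (p + 3 + 1 - 1) (by omega), hv (p + 3 + 1) (by omega), mul_zero, mul_zero,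
        add_zero]
    rw [hg, s1, s2, hv (p + 3) (by omega)] at h1
    refine mul_right_cancel₀ hN ?_
    linear_combination h1
  -- This is the equation at l = N - 2, one level below the two remaining coefficients.
  have hlower : (2 * (b1 : ℂ) * b2 * (starRingEnd ℂ) (v (p + 2)) * v (p + 1) +
      μ * (√((p : ℝ) + 1) : ℂ) * w) * v (p + 1) = 0 := by
    have h1 := hτ p
    have hg : gradC v p = (b1 : ℂ) * ((starRingEnd ℂ) (v (p + 2)) * (b2 * v (p + 1) ^ 2)) := by
      rw [gradC_eq_sum hv, Finset.sum_eq_single (p + 2),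
        show p + 2 + p = p + 1 + (p + 1) by ring, quad_add_self]
      · intro a b hab hne
        rcases lt_or_ge a (p + 1) with h | h
        · exact Or.inl (hlow a h)
        · exact Or.inr (hlow b (by omega))
      · intro j hjr hj
        have := Finset.mem_range.1 hjr
        rw [quad_eq_zero_of_lt hlow (by omega), mul_zero, mul_zero]
      · intro h
        exact absurd (Finset.mem_range.2 (by omega)) h
    have s1 : shiftC w v p = 0 := by
      rw [shiftC, hlow (p - 1) (by omega), hlow p (by omega), mul_zero, mul_zero, add_zero]
    have s2 : shiftC w v (p + 1) = w * v (p + 1) := by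
      rw [shiftC, Nat.add_sub_cancel, hlow p (by omega), mul_zero, zero_add]
    rw [hg, s1, s2, hlow p (by omega)] at h1
    linear_combination h1
  have hv1 : v (p + 1) = 0 := by
    -- Conjugating the upper equation and eliminating w leaves a relation between weights alone,
    -- excluded by `wt_product_lt`.
    by_contra h0
    have h2 := (mul_eq_zero.1 hlower).resolve_right h0
    have h1 := congrArg (starRingEnd ℂ) hupper
    simp only [map_add, map_mul, Complex.conj_conj, Complex.conj_ofReal, map_ofNat, map_zero] at h1
    have h3 : ((a1 * a2 * √((p : ℝ) + 1) - b1 * b2 * √((p : ℝ) + 3) : ℝ) : ℂ) *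
        (v (p + 1) * (starRingEnd ℂ) (v (p + 2))) = 0 := by
      push_cast
      linear_combination (√((p : ℝ) + 1) : ℂ) / 2 * h1 - (√((p : ℝ) + 3) : ℂ) / 2 * h2
    have h4 : v (p + 1) * (starRingEnd ℂ) (v (p + 2)) ≠ 0 := by simpa [h0] using hN
    have h5 : a1 * a2 * √((p : ℝ) + 1) = b1 * b2 * √((p : ℝ) + 3) := by
      have := (mul_eq_zero.1 h3).resolve_right h4
      rw [Complex.ofReal_eq_zero] at this
      linarith
    have h6 := congrArg (· ^ 2) h5
    simp only [mul_pow _ (√_)] at h6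
    rw [Real.sq_sqrt (by positivity), Real.sq_sqrt (by positivity)] at h6
    exact (wt_product_lt p).ne h6
  refine ⟨?_, ?_⟩
  · rw [hv1, map_zero, mul_zero, zero_mul, zero_add] at hupper
    have h1 : (√((p : ℝ) + 3) : ℂ) ≠ 0 := by
      exact_mod_cast (Real.sqrt_pos.2 (by positivity : (0 : ℝ) < p + 3)).ne'
    simpa [hμ.ne', h1] using hupper
  · ext n
    rcases lt_trichotomy n (p + 2) with h | rfl | h
    · rw [Pi.single_eq_of_ne h.ne]
      rcases (Nat.lt_succ_iff.1 h).eq_or_lt with rfl | h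
      · exact hv1
      · exact hlow n h
    · rw [Pi.single_eq_same]
    · rw [Pi.single_eq_of_ne h.ne', hv n h]

/-! ### From coefficients back to global minimisers -/

theorem quartC_single_norm (n : ℕ) (a : ℂ) :
    quartC (Pi.single n a) = wt (n + n) n ^ 2 * ‖a‖ ^ 4 := by
  have h : quad (Pi.single n a) = Pi.single (n + n) ((wt (n + n) n : ℂ) * (a * a)) :=
    bil_single_single n n a a
  have h2 : quartC (Pi.single n a) = massC (quad (Pi.single n a)) := rfl
  rw [h2, h, massC_single, norm_sq_ofReal_mul, norm_mul]
  ring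

theorem momC_single_norm (n : ℕ) (a : ℂ) : momC 0 (Pi.single n a) = (n + 1) * ‖a‖ ^ 2 := by
  rw [momC_zero (tame_single n a), massC_single, angC_single]
  ring

theorem IsMinC.single_one {μ : ℝ} {n : ℕ} {a : ℂ} (h : IsMinC μ 0 (Pi.single n a)) :
    IsMinC μ 0 (Pi.single n 1) := by
  have ha : ‖a‖ = 1 := by
    have := h.2.1
    rw [massC_single] at this
    exact (pow_eq_one_iff_of_nonneg (norm_nonneg a) two_ne_zero).1 this
  refine ⟨tame_single n 1, by rw [massC_single, norm_one, one_pow], fun d hd h1 => ?_⟩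
  refine le_trans (le_of_eq ?_) (h.2.2 d hd h1)
  rw [quartC_single_norm, quartC_single_norm, momC_single_norm, momC_single_norm, ha, norm_one]

theorem IsMinC.vortexMin {μ : ℝ} (h : IsMinC μ 0 (Pi.single 1 1)) : VortexMin μ := by
  intro c hc h1
  have h2 := h.2.2 c hc h1
  rw [quartC_single_norm, momC_single_norm, momC_zero hc, h1, wt_sq] at h2
  norm_num at h2
  linarith

theorem not_isMinC_of_two_le {μ : ℝ} (hμ : 0 < μ) {w : ℂ} {v : ℕ → ℂ} {N : ℕ}
    (hv : ∀ n, N < n → v n = 0) (hN : v N ≠ 0) (h2 : 2 ≤ N) : ¬ IsMinC μ w v := by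
  intro hm
  obtain ⟨p, rfl⟩ := Nat.exists_eq_add_of_le' h2
  obtain ⟨rfl, h1⟩ := hm.eq_single hμ hv hN
  rw [h1] at hm
  exact not_isMinC_single hμ h2 hm.single_one

theorem IsGlobalMinimizer.isMinC {μ : ℝ} {u : ℂ → ℂ} (hu : IsGlobalMinimizer μ u)
    {v : ℕ → ℂ} {w : ℂ} (hv : Tame v) (h1 : massC v = 1) (huv : u = fockState v w) :
    IsMinC μ w v := by
  refine ⟨hv, h1, fun d hd hd1 => ?_⟩
  have h := hu.2 _ (fockState_mem_unitMass (summable_norm_sq_of_tame hd) hd1 w)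
  rw [huv, energy_fockState hv h1, energy_fockState hd hd1, EReal.coe_le_coe_iff] at h
  linarith

theorem IsGlobalMinimizer.exists_coeff {μ : ℝ} (hμ : 0 < μ) {u : ℂ → ℂ}
    (hu : IsGlobalMinimizer μ u) : ∃ c, Tame c ∧ massC c = 1 ∧ u = fockState c 0 := by
  obtain ⟨c, hc, h1, rfl⟩ := exists_coeff_of_mem_unitMass hu.1
  refine ⟨c, tame_of_energy_ne_top hc h1 hμ ?_, h1, rfl⟩
  have t := tame_single 1 1
  have m : massC (Pi.single 1 1) = 1 := by rw [massC_single, norm_one, one_pow]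
  have h := hu.2 _ (fockState_mem_unitMass (summable_norm_sq_of_tame t) m 0)
  rw [energy_fockState t m] at h
  exact ne_top_of_le_ne_top (EReal.coe_ne_top _) h

/-- A minimiser with finitely many zeros forces the vortex state to be minimal. -/
theorem IsGlobalMinimizer.vortexMin_of_finite {μ : ℝ} (hμ : 0 < μ) (hμ2 : μ < 1 / 2) {u : ℂ → ℂ}
    (hu : IsGlobalMinimizer μ u) (hfin : {z | u z = 0}.Finite) : VortexMin μ := by
  obtain ⟨c, hc, h1, huc⟩ := hu.exists_coeff hμ
  have hz : {z | fockFun c z = 0} = {z | u z = 0} := by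
    ext z
    simp [huc, fockState_zero_apply, Complex.exp_ne_zero]
  obtain ⟨p, α, β, hp, hα, hf⟩ := exists_factorization_fockFun hc h1 (hz ▸ hfin)
  obtain ⟨ρ, C, hρ, hρ1, hC⟩ := exists_bound_of_eq_exp (summable_norm_sq_of_tame hc) hα hf
  have hm := hu.isMinC hc h1 huc
  have hα0 : α = 0 := quadratic_exponent_eq_zero hp hf fun r hr =>
    hm.superexponential_decay hμ hρ hρ1 hC hr
  obtain ⟨P, -, hP⟩ := exists_translate (c := c) (p := p) (β := β) fun z => by
    rw [hf, hα0, zero_mul, zero_add]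
  have tP := tame_polyC P
  have mP : massC (polyC P) = 1 := by rw [← massC_eq_of_fockState_eq hc tP hP, h1]
  have hmP := hu.isMinC tP mP (huc.trans hP)
  have hP0 : P ≠ 0 := by
    rintro rfl
    simp [massC, polyC] at mP
  have hN : polyC P P.natDegree ≠ 0 := by
    rw [polyC]
    exact mul_ne_zero (Polynomial.leadingCoeff_ne_zero.2 hP0) (sqrt_pi_factorial_ne_zero _)
  have hv : ∀ n, P.natDegree < n → polyC P n = 0 := fun n => polyC_eq_zero
  rcases le_or_gt 2 P.natDegree with h2 | h2
  · exact absurd hmP (not_isMinC_of_two_le hμ hv hN h2)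
  · have hv1 : ∀ n, 1 < n → polyC P n = 0 := fun n hn => hv n (by omega)
    have h3 := hu.2 _ (fockState_mem_unitMass (summable_norm_sq_of_tame (tame_single 1 1))
      (by rw [massC_single, norm_one, one_pow]) 0)
    rw [huc, hP, energy_fockState tP mP, energy_fockState (tame_single 1 1)
      (by rw [massC_single, norm_one, one_pow]), EReal.coe_le_coe_iff, quartC_single_norm,
      momC_single_norm, wt_sq] at h3
    norm_num at h3
    -- A polynomial of degree at most one whose energy does not exceed that of φ₁ is φ₁ itself up to
    -- phase, with no translation.
    obtain ⟨z0, z1, hw⟩ := two_level_rigidity hv1 mP hμ h3 (Or.inl hμ2)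
    have hs : polyC P = Pi.single 1 (polyC P 1) := by
      ext n
      rcases eq_or_ne n 1 with rfl | hn
      · rw [Pi.single_eq_same]
      · rw [Pi.single_eq_of_ne hn]
        rcases n with _ | n
        · exact z0
        · exact hv1 _ (by omega)
    rw [hw, hs] at hmP
    exact hmP.single_one.vortexMin

theorem fockState_single_one (a z : ℂ) : fockState (Pi.single 1 a) 0 z = a * phi1 z := by
  have h : fockFun (Pi.single 1 a) z = a * ((1 / √Real.pi : ℝ) : ℂ) * z := by
    rw [fockFun, tsum_eq_single 1 fun n hn => by rw [taylorC, Pi.single_eq_of_ne hn]; simp]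
    rw [taylorC, Pi.single_eq_same, Nat.factorial_one, Nat.cast_one, mul_one, pow_one]
    push_cast
    ring
  rw [fockState_zero_apply, h, phi1]
  ring

theorem VortexMin.isGlobalMinimizer_phi1 {μ : ℝ} (hμ : 0 < μ) (h : VortexMin μ) :
    IsGlobalMinimizer μ phi1 := by
  have t := tame_single 1 1
  have m : massC (Pi.single 1 1) = 1 := by rw [massC_single, norm_one, one_pow]
  have hphi : phi1 = fockState (Pi.single 1 1) 0 := by
    ext z
    rw [fockState_single_one, one_mul]
  rw [hphi]
  refine ⟨fockState_mem_unitMass (summable_norm_sq_of_tame t) m 0, fun u hu => ?_⟩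
  obtain ⟨c, hc, h1, rfl⟩ := exists_coeff_of_mem_unitMass hu
  by_cases hE : energy μ (fockState c 0) = ⊤
  · rw [hE]
    exact le_top
  · have hT := tame_of_energy_ne_top hc h1 hμ hE
    rw [energy_fockState t m, energy_fockState hT h1, EReal.coe_le_coe_iff]
    linarith [h.isMinC.2.2 c hT h1]

theorem VortexMin.unique {s μ : ℝ} (hs : VortexMin s) (h1 : s < μ) (h2 : μ < 1 / 2) {u : ℂ → ℂ}
    (hu : IsGlobalMinimizer μ u) : ∃ γ θ : ℝ, u = phaseRotation γ (spaceRotation θ phi1) := by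
  have hμ : 0 < μ := by linarith [hs.ge]
  obtain ⟨c, hc, hm, rfl⟩ := hu.exists_coeff hμ
  have h3 := (hu.isMinC hc hm rfl).2.2 _ (tame_single 1 1)
    (by rw [massC_single, norm_one, one_pow])
  rw [quartC_single_norm, momC_single_norm, momC_zero hc, hm, wt_sq] at h3
  norm_num at h3
  obtain ⟨hc1, hc0⟩ := hs.rigidity h1 h2 hc hm (by linarith)
  -- A space rotation of φ₁ is a phase rotation, so θ = 0 suffices.
  refine ⟨(c 1).arg, 0, ?_⟩
  have hs : c = Pi.single 1 (c 1) := by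
    ext n
    rcases eq_or_ne n 1 with rfl | hn
    · rw [Pi.single_eq_same]
    · rw [Pi.single_eq_of_ne hn, hc0 n hn]
  have harg : Complex.exp (Complex.I * ((c 1).arg : ℝ)) = c 1 := by
    have := Complex.norm_mul_exp_arg_mul_I (c 1)
    rwa [hc1, Complex.ofReal_one, one_mul, mul_comm] at this
  ext z
  rw [phaseRotation, spaceRotation, harg, hs, fockState_single_one, Pi.single_eq_same]
  simp

end LLL

end

theorem theorem1p4 :
    ∃ μ₀ : ℝ, μ₀ ∈ Set.Ico (5 / 32 : ℝ) (1 / 2) ∧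
      (∀ μ : ℝ, μ ∈ Set.Ioo μ₀ (1 / 2) →
        LLL.IsGlobalMinimizer μ LLL.phi1 ∧
        ∀ u : ℂ → ℂ, LLL.IsGlobalMinimizer μ u →
          ∃ γ θ : ℝ, u = LLL.phaseRotation γ (LLL.spaceRotation θ LLL.phi1)) ∧
      (∀ μ : ℝ, 0 < μ → μ < μ₀ →
        ∀ u : ℂ → ℂ, LLL.IsGlobalMinimizer μ u → {z : ℂ | u z = 0}.Infinite) := by
  obtain ⟨ε, hε, -, hV⟩ := LLL.exists_vortexMin
  have hbdd : BddBelow {μ | LLL.VortexMin μ} := ⟨5 / 32, fun μ hμ => hμ.ge⟩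
  have hlt : sInf {μ | LLL.VortexMin μ} < 1 / 2 := (csInf_le hbdd hV).trans_lt (by linarith)
  have hge : 5 / 32 ≤ sInf {μ | LLL.VortexMin μ} := le_csInf ⟨_, hV⟩ fun μ hμ => hμ.ge
  -- Above the infimum there is always a point of the set strictly between it and μ, as uniqueness
  -- requires; below it, a minimiser with finitely many zeros would place μ in the set.
  refine ⟨sInf {μ | LLL.VortexMin μ}, ⟨hge, hlt⟩, fun μ hμ => ?_, fun μ hμ hμ0 u hu hfin => ?_⟩
  · obtain ⟨s, hs, hsμ⟩ := exists_lt_of_csInf_lt ⟨_, hV⟩ hμ.1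
    exact ⟨(LLL.VortexMin.mono hs hsμ.le hμ.2).isGlobalMinimizer_phi1 (by linarith [hμ.1]),
      fun u hu => LLL.VortexMin.unique hs hsμ hμ.2 hu⟩
  · have := csInf_le hbdd (hu.vortexMin_of_finite hμ (hμ0.trans hlt) hfin)
    linarith
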